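/- Let $F$ be a non-Archimedean local field of characteristic zero, let $D$ be a finite-dimensional central simple algebra over $F$ (for instance a central division algebra), with its canonical topology as a finite-dimensional $F$-vector space, and let $\psi:F\to\mathbb{C}^\times$ be a non-trivial continuous unitary additive character. Let $k\ge 1$ and let $G=\mathrm{GL}_k(D)$. Let $N=N_{k,D}\subset G$ be the group of upper triangular unipotent matrices, with the character $$\psi_{k,D}(u)=\psi\bigl(\mathrm{tr}(u_{1,2}+u_{2,3}+\cdots+u_{k-1,k})\bigr),$$ where $\mathrm{tr}:D\to F$ is the reduced trace. Let $P=P_{k,D}=\{g\in G:(0,\dots,0,1)g=(0,\dots,0,1)\}$, let $\Delta:D^\times\to G$ be the diagonal embedding, and let $\tilde P=P\cdot\Delta(D^\times)$. For $a,b\ge 1$ with $a+b=k$ let $U'_{a,b}\subset P$ be the group of matrices $\begin{pmatrix} I_a & X\\ 0& I_b\end{pmatrix}$. Let $\pi$ be an irreducible smooth complex representation of $G$. Let $\mathrm{Wh}(\pi)=\mathrm{Hom}_N(\pi,\psi_{k,D})$, let $J(\pi)=J_{N,\psi_{k,D}}(\pi)$ be the quotient of $\pi$ by the span of all vectors $\pi(u)v-\psi_{k,D}(u)v$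 ($u\in N$, $v\in\pi$), and for $\lambda\in\mathrm{Wh}(\pi)$ let $\bar\lambda:J(\pi)\to\mathbb{C}$ be the induced functional. Let $\mathcal{I}=\mathrm{ind}_N^P(J(\pi)\ltimes\psi_{k,D})$ be the space of functions $f:P\to J(\pi)$ with $f(up)=\psi_{k,D}(u)f(p)$ for $u\in N$, which are right invariant under some open subgroup of $P$ and have compact support modulo $N$; $P$ acts on it by right translation, and $d\in D^\times$ acts by $(d\cdot f)(p)=\overline{\pi(\Delta(d))}\,f(\Delta(d)^{-1}p\,\Delta(d))$, where $\overline{\pi(\Delta(d))}$ is the action of $\Delta(d)$ on $J(\pi)$. Then: 1. There is an injective linear map $\mathcal{J}:\mathcal{I}\hookrightarrow\pi$ which is $P$-equivariant and $\Delta(D^\times)$-equivariant, hence $\tilde P$-equivariant, and which satisfies $$\langle\lambda,\mathcal{J}(f)\rangle=\langle\bar\lambda,f(1)\rangle\qquad\text{for all }\lambda\in\mathrm{Wh}(\pi),\ f\in\mathcal{I}.$$ 2. The representation $\mathcal{I}$ of $P$ is $D$-cuspidal: for all $a,b\ge 1$ with $a+b=k$, the Jacquet module $J_{U'_{a,b}}(\mathcal{I})$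 (the quotient of $\mathcal{I}$ by the span of all $u\cdot f-f$ with $u\in U'_{a,b}$, $f\in\mathcal{I}$) is zero. -/

import Mathlib

noncomputable section

namespace Kirillov

/-! ### Smooth representations, twisted Jacquet modules, compact induction -/

section General

variable {G : Type*} [Group G] {V : Type*} [AddCommGroup V] [Module ℂ V]

/-- A complex representation of a topological group is smooth if the stabilizer of every vector
is open. -/
def IsSmooth [TopologicalSpace G] (ρ : Representation ℂ G V) : Prop :=
  ∀ v : V, IsOpen {g : G | ρ g v = v}

/-- The span of the vectors `ρ(h) v - χ(h) v`, for `h` in the subgroup `H` and `v` in `V`. -/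
def jacquetKer (ρ : Representation ℂ G V) (H : Subgroup G) (χ : H →* Circle) : Submodule ℂ V :=
  Submodule.span ℂ {x | ∃ (h : H) (v : V), x = ρ h v - (χ h : ℂ) • v}

/-- The twisted Jacquet module `J_{H,χ}(ρ)`: the largest quotient of `ρ` on which `H` acts
by `χ`. -/
abbrev Jacquet (ρ : Representation ℂ G V) (H : Subgroup G) (χ : H →* Circle) :=
  V ⧸ jacquetKer ρ H χ

/-- The space `Hom_H(ρ, χ)` of linear functionals `l` with `l(ρ(h) v) = χ(h) l(v)`. -/
def equivariantFunctionals (ρ : Representation ℂ G V) (H : Subgroup G) (χ : H →* Circle) :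
    Submodule ℂ (V →ₗ[ℂ] ℂ) where
  carrier := {l | ∀ (h : H) (v : V), l (ρ h v) = (χ h : ℂ) * l v}
  add_mem' := by
    intro a b ha hb h v
    simp only [LinearMap.add_apply, ha h v, hb h v]
    ring
  zero_mem' := by intro h v; simp
  smul_mem' := by
    intro c a ha h v
    simp only [LinearMap.smul_apply, ha h v, smul_eq_mul]
    ring

/-- The functional on `J_{H,χ}(ρ)` obtained from an element of `Hom_H(ρ, χ)`. -/
def descend {ρ : Representation ℂ G V} {H : Subgroup G} {χ : H →* Circle}
    (l : equivariantFunctionals ρ H χ) : Jacquet ρ H χ →ₗ[ℂ] ℂ :=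
  (jacquetKer ρ H χ).liftQ l.1 (by
    refine Submodule.span_le.2 ?_
    rintro x ⟨h, v, rfl⟩
    simp [l.2 h v])

/-- If `g` normalizes `(H, χ)`, then `ρ(g)` acts on `J_{H,χ}(ρ)`. -/
def jacquetAct (ρ : Representation ℂ G V) (H : Subgroup G) (χ : H →* Circle) (g : G)
    (hg : ∀ h : H, ∃ h' : H, (h' : G) = g * h * g⁻¹ ∧ χ h' = χ h) :
    Jacquet ρ H χ →ₗ[ℂ] Jacquet ρ H χ :=
  (jacquetKer ρ H χ).mapQ (jacquetKer ρ H χ) (ρ g) (by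
    refine Submodule.span_le.2 ?_
    rintro x ⟨h, v, rfl⟩
    obtain ⟨h', e, hχ⟩ := hg h
    refine Submodule.subset_span ⟨h', ρ g v, ?_⟩
    rw [hχ, e, map_sub, map_smul, ← Module.End.mul_apply, ← Module.End.mul_apply, ← map_mul,
      ← map_mul]
    simp)

/-- The representation of `H` on the vector space `W` through the character `χ`. -/
def scalarRep {H : Type*} [Group H] (χ : H →* Circle) (W : Type*) [AddCommGroup W] [Module ℂ W] :
    Representation ℂ H W where
  toFun h := (χ h : ℂ) • LinearMap.id
  map_one' := by ext; simp
  map_mul' a b := by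
    ext w
    change ((χ (a * b) : Circle) : ℂ) • w = (χ a : ℂ) • (χ b : ℂ) • w
    rw [map_mul, Circle.coe_mul, mul_smul]

variable [TopologicalSpace G] [IsTopologicalGroup G]

/-- The space of the compactly induced representation `ind_H^G σ`: functions `f : G → W` with
`f(hg) = σ(h) f(g)` which are right invariant under some open subgroup and whose support is
compact modulo `H`. -/
def cInd {H : Subgroup G} {W : Type*} [AddCommGroup W] [Module ℂ W]
    (σ : Representation ℂ H W) : Submodule ℂ (G → W) where
  carrier := {f | (∀ (h : H) (g : G), f (h * g) = σ h (f g)) ∧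
    (∃ K : OpenSubgroup G, ∀ k ∈ K, ∀ g : G, f (g * k) = f g) ∧
    (∃ C : Set G, IsCompact C ∧ ∀ g : G, f g ≠ 0 → ∃ h : H, ∃ c ∈ C, g = h * c)}
  add_mem' := by
    rintro f₁ f₂ ⟨e₁, ⟨K₁, hK₁⟩, ⟨C₁, c₁, hC₁⟩⟩ ⟨e₂, ⟨K₂, hK₂⟩, ⟨C₂, c₂, hC₂⟩⟩
    refine ⟨fun h g => by simp [e₁, e₂], ⟨K₁ ⊓ K₂, fun k hk g => ?_⟩,
      ⟨C₁ ∪ C₂, c₁.union c₂, fun g hg => ?_⟩⟩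
    · have hk' := OpenSubgroup.mem_inf.1 hk
      simp [hK₁ k hk'.1 g, hK₂ k hk'.2 g]
    · by_cases h₁ : f₁ g = 0
      · have h₂ : f₂ g ≠ 0 := by
          intro h₂
          exact hg (by simp [h₁, h₂])
        obtain ⟨h, c, hc, e⟩ := hC₂ g h₂
        exact ⟨h, c, Or.inr hc, e⟩
      · obtain ⟨h, c, hc, e⟩ := hC₁ g h₁
        exact ⟨h, c, Or.inl hc, e⟩
  zero_mem' := ⟨fun h g => by simp, ⟨⊤, fun k _ g => rfl⟩, ⟨∅, isCompact_empty, fun g hg => by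
    simp at hg⟩⟩
  smul_mem' := by
    rintro a f ⟨e, ⟨K, hK⟩, ⟨C, c, hC⟩⟩
    refine ⟨fun h g => by simp [e], ⟨K, fun k hk g => by simp [hK k hk g]⟩,
      ⟨C, c, fun g hg => hC g ?_⟩⟩
    intro h
    exact hg (by simp [h])

/-- The action of `G` on `ind_H^G σ` by right translation: `(g · f)(x) = f(xg)`. -/
def cIndRep {H : Subgroup G} {W : Type*} [AddCommGroup W] [Module ℂ W]
    (σ : Representation ℂ H W) : Representation ℂ G (cInd σ) where
  toFun g :=
    { toFun := fun f => ⟨fun x => f.1 (x * g), by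
        obtain ⟨e, ⟨K, hK⟩, ⟨C, c, hC⟩⟩ := f.2
        refine ⟨fun h x => by simp only [mul_assoc, e], ⟨K.comap (MulAut.conj g⁻¹).toMonoidHom ?_, ?_⟩,
          ⟨(fun x => x * g⁻¹) '' C, c.image (continuous_mul_const _), ?_⟩⟩
        · change Continuous fun x => g⁻¹ * x * g⁻¹⁻¹
          fun_prop
        · intro k hk x
          have hk' : g⁻¹ * k * g⁻¹⁻¹ ∈ K := hk
          have := hK _ hk' (x * g)
          change f.1 (x * k * g) = f.1 (x * g)
          rw [← this]
          group
        · intro x hx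
          obtain ⟨h, y, hy, e'⟩ := hC _ hx
          exact ⟨h, y * g⁻¹, ⟨y, hy, rfl⟩, by rw [← mul_assoc, ← e']; group⟩⟩
      map_add' := fun _ _ => rfl
      map_smul' := fun _ _ => rfl }
  map_one' := by ext f x; simp
  map_mul' a b := by ext f x; simp [mul_assoc]

/-- Transport of structure on `ind_H^G σ`: given an automorphism `θ` of `G` preserving `H`, and an
endomorphism `T` of the coefficient space with `T σ(h) = σ(θ(h)) T`, the operator sending `f` to
the function `x ↦ T (f (θ⁻¹ x))`. -/
def cIndTransport {H : Subgroup G} {W : Type*} [AddCommGroup W] [Module ℂ W]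
    (σ : Representation ℂ H W) (θ : G ≃* G) (hθ : Continuous θ) (hθ' : Continuous θ.symm)
    (T : W →ₗ[ℂ] W)
    (hT : ∀ h : H, ∃ h' : H, (h' : G) = θ h ∧ ∀ w, T (σ h w) = σ h' (T w))
    (hH : ∀ h : H, θ.symm h ∈ H) : cInd σ →ₗ[ℂ] cInd σ where
  toFun f := ⟨fun x => T (f.1 (θ.symm x)), by
    obtain ⟨e, ⟨K, hK⟩, ⟨C, c, hC⟩⟩ := f.2
    refine ⟨fun h x => ?_, ⟨K.comap θ.symm.toMonoidHom hθ', fun k hk x => ?_⟩,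
      ⟨θ '' C, c.image hθ, fun x hx => ?_⟩⟩
    · obtain ⟨h', e', hT'⟩ := hT ⟨_, hH h⟩
      have e'' : h' = h := by
        apply Subtype.ext
        rw [e']
        simp
      rw [e''] at hT'
      change T (f.1 (θ.symm (h * x))) = σ h (T (f.1 (θ.symm x)))
      rw [map_mul, ← hT', ← e]
    · have hk' : θ.symm k ∈ K := hk
      change T (f.1 (θ.symm (x * k))) = T (f.1 (θ.symm x))
      rw [map_mul, hK _ hk']
    · have hx' : f.1 (θ.symm x) ≠ 0 := by
        intro h
        exact hx (by simp [h])
      obtain ⟨h, y, hy, e'⟩ := hC _ hx'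
      obtain ⟨h', e'', -⟩ := hT h
      refine ⟨h', θ y, ⟨y, hy, rfl⟩, ?_⟩
      rw [e'', ← map_mul, ← e']
      simp⟩
  map_add' f₁ f₂ := by ext x; simp
  map_smul' a f := by ext x; simp

end General

/-! ### The groups -/

section Groups

/-- `GL_k(D)`, with its unit group topology when `D` is a topological ring. -/
abbrev GLk (k : ℕ) (D : Type*) [Ring D] := (Matrix (Fin k) (Fin k) D)ˣ

variable (k : ℕ) (D : Type*) [Ring D]

/-- The unipotent group of matrices `g` with `g i j = δ i j` unless `r i j`, where `r` is
a transitive relation with `r i j → i < j`. -/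
def unipotent (r : Fin k → Fin k → Prop) (hlt : ∀ i j, r i j → i < j)
    (htr : ∀ i j l, r i j → r j l → r i l) : Subgroup (GLk k D) where
  carrier := {g | ∀ i j, ¬ r i j → g.1 i j = (1 : Matrix (Fin k) (Fin k) D) i j}
  one_mem' := fun _ _ _ => rfl
  mul_mem' := by
    intro g h hg hh i j hij
    have hii : ¬ r i i := fun h => lt_irrefl _ (hlt _ _ h)
    have hi : g.1 i i = 1 := by rw [hg i i hii, Matrix.one_apply_eq]
    rw [Units.val_mul, Matrix.mul_apply, Finset.sum_eq_single i]
    · rw [hi, one_mul, hh i j hij]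
    · intro l _ hl
      by_cases hil : r i l
      · have hlj : ¬ r l j := fun h' => hij (htr _ _ _ hil h')
        have hne : l ≠ j := by rintro rfl; exact hij hil
        rw [hh l j hlj, Matrix.one_apply_ne hne, mul_zero]
      · rw [hg i l hil, Matrix.one_apply_ne hl.symm, zero_mul]
    · simp
  inv_mem' := by
    intro g hg
    have key : ∀ n : ℕ, ∀ i j : Fin k, k - i.val = n → ¬ r i j →
        (g⁻¹).1 i j = (1 : Matrix (Fin k) (Fin k) D) i j := by
      intro n
      induction n using Nat.strong_induction_on with
      | _ n ih =>
        intro i j hn hij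
        have hii : ¬ r i i := fun h => lt_irrefl _ (hlt _ _ h)
        have hi : g.1 i i = 1 := by rw [hg i i hii, Matrix.one_apply_eq]
        have hm : (g.1 * (g⁻¹).1) i j = (1 : Matrix (Fin k) (Fin k) D) i j := by
          rw [Units.mul_inv]
        rw [Matrix.mul_apply, Finset.sum_eq_single i] at hm
        · rwa [hi, one_mul] at hm
        · intro l _ hl
          by_cases hil : r i l
          · have hlj : ¬ r l j := fun h' => hij (htr _ _ _ hil h')
            have hne : l ≠ j := by rintro rfl; exact hij hil
            have hlt' : i.val < l.val := hlt _ _ hil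
            have := l.isLt
            rw [ih (k - l.val) (by omega) l j rfl hlj, Matrix.one_apply_ne hne, mul_zero]
          · rw [hg i l hil, Matrix.one_apply_ne hl.symm, zero_mul]
        · simp
    intro i j hij
    exact key _ i j rfl hij

/-- `N_{k,D}`: the upper triangular unipotent matrices. -/
def N : Subgroup (GLk k D) :=
  unipotent k D (fun i j => i < j) (fun _ _ h => h) (fun _ _ _ h h' => h.trans h')

/-- `U'_{a,b}` with `a + b = k`: the matrices `[[1, X], [0, 1]]` with `X` of size `a × b`. -/
def U (a : ℕ) : Subgroup (GLk k D) :=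
  unipotent k D (fun i j => i.val < a ∧ a ≤ j.val)
    (fun _ _ h => Fin.lt_def.2 (lt_of_lt_of_le h.1 h.2))
    (fun _ _ _ h h' => ⟨h.1, h'.2⟩)

/-- The row vector `(0, …, 0, 1)`. -/
def lastRow : Fin k → D := fun j => if j.val + 1 = k then 1 else 0

/-- The mirabolic subgroup `P_{k,D}`: the stabilizer of the row vector `(0, …, 0, 1)`. -/
def P : Subgroup (GLk k D) where
  carrier := {g | Matrix.vecMul (lastRow k D) g.1 = lastRow k D}
  one_mem' := by simp
  mul_mem' := by
    intro g h hg hh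
    change Matrix.vecMul _ (g.1 * h.1) = _
    rw [← Matrix.vecMul_vecMul, hg, hh]
  inv_mem' := by
    intro g hg
    have hg' : Matrix.vecMul (lastRow k D) g.1 = lastRow k D := hg
    have h : Matrix.vecMul (Matrix.vecMul (lastRow k D) g.1) (g⁻¹).1 = lastRow k D := by
      rw [Matrix.vecMul_vecMul, Units.mul_inv, Matrix.vecMul_one]
    rwa [hg'] at h

/-- The diagonal embedding `Dˣ → GL_k(D)`. -/
def diag : Dˣ →* GLk k D := Units.map (Matrix.scalar (Fin k) : D →+* _).toMonoidHom

variable {k D}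

theorem diag_conj_apply (d : Dˣ) (g : GLk k D) (i j : Fin k) :
    (diag k D d * g * (diag k D d)⁻¹).1 i j = d.1 * g.1 i j * (d⁻¹).1 := by
  rw [← map_inv]
  simp [diag, Matrix.scalar_apply, Matrix.mul_diagonal, Matrix.diagonal_mul]

theorem diag_conj_mem_N (d : Dˣ) {g : GLk k D} (hg : g ∈ N k D) :
    diag k D d * g * (diag k D d)⁻¹ ∈ N k D := by
  intro i j hij
  rw [diag_conj_apply, hg i j hij]
  by_cases h : i = j
  · subst h; simp
  · simp [Matrix.one_apply_ne h]

theorem diag_conj_mem_P (d : Dˣ) {g : GLk k D} (hg : g ∈ P k D) :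
    diag k D d * g * (diag k D d)⁻¹ ∈ P k D := by
  have hg' : Matrix.vecMul (lastRow k D) g.1 = lastRow k D := hg
  change Matrix.vecMul (lastRow k D) _ = _
  ext j
  have e : ∀ h : GLk k D, ∀ j, Matrix.vecMul (lastRow k D) h.1 j
      = ∑ i, (if i.val + 1 = k then h.1 i j else 0) := by
    intro h j
    simp [Matrix.vecMul, dotProduct, lastRow]
  have hj := congrFun hg' j
  rw [e] at hj ⊢
  simp only [diag_conj_apply]
  have : ∀ i : Fin k, (if i.val + 1 = k then d.1 * g.1 i j * (d⁻¹).1 else 0)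
      = d.1 * (if i.val + 1 = k then g.1 i j else 0) * (d⁻¹).1 := by
    intro i
    split_ifs <;> simp
  simp only [this]
  rw [← Finset.sum_mul, ← Finset.mul_sum, hj]
  unfold lastRow
  split_ifs <;> simp

/-- Conjugation `p ↦ δ p δ⁻¹` by the diagonal element `δ` attached to `d`, as an automorphism
of `P_{k,D}`. -/
def conjP (d : Dˣ) : P k D ≃* P k D where
  toFun p := ⟨diag k D d * p * (diag k D d)⁻¹, diag_conj_mem_P d p.2⟩
  invFun p := ⟨(diag k D d)⁻¹ * p * diag k D d, by
    have := diag_conj_mem_P (k := k) d⁻¹ p.2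
    rwa [map_inv, inv_inv] at this⟩
  left_inv p := by
    apply Subtype.ext
    change (diag k D d)⁻¹ * (diag k D d * (p : GLk k D) * (diag k D d)⁻¹) * diag k D d = p
    group
  right_inv p := by
    apply Subtype.ext
    change diag k D d * ((diag k D d)⁻¹ * (p : GLk k D) * diag k D d) * (diag k D d)⁻¹ = p
    group
  map_mul' p q := by
    apply Subtype.ext
    change diag k D d * ((p : GLk k D) * q) * (diag k D d)⁻¹ =
      (diag k D d * (p : GLk k D) * (diag k D d)⁻¹) * (diag k D d * (q : GLk k D) *
        (diag k D d)⁻¹)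
    group

/-- The sum of the superdiagonal entries `X_{12} + X_{23} + ⋯ + X_{k-1,k}`. -/
def superdiagSum (g : Matrix (Fin k) (Fin k) D) : D :=
  ∑ i : Fin k, ∑ j : Fin k, if i.val + 1 = j.val then g i j else 0

theorem superdiagSum_one : superdiagSum (1 : Matrix (Fin k) (Fin k) D) = 0 := by
  refine Finset.sum_eq_zero fun i _ => Finset.sum_eq_zero fun j _ => ?_
  split_ifs with h
  · refine Matrix.one_apply_ne ?_
    rintro rfl
    omega
  · rfl

theorem superdiagSum_mul {g h : GLk k D} (hg : g ∈ N k D) (hh : h ∈ N k D) :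
    superdiagSum (g.1 * h.1) = superdiagSum g.1 + superdiagSum h.1 := by
  unfold superdiagSum
  rw [← Finset.sum_add_distrib]
  refine Finset.sum_congr rfl fun i _ => ?_
  rw [← Finset.sum_add_distrib]
  refine Finset.sum_congr rfl fun j _ => ?_
  split_ifs with hij
  · have hne : i ≠ j := by rintro rfl; omega
    have hgi : g.1 i i = 1 := by rw [hg i i (lt_irrefl _), Matrix.one_apply_eq]
    have hhj : h.1 j j = 1 := by rw [hh j j (lt_irrefl _), Matrix.one_apply_eq]
    rw [Matrix.mul_apply, Finset.sum_eq_add i j hne]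
    · rw [hgi, hhj, one_mul, mul_one, add_comm]
    · rintro l - ⟨hli, hlj⟩
      have hli' : l.val ≠ i.val := fun e => hli (Fin.ext e)
      have hlj' : l.val ≠ j.val := fun e => hlj (Fin.ext e)
      by_cases hil : i < l
      · have hlj2 : ¬ l < j := by
          intro h'
          have h1 := Fin.lt_def.1 hil
          have h2 := Fin.lt_def.1 h'
          omega
        rw [hh l j hlj2, Matrix.one_apply_ne hlj, mul_zero]
      · rw [hg i l hil, Matrix.one_apply_ne hli.symm, zero_mul]
    · simp
    · simp
  · simp

theorem superdiagSum_conj (d : Dˣ) (g : GLk k D) :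
    superdiagSum (diag k D d * g * (diag k D d)⁻¹).1 = d.1 * superdiagSum g.1 * (d⁻¹).1 := by
  unfold superdiagSum
  simp only [diag_conj_apply, Finset.mul_sum, Finset.sum_mul]
  refine Finset.sum_congr rfl fun i _ => Finset.sum_congr rfl fun j _ => ?_
  split_ifs <;> simp

end Groups

/-! ### The reduced trace and the Whittaker character -/

section Whittaker

variable (F : Type*) [Field F] {D : Type*} [Ring D] [Algebra F D]

/-- The reduced trace of a central simple algebra `D` of dimension `d²` over a field `F` of
characteristic zero: `d⁻¹` times the trace of left multiplication on `D`. It agrees with the matrix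
trace after any splitting, see `algebraMap_reducedTrace`. -/
def reducedTrace : D →ₗ[F] F :=
  (Nat.sqrt (Module.finrank F D) : F)⁻¹ • (LinearMap.trace F D ∘ₗ LinearMap.mul F D)

theorem reducedTrace_mul_comm (x y : D) : reducedTrace F (x * y) = reducedTrace F (y * x) := by
  simp only [reducedTrace, LinearMap.smul_apply, LinearMap.comp_apply]
  congr 1
  have e : ∀ a b : D, LinearMap.mulLeft F (a * b)
      = LinearMap.mulLeft F a * LinearMap.mulLeft F b := fun a b => by
    ext; simp
  change LinearMap.trace F D (LinearMap.mulLeft F (x * y))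
    = LinearMap.trace F D (LinearMap.mulLeft F (y * x))
  rw [e, e, LinearMap.trace_mul_comm]

theorem trace_mulLeft_matrix {K : Type*} [Field K] {d : ℕ} (A : Matrix (Fin d) (Fin d) K) :
    LinearMap.trace K _ (LinearMap.mulLeft K A) = (d : K) * A.trace := by
  rw [LinearMap.trace_eq_matrix_trace K (Matrix.stdBasis K (Fin d) (Fin d)), Matrix.trace]
  have : ∀ p : Fin d × Fin d, (LinearMap.toMatrix (Matrix.stdBasis K (Fin d) (Fin d))
      (Matrix.stdBasis K (Fin d) (Fin d)) (LinearMap.mulLeft K A)).diag p = A p.1 p.1 := by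
    intro p
    rw [Matrix.diag_apply, LinearMap.toMatrix_apply, Matrix.stdBasis_eq_single]
    change (A * Matrix.single p.1 p.2 (1 : K)) p.1 p.2 = A p.1 p.1
    simp
  rw [Finset.sum_congr rfl fun p _ => this p, Fintype.sum_prod_type]
  simp [Matrix.trace, Finset.mul_sum]

open scoped TensorProduct in
/-- For any splitting `φ` of `D`, the reduced trace of `x` is the trace of the matrix `φ(x)`. -/
theorem algebraMap_reducedTrace [CharZero F] [FiniteDimensional F D] {K : Type*} [Field K]
    [Algebra F K] {d : ℕ} (hd : 0 < d) (φ : K ⊗[F] D ≃ₐ[K] Matrix (Fin d) (Fin d) K) (x : D) :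
    algebraMap F K (reducedTrace F x) = (φ (1 ⊗ₜ[F] x)).trace := by
  have hdim : Module.finrank F D = d * d := by
    rw [← Module.finrank_baseChange (R := K), φ.toLinearEquiv.finrank_eq, Module.finrank_matrix]
    simp
  have h1 : algebraMap F K (LinearMap.trace F D (LinearMap.mulLeft F x))
      = LinearMap.trace K _ (LinearMap.mulLeft K (φ (1 ⊗ₜ[F] x))) := by
    rw [← LinearMap.trace_baseChange, ← LinearMap.trace_conj' _ φ.toLinearEquiv]
    congr 1
    ext1 A
    obtain ⟨t, rfl⟩ := φ.surjective A
    have e : (LinearMap.mulLeft F x).baseChange K = LinearMap.mulLeft K ((1 : K) ⊗ₜ[F] x) := by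
      ext y
      simp
    rw [e]
    simp [LinearEquiv.conj_apply]
  have hd0 : (d : K) ≠ 0 := by
    have : (d : F) ≠ 0 := Nat.cast_ne_zero.2 hd.ne'
    rw [← map_natCast (algebraMap F K)]
    exact (map_ne_zero _).2 this
  have h2 : (LinearMap.trace F D ∘ₗ LinearMap.mul F D) x = LinearMap.trace F D (LinearMap.mulLeft F x) := rfl
  rw [reducedTrace, LinearMap.smul_apply, smul_eq_mul, map_mul, h2, h1, trace_mulLeft_matrix,
    hdim, Nat.sqrt_eq, map_inv₀, map_natCast, inv_mul_cancel_left₀ hd0]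

variable {F} {k : ℕ}

/-- The character `ψ_{k,D}(u) = ψ(tr(X_{12} + X_{23} + ⋯ + X_{k-1,k}))` of `N_{k,D}`, where `tr` is
the reduced trace. -/
def psiN (ψ : AddChar F Circle) (k : ℕ) (D : Type*) [Ring D] [Algebra F D] : N k D →* Circle where
  toFun u := ψ (reducedTrace F (superdiagSum u.1.1))
  map_one' := by
    change ψ (reducedTrace F (superdiagSum (1 : Matrix (Fin k) (Fin k) D))) = 1
    rw [superdiagSum_one, map_zero, AddChar.map_zero_eq_one]
  map_mul' u v := by
    change ψ (reducedTrace F (superdiagSum (u.1.1 * v.1.1))) = _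
    rw [superdiagSum_mul u.2 v.2, map_add, AddChar.map_add_eq_mul]

theorem diag_normalizes (ψ : AddChar F Circle) (d : Dˣ) (u : N k D) :
    ∃ u' : N k D, (u' : GLk k D) = diag k D d * u * (diag k D d)⁻¹ ∧
      psiN ψ k D u' = psiN ψ k D u := by
  refine ⟨⟨_, diag_conj_mem_N d u.2⟩, rfl, ?_⟩
  change ψ (reducedTrace F (superdiagSum (diag k D d * u.1 * (diag k D d)⁻¹).1)) = _
  rw [superdiagSum_conj, reducedTrace_mul_comm, ← mul_assoc, Units.inv_mul, one_mul]
  rfl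

variable {V : Type*} [AddCommGroup V] [Module ℂ V]

/-- `Wh_{(k)_D}(π) = Hom_{N_{k,D}}(π, ψ_{k,D})`. -/
abbrev Wh (ψ : AddChar F Circle) (π : Representation ℂ (GLk k D) V) :
    Submodule ℂ (V →ₗ[ℂ] ℂ) :=
  equivariantFunctionals π (N k D) (psiN ψ k D)

/-- `J_{N_{k,D}, ψ_{k,D}}(π)`. -/
abbrev WhJacquet (ψ : AddChar F Circle) (π : Representation ℂ (GLk k D) V) :=
  Jacquet π (N k D) (psiN ψ k D)

/-- `J_{N_{k,D}, ψ_{k,D}}(π) ⋉ ψ_{k,D}` as a representation of `N_{k,D}`, regarded as a subgroup of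
`P_{k,D}`. -/
abbrev inducingRep (ψ : AddChar F Circle) (π : Representation ℂ (GLk k D) V) :
    Representation ℂ ((N k D).subgroupOf (P k D)) (WhJacquet ψ π) :=
  scalarRep ((psiN ψ k D).comp ((P k D).subtype.subgroupComap (N k D))) (WhJacquet ψ π)

/-- The action of `Dˣ`, embedded diagonally, on `J_{N_{k,D}, ψ_{k,D}}(π)`. -/
def diagJacquet (ψ : AddChar F Circle) (π : Representation ℂ (GLk k D) V) (d : Dˣ) :
    WhJacquet ψ π →ₗ[ℂ] WhJacquet ψ π :=
  jacquetAct π (N k D) (psiN ψ k D) (diag k D d) (diag_normalizes ψ d)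

variable [TopologicalSpace D] [IsTopologicalRing D]

/-- The space `ind_{N_{k,D}}^{P_{k,D}} (J_{N_{k,D}, ψ_{k,D}}(π) ⋉ ψ_{k,D})`. Normalized and
unnormalized induction coincide here, as `N_{k,D}` is a union of compact subgroups, on which all
modulus characters are trivial. -/
abbrev Ind (ψ : AddChar F Circle) (π : Representation ℂ (GLk k D) V) :
    Submodule ℂ (P k D → WhJacquet ψ π) :=
  cInd (inducingRep ψ π)

/-- `ind_{N_{k,D}}^{P_{k,D}} (J_{N_{k,D}, ψ_{k,D}}(π) ⋉ ψ_{k,D})` as a representation of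
`P_{k,D}`. -/
abbrev IndRep (ψ : AddChar F Circle) (π : Representation ℂ (GLk k D) V) :
    Representation ℂ (P k D) (Ind ψ π) :=
  cIndRep (inducingRep ψ π)

/-- The action of `Dˣ`, embedded diagonally, on the induced space:
`(d · f)(p) = d · f(δ⁻¹ p δ)`, with `δ` the diagonal element attached to `d`. -/
def diagInd (ψ : AddChar F Circle) (π : Representation ℂ (GLk k D) V) (d : Dˣ) :
    Ind ψ π →ₗ[ℂ] Ind ψ π :=
  cIndTransport (inducingRep ψ π) (conjP d)
    (by
      refine Continuous.subtype_mk ?_ _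
      fun_prop)
    (by
      refine Continuous.subtype_mk ?_ _
      fun_prop)
    (diagJacquet ψ π d)
    (by
      intro u
      obtain ⟨u', e, hψ⟩ := diag_normalizes ψ d ⟨u.1.1, u.2⟩
      refine ⟨⟨⟨u'.1, ?_⟩, u'.2⟩, ?_, ?_⟩
      · rw [e]
        exact diag_conj_mem_P d u.1.2
      · exact Subtype.ext e
      · intro w
        change diagJacquet ψ π d ((psiN ψ k D ⟨u.1.1, u.2⟩ : ℂ) • w)
          = (psiN ψ k D u' : ℂ) • diagJacquet ψ π d w
        rw [hψ, map_smul])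
    (by
      intro u
      have := diag_conj_mem_N (k := k) d⁻¹ (g := u.1.1) u.2
      rw [map_inv, inv_inv] at this
      exact this)

end Whittaker

/-- A representation of `P_{k,D}` is `D`-cuspidal if its Jacquet modules along `U'_{a,b}`
vanish for all `k = a + b` with `a, b ≥ 1`. -/
def IsDCuspidal {k : ℕ} {D : Type*} [Ring D] {W : Type*} [AddCommGroup W] [Module ℂ W]
    (ρ : Representation ℂ (P k D) W) : Prop :=
  ∀ a b : ℕ, 0 < a → 0 < b → a + b = k →
    Subsingleton (Jacquet ρ ((U k D a).subgroupOf (P k D)) 1)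

end Kirillov

end

noncomputable section

set_option linter.unusedSectionVars false

namespace Kirillov

/-! ### Averages over groups of functions invariant under a subgroup of finite index -/

section Average

variable {A : Type*} [Group A] {W W' : Type*} [AddCommGroup W] [Module ℂ W]
  [AddCommGroup W'] [Module ℂ W']

/-! The Kirillov map sends `v` to the function `p ↦ [π(p) v]` on the mirabolic group, with values in
the twisted Jacquet module (`kirillovFunction`). It is compatible with `P` and with the diagonal
`Dˣ`, and a Whittaker functional at `v` depends only on the value of this function at `1`. So it is
enough to find a subspace of `π`, stable under `P` and the diagonal, on which the map is injective
and whose image contains the induced space. The embedding is then the inverse map; its linearity,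
equivariance and compatibility with Whittaker functionals follow formally.

The subspace is `kirillovCore`. Number the columns from `0`, and let `U_m` be the upper unipotent
matrices that are trivial in the columns before `m` (`unipSet k D 0 m`), so that `U_1 = N` and `U_k
= 1`. A row `y` supported on `[0, m)` defines the character `theta ψ m y` of `U_m`: it is given by
`y` on column `m` and by the Whittaker character on later columns. The unit row gives the Whittaker
character itself. Call `y` nondegenerate when it lies in the orbit of the unit row under `GL_m(D)`;
over a division algebra this means `y ≠ 0`, while over a simple algebra it means that `y` is
unimodular (`exists_unit_row`). The core consists of the vectors all of whose `P`-translates die in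
the coinvariants of every degenerate `theta ψ m y`.

Injectivity (`eq_zero_of_mem_kirillovCore`): if all `[π(p) v]` vanish, climb from `U_1` to `U_k`.
Column `m` acts smoothly on the coinvariants of `U_{m+1}`, and by Fourier inversion
(`eq_zero_of_forall_mem_twistKer`) a vector killed in the coinvariants of every character of the
column is zero. Degenerate characters are covered by the core, and nondegenerate ones are conjugate,
by `GL_m(D)` inside `P`, to the one treated before. The same climb started from the zero row at
column `a` shows that the core dies in the Jacquet module of `U'_{a,b}`
(`mem_twistKer_one_of_mem_kirillovCore`).

Surjectivity (`exists_mem_kirillovCore`): average a lift of a given class, over large lattices in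
the columns `1, …, k - 1` in turn, against the unit-row character. Each average cuts off all rows
that are not close to the unit row, and close rows are nondegenerate. The result lies in the core
and its Kirillov function is supported in `N K` for a prescribed small `K`. Averaging over `K`,
translating and adding gives every function of the induced space.

Cuspidality passes from `π` to the induced space because vanishing in coinvariants amounts to the
vanishing of an average over some lattice, which an injective equivariant map detects. -/

/-- Invariance under right translation by some subgroup of finite index. -/
def IsUniform {β : Type*} (f : A → β) : Prop :=
  ∃ S : Subgroup A, S.FiniteIndex ∧ ∀ a, ∀ s ∈ S, f (a * s) = f a

theorem IsUniform.comp {β γ : Type*} {f : A → β} (hf : IsUniform f) (g : β → γ) :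
    IsUniform (fun a => g (f a)) := by
  obtain ⟨S, h, hS⟩ := hf
  exact ⟨S, h, fun a s hs => by simp only [hS a s hs]⟩

theorem IsUniform.comp₂ {β γ δ : Type*} {f : A → β} {g : A → γ} (hf : IsUniform f)
    (hg : IsUniform g) (h : β → γ → δ) : IsUniform (fun a => h (f a) (g a)) := by
  obtain ⟨S, i, hS⟩ := hf
  obtain ⟨S', i', hS'⟩ := hg
  exact ⟨S ⊓ S', inferInstance, fun a s hs => by simp only [hS a s hs.1, hS' a s hs.2]⟩

theorem isUniform_const {β : Type*} (b : β) : IsUniform (fun _ : A => b) :=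
  ⟨⊤, inferInstance, fun _ _ _ => rfl⟩

theorem IsUniform.mul_left {β : Type*} {f : A → β} (hf : IsUniform f) (b : A) :
    IsUniform (fun a => f (b * a)) := by
  obtain ⟨S, h, hS⟩ := hf
  exact ⟨S, h, fun a s hs => by simp only [← mul_assoc, hS _ s hs]⟩

theorem isUniform_of_isOpen [TopologicalSpace A] [IsTopologicalGroup A] [CompactSpace A]
    {β : Type*} {f : A → β} (S : Subgroup A) (hS : IsOpen (S : Set A))
    (h : ∀ a, ∀ s ∈ S, f (a * s) = f a) : IsUniform f := by
  have := S.quotient_finite_of_isOpen hS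
  exact ⟨S, Subgroup.finiteIndex_of_finite_quotient, h⟩

open Classical in
/-- The average of a function which is invariant under a subgroup of finite index. -/
def average (f : A → W) : W :=
  if h : IsUniform f then
    (h.choose.index : ℂ)⁻¹ • ∑ᶠ q : A ⧸ h.choose, f q.out
  else 0

/-- Every coset of `S` breaks into `[S : S']` cosets of `S'`, and `f` is constant on it. Comparing
two subgroups through their intersection then shows that `average` does not depend on the chosen
subgroup. -/
theorem finsum_out_of_le {f : A → W} {S S' : Subgroup A} [S.FiniteIndex] [S'.FiniteIndex]
    (hf : ∀ a, ∀ s ∈ S, f (a * s) = f a) (h : S' ≤ S) :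
    (S'.index : ℂ)⁻¹ • ∑ᶠ q : A ⧸ S', f q.out = (S.index : ℂ)⁻¹ • ∑ᶠ q : A ⧸ S, f q.out := by
  classical
  have : Fintype (A ⧸ S) := Fintype.ofFinite _
  have : Fintype (A ⧸ S') := Fintype.ofFinite _
  have : (S'.subgroupOf S).FiniteIndex := inferInstance
  have : Fintype (S ⧸ S'.subgroupOf S) := Fintype.ofFinite _
  let g : A ⧸ S → W := fun q => f q.out
  have hg : ∀ a : A, f a = g (a : A ⧸ S) := by
    intro a
    have h1 : ((a : A ⧸ S).out : A ⧸ S) = (a : A ⧸ S) := Quotient.out_eq' _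
    have h2 := QuotientGroup.eq.1 h1
    change f a = f (a : A ⧸ S).out
    rw [← hf (a : A ⧸ S).out _ h2]
    simp
  have h1 : ∑ᶠ q : A ⧸ S', f q.out = ∑ p : (A ⧸ S) × (S ⧸ S'.subgroupOf S), g p.1 := by
    rw [finsum_eq_sum_of_fintype]
    refine Fintype.sum_equiv (Subgroup.quotientEquivProdOfLE h) _ _ fun q => ?_
    rw [hg]
    congr 1
    conv_rhs => rw [← Quotient.out_eq' q]
    rfl
  rw [h1, finsum_eq_sum_of_fintype, Fintype.sum_prod_type]
  simp only [Finset.sum_const, ← Finset.smul_sum]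
  rw [← Nat.cast_smul_eq_nsmul ℂ, smul_smul, ← Subgroup.relIndex_mul_index h]
  congr 1
  have e : (Finset.univ : Finset (S ⧸ S'.subgroupOf S)).card = S'.relIndex S := by
    rw [Finset.card_univ, Fintype.card_eq_nat_card]; rfl
  rw [e]
  have h0 : (S'.relIndex S : ℂ) ≠ 0 := by
    rw [← e]
    exact_mod_cast Fintype.card_ne_zero
  push_cast
  rw [mul_inv, mul_comm, ← mul_assoc, mul_inv_cancel₀ h0, one_mul]

theorem average_eq {f : A → W} (S : Subgroup A) [S.FiniteIndex]
    (hf : ∀ a, ∀ s ∈ S, f (a * s) = f a) :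
    average f = (S.index : ℂ)⁻¹ • ∑ᶠ q : A ⧸ S, f q.out := by
  have h : IsUniform f := ⟨S, inferInstance, hf⟩
  rw [average, dif_pos h]
  have := h.choose_spec.1
  rw [← finsum_out_of_le hf (inf_le_left : S ⊓ h.choose ≤ S),
    ← finsum_out_of_le h.choose_spec.2 (inf_le_right : S ⊓ h.choose ≤ _)]

theorem average_add {f g : A → W} (hf : IsUniform f) (hg : IsUniform g) :
    average (fun a => f a + g a) = average f + average g := by
  obtain ⟨S, i, hS⟩ := hf
  obtain ⟨S', i', hS'⟩ := hg
  have h1 : ∀ a, ∀ s ∈ S ⊓ S', f (a * s) = f a := fun a s hs => hS a s hs.1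
  have h2 : ∀ a, ∀ s ∈ S ⊓ S', g (a * s) = g a := fun a s hs => hS' a s hs.2
  rw [average_eq (S ⊓ S') h1, average_eq (S ⊓ S') h2, average_eq (S ⊓ S')
    fun a s hs => by rw [h1 a s hs, h2 a s hs], ← smul_add,
    finsum_add_distrib (Set.toFinite _) (Set.toFinite _)]

theorem map_average {f : A → W} (hf : IsUniform f) (T : W →ₗ[ℂ] W') :
    T (average f) = average (fun a => T (f a)) := by
  obtain ⟨S, i, hS⟩ := hf
  rw [average_eq S hS, average_eq S fun a s hs => by rw [hS a s hs], map_smul]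
  congr 1
  exact (T : W →+ W').map_finsum (Set.toFinite _)

theorem average_smul {f : A → W} (hf : IsUniform f) (c : ℂ) :
    average (fun a => c • f a) = c • average f :=
  (map_average hf (c • LinearMap.id)).symm

theorem average_const (w : W) : average (fun _ : A => w) = w := by
  rw [average_eq ⊤ fun _ _ _ => rfl]
  have : Subsingleton (A ⧸ (⊤ : Subgroup A)) := QuotientGroup.subsingleton_quotient_top
  have : Unique (A ⧸ (⊤ : Subgroup A)) := uniqueOfSubsingleton ((1 : A) : A ⧸ (⊤ : Subgroup A))
  rw [finsum_unique]
  simp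

theorem average_mem {f : A → W} {p : Submodule ℂ W} (hf : ∀ a, f a ∈ p) : average f ∈ p := by
  rw [average]
  split_ifs with h
  · exact p.smul_mem _ (finsum_induction (· ∈ p) p.zero_mem (fun _ _ => p.add_mem) fun q => hf _)
  · exact p.zero_mem

theorem average_mul_left {f : A → W} (hf : IsUniform f) (b : A) :
    average (fun a => f (b * a)) = average f := by
  obtain ⟨S, i, hS⟩ := hf
  rw [average_eq S hS, average_eq S fun a s hs => by rw [← mul_assoc, hS _ s hs]]
  congr 1
  refine finsum_eq_of_bijective (fun q : A ⧸ S => b • q) (MulAction.bijective b) fun q => ?_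
  have h1 : ((b • q).out : A ⧸ S) = ((b * q.out : A) : A ⧸ S) := by
    rw [QuotientGroup.out_eq']
    conv_lhs => rw [← QuotientGroup.out_eq' q]
    rfl
  have h2 := QuotientGroup.eq.1 h1
  change f (b * q.out) = f (b • q).out
  rw [← hS (b • q).out _ h2, mul_inv_cancel_left]

/-- Left invariance of the average gives `average f = c • average f`. This is the orthogonality of
characters behind Fourier inversion and the cutoffs. -/
theorem average_eq_zero_of_mul_left {f : A → W} (hf : IsUniform f) (b : A) (c : ℂ) (hc : c ≠ 1)
    (h : ∀ a, f (b * a) = c • f a) : average f = 0 := by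
  have h1 := average_mul_left hf b
  rw [funext h, average_smul hf] at h1
  have h2 : (c - 1) • average f = 0 := by rw [sub_smul, h1, one_smul, sub_self]
  exact (smul_eq_zero.1 h2).resolve_left (sub_ne_zero.2 hc)

open Classical in
theorem average_indicator_ne_zero {p : A → Prop} (hp : IsUniform p) {a : A} (ha : p a) :
    average (fun a => if p a then (1 : ℂ) else 0) ≠ 0 := by
  obtain ⟨S, i, hS⟩ := hp
  have : Fintype (A ⧸ S) := Fintype.ofFinite _
  rw [average_eq S fun a s hs => by simp [hS a s hs], finsum_eq_sum_of_fintype]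
  refine smul_ne_zero (inv_ne_zero (by exact_mod_cast Subgroup.FiniteIndex.index_ne_zero)) ?_
  rw [Finset.sum_boole, Nat.cast_ne_zero, Finset.card_ne_zero]
  refine ⟨(a : A ⧸ S), Finset.mem_filter.2 ⟨Finset.mem_univ _, ?_⟩⟩
  have h1 : ((a : A ⧸ S).out : A ⧸ S) = (a : A ⧸ S) := QuotientGroup.out_eq' _
  have h2 := QuotientGroup.eq.1 h1
  rw [← hS _ _ h2]
  simpa using ha

end Average

/-! ### Lattices in finite-dimensional spaces over a local field -/

section Lattice

open ValuativeRel Topology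

variable {F : Type*} [Field F] [ValuativeRel F] [TopologicalSpace F]
  [IsNonarchimedeanLocalField F]

/-- The circle has no small subgroups: `w² - 1 = (w + 1)(w - 1)` with `‖w + 1‖ ≥ 3/2` for `w` near
`1`, so each squaring multiplies the distance to `1` by at least `3/2`. -/
theorem circle_eq_one_of_forall_pow_near (z : Circle)
    (h : ∀ n : ℕ, ‖((z ^ n : Circle) : ℂ) - 1‖ < 1 / 2) : z = 1 := by
  have key : ∀ n : ℕ, (3 / 2 : ℝ) ^ n * ‖(z : ℂ) - 1‖ ≤ ‖((z ^ (2 ^ n) : Circle) : ℂ) - 1‖ := by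
    intro n
    induction n with
    | zero => simp
    | succ n ih =>
      have h1 := h (2 ^ n)
      set w : ℂ := ((z ^ (2 ^ n) : Circle) : ℂ) with hw
      have h2 : ((z ^ (2 ^ (n + 1)) : Circle) : ℂ) - 1 = (w + 1) * (w - 1) := by
        rw [pow_succ, pow_mul, Circle.coe_pow, ← hw]
        ring
      have h3 : (3 / 2 : ℝ) ≤ ‖w + 1‖ := by
        have : ‖(2 : ℂ)‖ ≤ ‖w + 1‖ + ‖w - 1‖ := by
          have e : (2 : ℂ) = (w + 1) - (w - 1) := by ring
          conv_lhs => rw [e]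
          exact norm_sub_le _ _
        rw [Complex.norm_ofNat] at this
        linarith
      rw [h2, norm_mul, pow_succ]
      nlinarith [norm_nonneg (w - 1), norm_nonneg ((z : ℂ) - 1)]
  by_contra hz
  have hpos : 0 < ‖(z : ℂ) - 1‖ := norm_pos_iff.2 (sub_ne_zero.2 fun e => hz (Circle.ext (by simpa using e)))
  obtain ⟨n, hn⟩ := pow_unbounded_of_one_lt (1 / ‖(z : ℂ) - 1‖) (by norm_num : (1 : ℝ) < 3 / 2)
  have h1 := key n
  have h2 := h (2 ^ n)
  rw [div_lt_iff₀ hpos] at hn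
  linarith

/-- Integers have valuation at most `1`, so a ball contains all multiples of its elements. If `ψ`
maps the ball close to `1`, the powers of each value stay close to `1`. -/
theorem addChar_exists_ball_eq_one {ψ : AddChar F Circle} (hψ : Continuous ψ) :
    ∃ γ : ValueGroupWithZero F, γ ≠ 0 ∧ ∀ x, valuation F x < γ → ψ x = 1 := by
  have h1 : {x | ‖(ψ x : ℂ) - 1‖ < 1 / 2} ∈ 𝓝 (0 : F) := by
    refine IsOpen.mem_nhds ?_ (by simp)
    exact isOpen_lt (by fun_prop) continuous_const
  obtain ⟨γ, hγ, h⟩ := (IsValuativeTopology.hasBasis_nhds_zero' F).mem_iff.1 h1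
  refine ⟨γ, hγ, fun x hx => circle_eq_one_of_forall_pow_near _ fun n => ?_⟩
  rw [← AddChar.map_nsmul_eq_pow]
  refine h ?_
  rw [Set.mem_ofPred_eq, nsmul_eq_mul, map_mul]
  refine lt_of_le_of_lt ?_ hx
  have : valuation F (n : F) ≤ 1 := by
    induction n with
    | zero => simp
    | succ n ih =>
      rw [Nat.cast_succ]
      exact (Valuation.map_add _ _ _).trans (max_le ih (by simp))
  calc _ ≤ 1 * valuation F x := mul_le_mul_left this _
    _ = _ := one_mul _

variable {X : Type*} [AddCommGroup X] [Module F X] [TopologicalSpace X] [IsModuleTopology F X]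
  {ι : Type*} [Fintype ι]

/-- The lattice of vectors all of whose coordinates have valuation at most `γ`. -/
def coordBall (b : Module.Basis ι F X) (γ : ValueGroupWithZero F) : AddSubgroup X where
  carrier := {x | ∀ i, valuation F (b.repr x i) ≤ γ}
  add_mem' hx hy i := by
    rw [map_add]
    exact (Valuation.map_add _ _ _).trans (max_le (hx i) (hy i))
  zero_mem' i := by simp
  neg_mem' hx i := by
    rw [map_neg, Finsupp.neg_apply, Valuation.map_neg]
    exact hx i

theorem coordBall_mono (b : Module.Basis ι F X) {γ δ : ValueGroupWithZero F} (h : γ ≤ δ) :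
    coordBall b γ ≤ coordBall b δ := fun _ hx i => (hx i).trans h

/-- The coordinates give a homeomorphism. -/
def coordHomeo (b : Module.Basis ι F X) : X ≃ₜ (ι → F) where
  toEquiv := b.equivFun.toEquiv
  continuous_toFun := IsModuleTopology.continuous_of_linearMap b.equivFun.toLinearMap
  continuous_invFun := by
    have := IsModuleTopology.toContinuousAdd F X
    exact IsModuleTopology.continuous_of_linearMap b.equivFun.symm.toLinearMap

theorem isCompact_coordBall (b : Module.Basis ι F X) (γ : ValueGroupWithZero F) :
    IsCompact (coordBall b γ : Set X) := by
  have h : IsCompact (Set.univ.pi fun _ : ι => {x : F | valuation F x ≤ γ}) :=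
    isCompact_univ_pi fun _ => IsNonarchimedeanLocalField.isCompact_closedBall F γ
  rw [← (coordHomeo b).isCompact_preimage] at h
  convert h using 1
  ext x
  simp [coordBall, coordHomeo]

theorem exists_coordBall_subset (b : Module.Basis ι F X) {s : Set X} (hs : s ∈ 𝓝 (0 : X)) :
    ∃ γ ≠ 0, (coordBall b γ : Set X) ⊆ s := by
  have h : (coordHomeo b).symm ⁻¹' s ∈ 𝓝 (0 : ι → F) := by
    refine (coordHomeo b).symm.continuous.continuousAt ?_
    have : (coordHomeo b).symm 0 = 0 := b.equivFun.symm.map_zero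
    rwa [this]
  rw [nhds_pi, Filter.mem_pi] at h
  obtain ⟨I, -, t, ht, hI⟩ := h
  choose γ hγ h using fun i => (IsValuativeTopology.hasBasis_nhds_zero' F).mem_iff.1 (ht i)
  obtain ⟨δ, hδ, hlt⟩ : ∃ δ : ValueGroupWithZero F, δ ≠ 0 ∧ ∀ i, δ < γ i := by
    have : ∀ T : Finset ι, ∃ δ : ValueGroupWithZero F, δ ≠ 0 ∧ ∀ i ∈ T, δ < γ i := by
      classical
      intro T
      induction T using Finset.induction_on with
      | empty => exact ⟨1, one_ne_zero, by simp⟩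
      | insert i T _ ih =>
        obtain ⟨δ, hδ, h⟩ := ih
        obtain ⟨r, hr, hr1⟩ := Valuation.IsNontrivial.exists_lt_one (v := valuation F)
        have hr0 : valuation F r ≠ 0 := by simpa using hr
        refine ⟨min δ (γ i * valuation F r), ?_, ?_⟩
        · rcases min_choice δ (γ i * valuation F r) with e | e <;> rw [e]
          exacts [hδ, mul_ne_zero (hγ i) hr0]
        · intro j hj
          rcases Finset.mem_insert.1 hj with rfl | hj
          · refine (min_le_right _ _).trans_lt ?_
            calc _ < γ j * 1 := mul_lt_mul_of_pos_left hr1 (zero_lt_iff.2 (hγ j))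
              _ = _ := mul_one _
          · exact (min_le_left _ _).trans_lt (h j hj)
    obtain ⟨δ, hδ, h⟩ := this Finset.univ
    exact ⟨δ, hδ, fun i => h i (Finset.mem_univ i)⟩
  refine ⟨δ, hδ, fun x hx => ?_⟩
  have : coordHomeo b x ∈ (coordHomeo b).symm ⁻¹' s :=
    hI fun i _ => h i (lt_of_le_of_lt (hx i) (hlt i))
  simpa using this

theorem isOpen_coordBall (b : Module.Basis ι F X) {γ : ValueGroupWithZero F} (hγ : γ ≠ 0) :
    IsOpen (coordBall b γ : Set X) := by
  have := IsModuleTopology.topologicalAddGroup F X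
  refine (coordBall b γ).isOpen_of_mem_nhds (g := 0) ?_
  have h : (Set.univ.pi fun _ : ι => {x : F | valuation F x < γ}) ∈ 𝓝 (0 : ι → F) :=
    set_pi_mem_nhds Set.finite_univ fun i _ =>
      (IsValuativeTopology.hasBasis_nhds_zero' F).mem_of_mem hγ
  have h0 : coordHomeo b 0 = 0 := b.equivFun.map_zero
  rw [← h0] at h
  filter_upwards [(coordHomeo b).continuous.continuousAt h] with x hx i
  exact (hx i trivial).le

theorem exists_subset_coordBall (b : Module.Basis ι F X) {C : Set X} (hC : IsCompact C) :
    ∃ γ ≠ 0, C ⊆ coordBall b γ := by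
  have : Nonempty {γ : ValueGroupWithZero F // γ ≠ 0} := ⟨⟨1, one_ne_zero⟩⟩
  obtain ⟨γ, hγ⟩ := hC.elim_directed_cover
    (fun γ : {γ : ValueGroupWithZero F // γ ≠ 0} => (coordBall b γ.1 : Set X))
    (fun γ => isOpen_coordBall b γ.2)
    (fun x _ => by
      refine Set.mem_iUnion.2 ⟨⟨max 1 (Finset.univ.sup fun i => valuation F (b.repr x i)), ?_⟩,
        fun i => ?_⟩
      · exact (lt_of_lt_of_le one_pos (le_max_left _ _)).ne'
      · exact le_max_of_le_right (Finset.le_sup (f := fun i => valuation F (b.repr x i))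
          (Finset.mem_univ i)))
    (fun γ δ => by
      rcases le_total γ.1 δ.1 with h | h
      · exact ⟨δ, coordBall_mono b h, subset_rfl⟩
      · exact ⟨γ, subset_rfl, coordBall_mono b h⟩)
  exact ⟨γ.1, γ.2, hγ⟩

theorem exists_lattice (b : Module.Basis ι F X) {C : Set X} (hC : IsCompact C) :
    ∃ L : AddSubgroup X, IsOpen (L : Set X) ∧ IsCompact (L : Set X) ∧ C ⊆ L := by
  obtain ⟨γ, h0, h⟩ := exists_subset_coordBall b hC
  exact ⟨_, isOpen_coordBall b h0, isCompact_coordBall b _, h⟩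

variable [FiniteDimensional F X]

/-- The annihilator of a subgroup under the pairing `ψ(β(y, x))`. -/
def perp (ψ : AddChar F Circle) (β : X →ₗ[F] X →ₗ[F] F) (L : AddSubgroup X) : AddSubgroup X where
  carrier := {y | ∀ x ∈ L, ψ (β y x) = 1}
  add_mem' hx hy i hi := by
    rw [map_add, LinearMap.add_apply, AddChar.map_add_eq_mul, hx i hi, hy i hi, one_mul]
  zero_mem' i _ := by simp
  neg_mem' hx i hi := by
    rw [map_neg, LinearMap.neg_apply, AddChar.map_neg_eq_inv, hx i hi, inv_one]

theorem continuous_char (ψ : AddChar F Circle) (hψ : Continuous ψ) (β : X →ₗ[F] X →ₗ[F] F) :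
    Continuous fun p : X × X => ψ (β p.1 p.2) :=
  hψ.comp (IsModuleTopology.continuous_bilinear_of_finite_left β)

/-- The character is trivial near each point of `{0} × L`; since `L` is compact, the tube lemma
gives one neighbourhood of `0` that annihilates all of `L`. -/
theorem isOpen_perp {ψ : AddChar F Circle} (hψ : Continuous ψ) (β : X →ₗ[F] X →ₗ[F] F)
    {L : AddSubgroup X} (hL : IsCompact (L : Set X)) : IsOpen (perp ψ β L : Set X) := by
  have := IsModuleTopology.topologicalAddGroup F X
  refine (perp ψ β L).isOpen_of_mem_nhds (g := 0) ?_
  obtain ⟨γ, hγ, h⟩ := addChar_exists_ball_eq_one hψ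
  have ho : {p : X × X | ψ (β p.1 p.2) = 1} ∈ 𝓝ˢ (({0} : Set X) ×ˢ (L : Set X)) := by
    rw [mem_nhdsSet_iff_forall]
    rintro ⟨y, x⟩ ⟨rfl, -⟩
    have hc := (IsModuleTopology.continuous_bilinear_of_finite_left β).continuousAt
      (x := ((0 : X), x))
    have hn : {t : F | valuation F t < γ} ∈ 𝓝 (β (0, x).1 (0, x).2) := by
      simpa using (IsValuativeTopology.hasBasis_nhds_zero' F).mem_of_mem hγ
    filter_upwards [hc hn] with p hp
    exact h _ hp
  obtain ⟨u, v, hu, hv, h0, hLv, huv⟩ := generalized_tube_lemma isCompact_singleton hL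
    isOpen_interior (subset_interior_iff_mem_nhdsSet.2 ho)
  refine Filter.mem_of_superset (hu.mem_nhds (h0 rfl)) fun y hy x hx => ?_
  have := interior_subset (huv (show (y, x) ∈ u ×ˢ v from ⟨hy, hLv hx⟩))
  exact this

theorem isClosed_perp {ψ : AddChar F Circle} (hψ : Continuous ψ) (β : X →ₗ[F] X →ₗ[F] F)
    (L : AddSubgroup X) : IsClosed (perp ψ β L : Set X) := by
  have : (perp ψ β L : Set X) = ⋂ x ∈ L, {y | ψ (β y x) = 1} := by
    ext; simp [perp]
  rw [this]
  refine isClosed_biInter fun x _ => isClosed_eq ?_ continuous_const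
  exact (continuous_char ψ hψ β).comp (by fun_prop : Continuous fun y : X => (y, x))

/-- The basis of `X` dual to `b` under an injective pairing. -/
theorem exists_dual_basis (b : Module.Basis ι F X) {β : X →ₗ[F] X →ₗ[F] F}
    (hβ : Function.Injective β) :
    ∃ b' : Module.Basis ι F X, ∀ y i, b'.repr y i = β y (b i) := by
  classical
  let e₀ : X →ₗ[F] (ι → F) := LinearMap.pi fun i => β.flip (b i)
  have hinj : Function.Injective e₀ := by
    rw [← LinearMap.ker_eq_bot, LinearMap.ker_eq_bot']
    intro y hy
    refine hβ (b.ext fun i => ?_)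
    rw [map_zero, LinearMap.zero_apply]
    exact congrFun hy i
  let e := LinearEquiv.ofInjectiveOfFinrankEq e₀ hinj (by
    rw [Module.finrank_eq_card_basis b, Module.finrank_fintype_fun_eq_card])
  exact ⟨Module.Basis.ofEquivFun e, fun y i => rfl⟩

/-- Otherwise `t = x₀ / c` would be admissible and force `ψ x₀ = 1`. This converts annihilation
under `ψ` into a bound on a coordinate. -/
theorem valuation_lt_of_char_eq_one {ψ : AddChar F Circle} {x₀ : F} (hx₀ : ψ x₀ ≠ 1) {c : F}
    {γ : ValueGroupWithZero F}
    (h : ∀ t, valuation F t ≤ γ → ψ (c * t) = 1) : valuation F c * γ < valuation F x₀ := by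
  by_contra! hle
  refine hx₀ ?_
  by_cases hc : c = 0
  · subst hc
    have : x₀ = 0 := by
      rw [map_zero, zero_mul] at hle
      simpa using hle
    rw [this, AddChar.map_zero_eq_one]
  · have hc' : 0 < valuation F c := zero_lt_iff.2 (by simpa using hc)
    have := h (x₀ / c) (by
      rw [map_div₀, div_le_iff₀ hc', mul_comm]
      exact hle)
    rwa [mul_div_cancel₀ _ hc] at this

/-- `L` contains a ball of some radius `γ`, which bounds the dual coordinates of its annihilator by
`|x₀| / γ`. -/
theorem isCompact_perp {ψ : AddChar F Circle} (hψ : Continuous ψ) (hψ1 : ψ ≠ 1)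
    {β : X →ₗ[F] X →ₗ[F] F} (hβ : Function.Injective β)
    {L : AddSubgroup X} (hL : IsOpen (L : Set X)) : IsCompact (perp ψ β L : Set X) := by
  let b := Module.finBasis F X
  obtain ⟨b', hb'⟩ := exists_dual_basis b hβ
  obtain ⟨x₀, hx₀⟩ := AddChar.ne_one_iff.1 hψ1
  obtain ⟨γ, hγ, h⟩ := exists_coordBall_subset b (hL.mem_nhds L.zero_mem)
  refine (isCompact_coordBall b' (valuation F x₀ / γ)).of_isClosed_subset
    (isClosed_perp hψ β L) fun y hy i => ?_
  rw [hb', le_div_iff₀ (zero_lt_iff.2 hγ)]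
  refine (valuation_lt_of_char_eq_one hx₀ fun t ht => ?_).le
  have hm : t • b i ∈ L := h fun j => by
    rw [map_smul, Module.Basis.repr_self, Finsupp.smul_single, smul_eq_mul, mul_one]
    by_cases hij : i = j
    · subst hij; simpa using ht
    · simp [hij]
  have := hy _ hm
  rwa [map_smul, smul_eq_mul, mul_comm] at this

theorem exists_perp_subset {ψ : AddChar F Circle} (hψ1 : ψ ≠ 1)
    {β : X →ₗ[F] X →ₗ[F] F} (hβ : Function.Injective β) {s : Set X} (hs : s ∈ 𝓝 (0 : X)) :
    ∃ L : AddSubgroup X, IsOpen (L : Set X) ∧ IsCompact (L : Set X) ∧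
      (perp ψ β L : Set X) ⊆ s := by
  let b := Module.finBasis F X
  obtain ⟨b', hb'⟩ := exists_dual_basis b hβ
  obtain ⟨x₀, hx₀⟩ := AddChar.ne_one_iff.1 hψ1
  obtain ⟨γ, hγ, h⟩ := exists_coordBall_subset b' hs
  have h0 : valuation F x₀ / γ ≠ 0 := by
    refine div_ne_zero ?_ hγ
    rw [Ne, map_eq_zero]
    rintro rfl
    exact hx₀ (AddChar.map_zero_eq_one ψ)
  -- With this radius, the bound `|c| * (|x₀| / γ) < |x₀|` on a dual coordinate `c` becomes `|c| <
  -- γ`.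
  refine ⟨coordBall b (valuation F x₀ / γ), isOpen_coordBall b h0, isCompact_coordBall b _,
    fun y hy => h fun i => ?_⟩
  have := valuation_lt_of_char_eq_one hx₀ (c := β y (b i)) (γ := valuation F x₀ / γ)
    fun t ht => by
      have hm : t • b i ∈ coordBall b (valuation F x₀ / γ) := fun j => by
        rw [map_smul, Module.Basis.repr_self, Finsupp.smul_single, smul_eq_mul, mul_one]
        by_cases hij : i = j
        · subst hij; simpa using ht
        · simp [hij]
      have := hy _ hm
      rwa [map_smul, smul_eq_mul, mul_comm] at this
  rw [hb']
  rw [← mul_div_assoc, div_lt_iff₀ (zero_lt_iff.2 hγ), mul_comm (valuation F x₀)] at this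
  exact (lt_of_mul_lt_mul_right' this).le

end Lattice

/-! ### Twisted coinvariants -/

section TwistKer

variable {G : Type*} {W : Type*} [AddCommGroup W] [Module ℂ W]

/-- The span of the vectors `T(g) w - χ(g) w` with `g ∈ S`. -/
def twistKer (T : G → W →ₗ[ℂ] W) (S : Set G) (χ : G → Circle) : Submodule ℂ W :=
  Submodule.span ℂ {x | ∃ g ∈ S, ∃ w, x = T g w - (χ g : ℂ) • w}

theorem sub_mem_twistKer (T : G → W →ₗ[ℂ] W) {S : Set G} (χ : G → Circle) {g : G} (hg : g ∈ S)
    (w : W) : T g w - (χ g : ℂ) • w ∈ twistKer T S χ :=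
  Submodule.subset_span ⟨g, hg, w, rfl⟩

theorem twistKer_le {T : G → W →ₗ[ℂ] W} {S : Set G} {χ : G → Circle} {p : Submodule ℂ W}
    (h : ∀ g ∈ S, ∀ w, T g w - (χ g : ℂ) • w ∈ p) : twistKer T S χ ≤ p := by
  refine Submodule.span_le.2 ?_
  rintro x ⟨g, hg, w, rfl⟩
  exact h g hg w

theorem twistKer_mono (T : G → W →ₗ[ℂ] W) {S S' : Set G} {χ χ' : G → Circle} (h : S ⊆ S')
    (hχ : ∀ g ∈ S, χ g = χ' g) : twistKer T S χ ≤ twistKer T S' χ' :=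
  twistKer_le fun g hg w => by
    rw [hχ g hg]
    exact sub_mem_twistKer T χ' (h hg) w

/-- A twisted coinvariant relation only involves finitely many group elements. -/
theorem exists_finite_twistKer {T : G → W →ₗ[ℂ] W} {S : Set G} {χ : G → Circle} {w : W}
    (h : w ∈ twistKer T S χ) : ∃ S' ⊆ S, S'.Finite ∧ w ∈ twistKer T S' χ := by
  induction h using Submodule.span_induction with
  | mem x hx =>
    obtain ⟨g, hg, w, rfl⟩ := hx
    exact ⟨{g}, Set.singleton_subset_iff.2 hg, Set.finite_singleton g,
      sub_mem_twistKer T χ (Set.mem_singleton g) w⟩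
  | zero => exact ⟨∅, Set.empty_subset _, Set.finite_empty, Submodule.zero_mem _⟩
  | add x y _ _ hx hy =>
    obtain ⟨S₁, h₁, f₁, m₁⟩ := hx
    obtain ⟨S₂, h₂, f₂, m₂⟩ := hy
    exact ⟨S₁ ∪ S₂, Set.union_subset h₁ h₂, f₁.union f₂, Submodule.add_mem _
      (twistKer_mono T Set.subset_union_left (fun _ _ => rfl) m₁)
      (twistKer_mono T Set.subset_union_right (fun _ _ => rfl) m₂)⟩
  | smul a x _ hx =>
    obtain ⟨S₁, h₁, f₁, m₁⟩ := hx
    exact ⟨S₁, h₁, f₁, Submodule.smul_mem _ _ m₁⟩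

theorem map_mem_twistKer {T : G → W →ₗ[ℂ] W} {S S' : Set G} {χ χ' : G → Circle} {A : W →ₗ[ℂ] W}
    (h : ∀ g ∈ S, ∃ g' ∈ S', χ' g' = χ g ∧ ∀ w, A (T g w) = T g' (A w)) {w : W}
    (hw : w ∈ twistKer T S χ) : A w ∈ twistKer T S' χ' := by
  suffices twistKer T S χ ≤ (twistKer T S' χ').comap A from this hw
  refine twistKer_le fun g hg w => ?_
  obtain ⟨g', hg', e, h'⟩ := h g hg
  rw [Submodule.mem_comap, map_sub, map_smul, h', ← e]
  exact sub_mem_twistKer T χ' hg' _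

end TwistKer

/-! ### Twisted coinvariants of group representations, and conjugation -/

section RepTwist

variable {G : Type*} [Group G] {W : Type*} [AddCommGroup W] [Module ℂ W]

theorem jacquetKer_eq_twistKer (ρ : Representation ℂ G W) (H : Subgroup G) (χ : H →* Circle)
    (χ' : G → Circle) (h : ∀ g : H, χ g = χ' g) : jacquetKer ρ H χ = twistKer ρ H χ' := by
  apply le_antisymm
  · refine Submodule.span_le.2 ?_
    rintro x ⟨g, w, rfl⟩
    rw [h]
    exact sub_mem_twistKer ρ χ' g.2 w
  · refine twistKer_le fun g hg w => Submodule.subset_span ⟨⟨g, hg⟩, w, ?_⟩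
    rw [h]

theorem conj_mem_twistKer (ρ : Representation ℂ G W) {S S' : Set G} {χ χ' : G → Circle} (g : G)
    (h : ∀ s ∈ S, g * s * g⁻¹ ∈ S' ∧ χ' (g * s * g⁻¹) = χ s) {w : W}
    (hw : w ∈ twistKer ρ S χ) : ρ g w ∈ twistKer ρ S' χ' :=
  map_mem_twistKer (fun s hs => ⟨g * s * g⁻¹, (h s hs).1, (h s hs).2, fun w => by
    rw [← Module.End.mul_apply, ← Module.End.mul_apply, ← map_mul, ← map_mul,
      inv_mul_cancel_right]⟩) hw

end RepTwist

/-! ### Fourier inversion for a smooth action of a finite-dimensional space -/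

section Fourier

open Topology ValuativeRel

variable {F : Type*} [Field F] [ValuativeRel F] [TopologicalSpace F]
  [IsNonarchimedeanLocalField F]
  {X : Type*} [AddCommGroup X] [Module F X] [TopologicalSpace X] [IsModuleTopology F X]
  {W : Type*} [AddCommGroup W] [Module ℂ W]

/-- A smooth linear action of an additive topological group. -/
structure IsSmoothAction {X : Type*} [AddCommGroup X] [TopologicalSpace X]
    (T : X → W →ₗ[ℂ] W) : Prop where
  zero : T 0 = LinearMap.id
  add : ∀ x y, T (x + y) = T x ∘ₗ T y
  smooth : ∀ w, ∃ U ∈ 𝓝 (0 : X), ∀ x ∈ U, T x w = w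

/-- The stabilizer of a vector. -/
def IsSmoothAction.stab {T : X → W →ₗ[ℂ] W} (hT : IsSmoothAction T) (w : W) : AddSubgroup X where
  carrier := {x | T x w = w}
  zero_mem' := by simp [hT.zero]
  add_mem' {x y} hx hy := by
    have hx' : T x w = w := hx
    have hy' : T y w = w := hy
    change T (x + y) w = w
    rw [hT.add, LinearMap.comp_apply, hy', hx']
  neg_mem' {x} hx := by
    have hx' : T x w = w := hx
    change T (-x) w = w
    conv_lhs => rw [← hx']
    rw [← LinearMap.comp_apply, ← hT.add, neg_add_cancel, hT.zero, LinearMap.id_apply]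

theorem IsSmoothAction.isOpen_stab [IsTopologicalAddGroup X] {T : X → W →ₗ[ℂ] W}
    (hT : IsSmoothAction T) (w : W) : IsOpen (hT.stab w : Set X) := by
  obtain ⟨U, hU, h⟩ := hT.smooth w
  exact (hT.stab w).isOpen_of_mem_nhds (Filter.mem_of_superset hU h)

/-- The average of `χ(x)⁻¹ T(x) w` over a lattice `L`. -/
def latticeAverage (T : X → W →ₗ[ℂ] W) (χ : AddChar X Circle) (L : AddSubgroup X) (w : W) : W :=
  average fun x : Multiplicative L => ((χ (x.toAdd : X))⁻¹ : ℂ) • T (x.toAdd : X) w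

variable [IsTopologicalAddGroup X]

theorem isUniform_of_isOpen_add {L : AddSubgroup X} (hL : IsCompact (L : Set X)) {β : Type*}
    {f : X → β} (S : AddSubgroup X) (hS : IsOpen (S : Set X))
    (h : ∀ a, ∀ s ∈ S, f (a + s) = f a) :
    IsUniform fun x : Multiplicative L => f (x.toAdd : X) := by
  have : CompactSpace L := isCompact_iff_compactSpace.1 hL
  refine isUniform_of_isOpen (AddSubgroup.toSubgroup (S.addSubgroupOf L)) ?_
    fun a s hs => h _ _ hs
  exact hS.preimage continuous_subtype_val

theorem isUniform_latticeAverage {T : X → W →ₗ[ℂ] W} (hT : IsSmoothAction T)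
    {χ : AddChar X Circle} (hχ : ∃ U ∈ 𝓝 (0 : X), ∀ x ∈ U, χ x = 1) {L : AddSubgroup X}
    (hL : IsCompact (L : Set X)) (w : W) :
    IsUniform fun x : Multiplicative L => ((χ (x.toAdd : X))⁻¹ : ℂ) • T (x.toAdd : X) w := by
  obtain ⟨U, hU, h⟩ := hχ
  let K : AddSubgroup X :=
    { carrier := {x | χ x = 1}
      zero_mem' := by simp
      add_mem' := fun {x y} hx hy => by
        have hx' : χ x = 1 := hx
        have hy' : χ y = 1 := hy
        simp [AddChar.map_add_eq_mul, hx', hy']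
      neg_mem' := fun {x} hx => by
        have hx' : χ x = 1 := hx
        simp [AddChar.map_neg_eq_inv, hx'] }
  have hK : IsOpen (K : Set X) := K.isOpen_of_mem_nhds (Filter.mem_of_superset hU h)
  refine IsUniform.comp₂ (f := fun x : Multiplicative L => χ (x.toAdd : X))
    (g := fun x : Multiplicative L => T (x.toAdd : X) w)
    (isUniform_of_isOpen_add hL K hK fun a s hs => ?_)
    (isUniform_of_isOpen_add (f := fun x => T x w) hL (hT.stab w) (hT.isOpen_stab w)
      fun a s hs => ?_) (fun (c : Circle) w => (c : ℂ)⁻¹ • w)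
  · have hs' : χ s = 1 := hs
    rw [AddChar.map_add_eq_mul, hs', mul_one]
  · have hs' : T s w = w := hs
    change T (a + s) w = T a w
    rw [hT.add, LinearMap.comp_apply, hs']

/-- Replacing `w` by `T g w` with `g ∈ L` multiplies the average by `χ g`. Together with
`sub_latticeAverage_mem`, a vector dies in the twisted coinvariants of a compact `L` exactly when
its average is zero. -/
theorem latticeAverage_eq_zero {T : X → W →ₗ[ℂ] W} (hT : IsSmoothAction T)
    {χ : AddChar X Circle} (hχ : ∃ U ∈ 𝓝 (0 : X), ∀ x ∈ U, χ x = 1) {L : AddSubgroup X}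
    (hL : IsCompact (L : Set X)) {w : W} (hw : w ∈ twistKer T L χ) :
    latticeAverage T χ L w = 0 := by
  let E : W →ₗ[ℂ] W :=
    { toFun := latticeAverage T χ L
      map_add' := fun w w' => by
        unfold latticeAverage
        rw [← average_add (isUniform_latticeAverage hT hχ hL w)
          (isUniform_latticeAverage hT hχ hL w')]
        simp only [map_add, smul_add]
      map_smul' := fun c w => by
        unfold latticeAverage
        rw [RingHom.id_apply, ← average_smul (isUniform_latticeAverage hT hχ hL w)]
        simp only [map_smul, smul_comm c] }
  suffices twistKer T L χ ≤ LinearMap.ker E from this hw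
  refine twistKer_le fun g hg w => ?_
  rw [LinearMap.mem_ker, map_sub, map_smul, sub_eq_zero]
  change latticeAverage T χ L (T g w) = (χ g : ℂ) • latticeAverage T χ L w
  unfold latticeAverage
  rw [← average_smul (isUniform_latticeAverage hT hχ hL w), ← average_mul_left
    ((isUniform_latticeAverage hT hχ hL w).comp _) (Multiplicative.ofAdd ⟨g, hg⟩)]
  congr 1
  funext x
  change _ = (χ g : ℂ) • ((χ (g + (x.toAdd : X)) : ℂ)⁻¹) • T (g + x.toAdd) w
  rw [AddChar.map_add_eq_mul, smul_smul, Circle.coe_mul, mul_inv, mul_inv_cancel_left₀ (by simp),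
    add_comm g, hT.add]
  rfl

theorem sub_latticeAverage_mem {T : X → W →ₗ[ℂ] W} (hT : IsSmoothAction T)
    {χ : AddChar X Circle} (hχ : ∃ U ∈ 𝓝 (0 : X), ∀ x ∈ U, χ x = 1) {L : AddSubgroup X}
    (hL : IsCompact (L : Set X)) (w : W) :
    latticeAverage T χ L w - w ∈ twistKer T L χ := by
  have hu := isUniform_latticeAverage hT hχ hL w
  have : latticeAverage T χ L w - w = average fun x : Multiplicative L =>
      ((χ (x.toAdd : X))⁻¹ : ℂ) • T (x.toAdd : X) w + (-1 : ℂ) • w := by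
    rw [average_add hu (isUniform_const _), average_const, neg_one_smul, ← sub_eq_add_neg]
    rfl
  rw [this]
  refine average_mem fun x => ?_
  have h := Submodule.smul_mem _ ((χ (x.toAdd : X))⁻¹ : ℂ) (sub_mem_twistKer T χ x.toAdd.2 w)
  rwa [smul_sub, smul_smul, inv_mul_cancel₀ (by simp), one_smul, sub_eq_add_neg,
    ← neg_one_smul ℂ w] at h

variable [FiniteDimensional F X]

/-- The character `x ↦ ψ(β(y, x))`. -/
def pairChar (ψ : AddChar F Circle) (β : X →ₗ[F] X →ₗ[F] F) (y : X) : AddChar X Circle where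
  toFun x := ψ (β y x)
  map_zero_eq_one' := by simp
  map_add_eq_mul' a b := by rw [map_add, AddChar.map_add_eq_mul]

theorem pairChar_locally_trivial {ψ : AddChar F Circle} (hψ : Continuous ψ)
    (β : X →ₗ[F] X →ₗ[F] F) (y : X) : ∃ U ∈ 𝓝 (0 : X), ∀ x ∈ U, pairChar ψ β y x = 1 := by
  obtain ⟨γ, hγ, h⟩ := addChar_exists_ball_eq_one hψ
  have hn : {t : F | valuation F t < γ} ∈ 𝓝 (β y 0) := by
    simpa using (IsValuativeTopology.hasBasis_nhds_zero' F).mem_of_mem hγ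
  exact ⟨_, (IsModuleTopology.continuous_of_linearMap (β y)).continuousAt hn, fun x hx => h _ hx⟩

/-- A vector all of whose twisted coinvariants vanish is zero. -/
theorem eq_zero_of_forall_mem_twistKer {ψ : AddChar F Circle} (hψ : Continuous ψ) (hψ1 : ψ ≠ 1)
    {β : X →ₗ[F] X →ₗ[F] F} (hβ : Function.Injective β) (hβ' : Function.Injective β.flip)
    {T : X → W →ₗ[ℂ] W} (hT : IsSmoothAction T) {w : W}
    (hw : ∀ y, w ∈ twistKer T Set.univ (pairChar ψ β y)) : w = 0 := by
  classical
  -- `M` is a lattice of characters whose annihilator `L₀` fixes `w`, and `Y` is the group of all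
  -- characters trivial on `L₀`. Only `M ≤ Y` is needed below, not biduality.
  obtain ⟨M, hMo, hMc, hM⟩ := exists_perp_subset hψ1 hβ' ((hT.isOpen_stab w).mem_nhds
    (hT.stab w).zero_mem)
  set L₀ := perp ψ β.flip M with hL₀
  have hL₀o : IsOpen (L₀ : Set X) := isOpen_perp hψ _ hMc
  have hL₀c : IsCompact (L₀ : Set X) := isCompact_perp hψ hψ1 hβ' hMo
  set Y := perp ψ β L₀ with hY
  have hYc : IsCompact (Y : Set X) := isCompact_perp hψ hψ1 hβ hL₀o
  have hMY : M ≤ Y := fun y hy x hx => hx y hy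
  -- a lattice over which all the relations hold
  obtain ⟨L, hLo, hLc, hLL, hL⟩ : ∃ L : AddSubgroup X, IsOpen (L : Set X) ∧
      IsCompact (L : Set X) ∧ L₀ ≤ L ∧ ∀ y ∈ Y, w ∈ twistKer T L (pairChar ψ β y) := by
    have h1 : ∀ y : X, ∃ L : AddSubgroup X, IsCompact (L : Set X) ∧
        w ∈ twistKer T L (pairChar ψ β y) := by
      intro y
      obtain ⟨S, -, hS, h⟩ := exists_finite_twistKer (hw y)
      obtain ⟨L, -, hLc, hSL⟩ := exists_lattice (Module.finBasis F X) hS.isCompact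
      exact ⟨L, hLc, twistKer_mono T hSL (fun _ _ => rfl) h⟩
    choose L hLc hL using h1
    -- The relation found for `y` over `L y` also serves each `z` with `z - y` in the annihilator of
    -- `L y`, because the two characters agree there. Compactness of `Y` leaves finitely many
    -- lattices to enclose.
    obtain ⟨t, -, ht⟩ := hYc.elim_nhds_subcover (fun y => {z | z - y ∈ perp ψ β (L y)})
      fun y _ => by
        refine IsOpen.mem_nhds ?_ (by simp)
        exact (isOpen_perp hψ β (hLc y)).preimage (by fun_prop : Continuous fun z => z - y)
    obtain ⟨L', hLo', hLc', h'⟩ := exists_lattice (Module.finBasis F X)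
      (hL₀c.union (t.isCompact_biUnion fun y _ => hLc y))
    refine ⟨L', hLo', hLc', fun x hx => h' (Or.inl hx), fun y hy => ?_⟩
    obtain ⟨y₀, hy₀, hz⟩ := Set.mem_iUnion₂.1 (ht hy)
    refine twistKer_mono T (fun x hx => h' (Or.inr (Set.mem_iUnion₂.2 ⟨y₀, hy₀, hx⟩))) ?_ (hL y₀)
    intro x hx
    have hz' := hz x hx
    rw [map_sub, LinearMap.sub_apply, AddChar.map_sub_eq_div, div_eq_one] at hz'
    exact hz'.symm
  have : CompactSpace Y := isCompact_iff_compactSpace.1 hYc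
  have : CompactSpace L := isCompact_iff_compactSpace.1 hLc
  let S : Subgroup (Multiplicative L) := AddSubgroup.toSubgroup (L₀.addSubgroupOf L)
  have : Finite (Multiplicative L ⧸ S) := S.quotient_finite_of_isOpen
    (hL₀o.preimage continuous_subtype_val)
  have : S.FiniteIndex := Subgroup.finiteIndex_of_finite_quotient
  have : Fintype (Multiplicative L ⧸ S) := Fintype.ofFinite _
  let out : Multiplicative L ⧸ S → X := fun q => (q.out.toAdd : X)
  have h2 : ∀ y ∈ Y, ∑ q, ((pairChar ψ β y (out q) : ℂ)⁻¹) • T (out q) w = 0 := by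
    intro y hy
    have h := latticeAverage_eq_zero hT (pairChar_locally_trivial hψ β y) hLc (hL y hy)
    unfold latticeAverage at h
    rw [average_eq S, finsum_eq_sum_of_fintype] at h
    · exact (smul_eq_zero.1 h).resolve_left (inv_ne_zero
        (by exact_mod_cast Subgroup.FiniteIndex.index_ne_zero))
    · intro a s hs
      have hs₀ : (s.toAdd : X) ∈ L₀ := hs
      have e1 : pairChar ψ β y (s.toAdd : X) = 1 := hy _ hs₀
      have e2 : T (s.toAdd : X) w = w := hM hs₀
      change ((pairChar ψ β y ((a.toAdd : X) + s.toAdd) : ℂ)⁻¹) • T ((a.toAdd : X) + s.toAdd) w = _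
      rw [AddChar.map_add_eq_mul, e1, mul_one, hT.add, LinearMap.comp_apply, e2]
  have hu : ∀ x : X, IsUniform fun y : Multiplicative Y =>
      ((pairChar ψ β (y.toAdd : X) x : ℂ)⁻¹) := by
    intro x
    obtain ⟨U, hU, h⟩ := pairChar_locally_trivial hψ β.flip x
    let K : AddSubgroup X := perp ψ β (AddSubgroup.zmultiples x)
    have hK : IsOpen (K : Set X) := by
      refine K.isOpen_of_mem_nhds (Filter.mem_of_superset hU fun y hy z hz => ?_)
      obtain ⟨n, rfl⟩ := AddSubgroup.mem_zmultiples_iff.1 hz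
      have : ψ (β y x) = 1 := h y hy
      rw [map_zsmul, AddChar.map_zsmul_eq_zpow, this, one_zpow]
    refine (isUniform_of_isOpen_add hYc (f := fun y => ψ (β y x)) K hK fun a s hs => ?_).comp
      fun c : Circle => (c : ℂ)⁻¹
    have : ψ (β s x) = 1 := hs x (AddSubgroup.mem_zmultiples x)
    rw [map_add, LinearMap.add_apply, AddChar.map_add_eq_mul, this, mul_one]
  -- Orthogonality over `Y`: a representative outside `L₀` pairs nontrivially with some element of
  -- `M ≤ Y`, so only the trivial coset survives, with contribution `w`. Averaging the vanishing
  -- sums `h2` over `Y` therefore gives `w = 0`.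
  have h3 : ∀ q, average (fun y : Multiplicative Y => ((pairChar ψ β (y.toAdd : X) (out q) : ℂ)⁻¹)
      • T (out q) w) = if q = ((1 : Multiplicative L) : Multiplicative L ⧸ S) then w else 0 := by
    intro q
    have hq : q = ((1 : Multiplicative L) : Multiplicative L ⧸ S) ↔ out q ∈ L₀ := by
      conv_lhs => rw [← QuotientGroup.out_eq' q]
      rw [eq_comm, QuotientGroup.eq, inv_one, one_mul]
      rfl
    split_ifs with h
    · rw [hq] at h
      have e2 : T (out q) w = w := hM h
      have e1 : ∀ y : Multiplicative Y, pairChar ψ β (y.toAdd : X) (out q) = 1 :=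
        fun y => y.toAdd.2 _ h
      simp only [e1, e2, Circle.coe_one, inv_one, one_smul]
      exact average_const w
    · rw [hq] at h
      obtain ⟨y, hy, hne⟩ : ∃ y ∈ M, ψ (β y (out q)) ≠ 1 := by
        by_contra! hc
        exact h hc
      refine average_eq_zero_of_mul_left ((hu (out q)).comp fun c => c • T (out q) w)
        (Multiplicative.ofAdd ⟨y, hMY hy⟩) ((ψ (β y (out q)) : ℂ)⁻¹) ?_ fun a => ?_
      · rw [Ne, inv_eq_one]
        exact fun e => hne (Circle.ext e)
      · change ((ψ (β (y + (a.toAdd : X)) (out q)) : ℂ)⁻¹) • _ = _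
        rw [map_add, LinearMap.add_apply, AddChar.map_add_eq_mul, Circle.coe_mul, mul_inv,
          mul_smul]
        rfl
  have h4 : ∀ t : Finset (Multiplicative L ⧸ S),
      average (fun y : Multiplicative Y => ∑ q ∈ t,
        ((pairChar ψ β (y.toAdd : X) (out q) : ℂ)⁻¹) • T (out q) w) =
      ∑ q ∈ t, (if q = ((1 : Multiplicative L) : Multiplicative L ⧸ S) then w else 0) ∧
      IsUniform (fun y : Multiplicative Y => ∑ q ∈ t,
        ((pairChar ψ β (y.toAdd : X) (out q) : ℂ)⁻¹) • T (out q) w) := by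
    intro t
    induction t using Finset.induction_on with
    | empty => exact ⟨by simpa using average_const (A := Multiplicative Y) (0 : W),
        by simpa using isUniform_const (A := Multiplicative Y) (0 : W)⟩
    | insert q t hq ih =>
      have hq' := (hu (out q)).comp fun c => c • T (out q) w
      simp only [Finset.sum_insert hq]
      exact ⟨by rw [average_add hq' ih.2, ih.1, h3], hq'.comp₂ ih.2 (· + ·)⟩
  have h5 := (h4 Finset.univ).1
  rw [Finset.sum_ite_eq' , if_pos (Finset.mem_univ _)] at h5
  rw [← h5, ← average_const (A := Multiplicative Y) (0 : W)]
  congr 1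
  funext y
  exact h2 _ y.toAdd.2

end Fourier

/-! ### The trace pairing -/

section TracePairing

variable (F : Type*) [Field F] [CharZero F] {D : Type*} [Ring D] [Algebra F D] [IsSimpleRing D]
  [FiniteDimensional F D]

/-- The radical of the trace form is a two-sided ideal, since the trace is cyclic. By simplicity it
is zero or everything, and it cannot contain `1` because the reduced trace of `1` is non-zero in
characteristic zero. -/
theorem eq_zero_of_reducedTrace_mul {y : D} (h : ∀ x, reducedTrace F (x * y) = 0) : y = 0 := by
  let I : TwoSidedIdeal D := TwoSidedIdeal.mk' {y | ∀ x, reducedTrace F (x * y) = 0}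
    (fun x => by simp) (fun {a b} ha hb x => by rw [mul_add, map_add, ha, hb, add_zero])
    (fun {a} ha x => by rw [mul_neg, map_neg, ha, neg_zero])
    (fun {a b} hb x => by rw [← mul_assoc]; exact hb _)
    (fun {a b} ha x => by
      rw [← mul_assoc, reducedTrace_mul_comm, ← mul_assoc]
      exact ha _)
  have hI : ∀ y, y ∈ I ↔ ∀ x, reducedTrace F (x * y) = 0 := fun y =>
    TwoSidedIdeal.mem_mk' ..
  rcases eq_bot_or_eq_top I with e | e
  · have : y ∈ I := (hI y).2 h
    rwa [e, TwoSidedIdeal.mem_bot] at this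
  · exfalso
    have h1 : (1 : D) ∈ I := by rw [e]; trivial
    have h2 := (hI 1).1 h1 1
    rw [mul_one] at h2
    have hd : 0 < Module.finrank F D := Module.finrank_pos
    have h3 : (LinearMap.trace F D ∘ₗ LinearMap.mul F D) 1 = (Module.finrank F D : F) := by
      have : LinearMap.mul F D 1 = LinearMap.id := by ext; simp
      rw [LinearMap.comp_apply, this, LinearMap.trace_id]
    rw [reducedTrace, LinearMap.smul_apply, h3, smul_eq_mul] at h2
    rcases mul_eq_zero.1 h2 with h2 | h2
    · rw [inv_eq_zero, Nat.cast_eq_zero, Nat.sqrt_eq_zero] at h2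
      omega
    · rw [Nat.cast_eq_zero] at h2
      omega

variable (D) in
/-- The pairing `(y, x) ↦ tr(∑ y_t x_t)` on tuples of elements of `D`. -/
def tracePairing (σ : Type*) [Fintype σ] : (σ → D) →ₗ[F] (σ → D) →ₗ[F] F :=
  LinearMap.mk₂ F (fun y x => reducedTrace F (∑ t, y t * x t))
    (fun a b c => by simp [add_mul, Finset.sum_add_distrib])
    (fun a b c => by simp [← Finset.smul_sum])
    (fun a b c => by simp [mul_add, Finset.sum_add_distrib])
    (fun a b c => by simp [← Finset.smul_sum])

variable {F}

theorem tracePairing_apply {σ : Type*} [Fintype σ] (y x : σ → D) :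
    tracePairing F D σ y x = reducedTrace F (∑ t, y t * x t) := rfl

theorem tracePairing_comm {σ : Type*} [Fintype σ] (y x : σ → D) :
    tracePairing F D σ y x = tracePairing F D σ x y := by
  simp only [tracePairing_apply, map_sum, reducedTrace_mul_comm]

theorem tracePairing_injective (σ : Type*) [Fintype σ] :
    Function.Injective (tracePairing F D σ) := by
  classical
  rw [← LinearMap.ker_eq_bot, LinearMap.ker_eq_bot']
  intro y hy
  funext t
  refine eq_zero_of_reducedTrace_mul F fun x => ?_
  have := LinearMap.congr_fun hy (Pi.single t x)
  rw [tracePairing_apply, Finset.sum_eq_single t] at this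
  · rw [reducedTrace_mul_comm]
    simpa using this
  · intro s _ hs
    rw [Pi.single_eq_of_ne hs, mul_zero]
  · simp

theorem tracePairing_flip_injective (σ : Type*) [Fintype σ] :
    Function.Injective (tracePairing F D σ).flip := by
  intro y z h
  refine tracePairing_injective (F := F) σ (LinearMap.ext fun x => ?_)
  rw [tracePairing_comm y, tracePairing_comm z]
  exact LinearMap.congr_fun h x

end TracePairing

/-! ### Completing unimodular rows -/

section Unimodular

variable (F : Type*) [Field F] {D : Type*} [Ring D] [Algebra F D] [IsSimpleRing D]
  [FiniteDimensional F D] {ι : Type*} [Fintype ι] [DecidableEq ι]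

/-- Over a simple Artinian ring every submodule of `ι → D` is a power of one simple module, and its
dimension over `F` determines the exponent. -/
theorem nonempty_linearEquiv_of_finrank_eq {K₁ K₂ : Submodule D (ι → D)}
    (h : Module.finrank F K₁ = Module.finrank F K₂) : Nonempty (K₁ ≃ₗ[D] K₂) := by
  have : IsArtinianRing D := IsArtinianRing.of_finite F D
  rcases subsingleton_or_nontrivial (ι → D) with hs | hn
  · have : Subsingleton K₁ := inferInstance
    have : Subsingleton K₂ := inferInstance
    exact ⟨0, 0, fun _ => Subsingleton.elim _ _, fun _ => Subsingleton.elim _ _⟩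
  · obtain ⟨S, hS⟩ := IsAtomic.exists_atom (Submodule D (ι → D))
    rw [← isSimpleModule_iff_isAtom] at hS
    have hM : IsIsotypicOfType D (ι → D) S := IsSimpleRing.isIsotypic D (ι → D) S
    obtain ⟨n₁, ⟨e₁⟩⟩ := (hM.of_injective K₁.subtype K₁.injective_subtype).linearEquiv_fun
    obtain ⟨n₂, ⟨e₂⟩⟩ := (hM.of_injective K₂.subtype K₂.injective_subtype).linearEquiv_fun
    have : Nontrivial S := IsSimpleModule.nontrivial D S
    have : FiniteDimensional F S :=
      inferInstanceAs (FiniteDimensional F (S.restrictScalars F))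
    have hd : 0 < Module.finrank F S := Module.finrank_pos
    have h₁ := (e₁.restrictScalars F).finrank_eq
    have h₂ := (e₂.restrictScalars F).finrank_eq
    rw [Module.finrank_pi_fintype, Finset.sum_const, Finset.card_univ, Fintype.card_fin,
      smul_eq_mul] at h₁ h₂
    have : n₁ = n₂ := by
      rw [h₁, h₂] at h
      exact Nat.eq_of_mul_eq_mul_right hd h
    subst this
    exact ⟨e₁.trans e₂.symm⟩

/-- A unimodular row over a finite-dimensional simple algebra is a row of an invertible matrix. -/
theorem exists_unit_row (F : Type*) [Field F] {D : Type*} [Ring D] [Algebra F D] [IsSimpleRing D]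
    [FiniteDimensional F D] {ι : Type*} [Fintype ι] [DecidableEq ι] (i₀ : ι) (y c : ι → D) (h : ∑ i, y i * c i = 1) :
    ∃ g : (Matrix ι ι D)ˣ, g.1 i₀ = y := by
  let φ : (ι → D) →ₗ[D] D := ∑ i, (LinearMap.toSpanSingleton D D (c i)) ∘ₗ LinearMap.proj i
  have hφ : ∀ r, φ r = ∑ i, r i * c i := fun r => by simp [φ]
  let p : (ι → D) →ₗ[D] D := LinearMap.proj i₀
  have hφy : φ y = 1 := by rw [hφ, h]
  have hp : p (Pi.single i₀ 1) = 1 := by simp [p]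
  have hfin : ∀ f : (ι → D) →ₗ[D] D, Function.Surjective f →
      Module.finrank F (LinearMap.ker f) + Module.finrank F D = Module.finrank F (ι → D) := by
    intro f hf
    have := LinearMap.finrank_range_add_finrank_ker (f.restrictScalars F)
    rw [LinearMap.range_eq_top.2 (by exact hf), finrank_top] at this
    rw [← this, add_comm]
    rfl
  have hsurj : ∀ (f : (ι → D) →ₗ[D] D) (v : ι → D), f v = 1 → Function.Surjective f :=
    fun f v hv d => ⟨d • v, by simp [hv]⟩
  -- Both functionals take the value `1`, so their kernels have equal dimension. An isomorphism of
  -- the kernels, extended by sending the unit row to `y`, is the required automorphism.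
  obtain ⟨θ⟩ := nonempty_linearEquiv_of_finrank_eq F (K₁ := LinearMap.ker p)
    (K₂ := LinearMap.ker φ) (by
      have h₁ := hfin p (hsurj p _ hp)
      have h₂ := hfin φ (hsurj φ _ hφy)
      omega)
  have key : ∀ (f : (ι → D) →ₗ[D] D) (v : ι → D), f v = 1 → ∃ P : (ι → D) →ₗ[D] LinearMap.ker f,
      (∀ r, (P r : ι → D) = r - f r • v) := by
    intro f v hv
    refine ⟨LinearMap.codRestrict _ (LinearMap.id - f.smulRight v) fun r => ?_, fun r => ?_⟩
    · simp [LinearMap.mem_ker, hv]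
    · rfl
  obtain ⟨P₁, hP₁⟩ := key p _ hp
  obtain ⟨P₂, hP₂⟩ := key φ _ hφy
  let e : (ι → D) →ₗ[D] (ι → D) := (LinearMap.ker φ).subtype ∘ₗ θ.toLinearMap ∘ₗ P₁ + p.smulRight y
  let e' : (ι → D) →ₗ[D] (ι → D) :=
    (LinearMap.ker p).subtype ∘ₗ θ.symm.toLinearMap ∘ₗ P₂ + φ.smulRight (Pi.single i₀ 1)
  have he : ∀ r, e r = (θ (P₁ r) : ι → D) + p r • y := fun r => rfl
  have he' : ∀ r, e' r = (θ.symm (P₂ r) : ι → D) + φ r • Pi.single i₀ 1 := fun r => rfl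
  have hee : ∀ r, e' (e r) = r := by
    intro r
    have h1 : φ (e r) = p r := by
      rw [he, map_add, map_smul, hφy, LinearMap.mem_ker.1 (θ (P₁ r)).2, zero_add, smul_eq_mul,
        mul_one]
    have h2 : P₂ (e r) = θ (P₁ r) := by
      apply Subtype.ext
      rw [hP₂, h1, he, add_sub_cancel_right]
    rw [he', h1, h2, LinearEquiv.symm_apply_apply, hP₁, sub_add_cancel]
  have hee' : ∀ r, e (e' r) = r := by
    intro r
    have h1 : p (e' r) = φ r := by
      rw [he', map_add, map_smul, hp, LinearMap.mem_ker.1 (θ.symm (P₂ r)).2, zero_add, smul_eq_mul,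
        mul_one]
    have h2 : P₁ (e' r) = θ.symm (P₂ r) := by
      apply Subtype.ext
      rw [hP₁, h1, he', add_sub_cancel_right]
    rw [he, h1, h2, LinearEquiv.apply_symm_apply, hP₂, sub_add_cancel]
  have hmul : ∀ a b : (ι → D) →ₗ[D] (ι → D), (∀ r, b (a r) = r) →
      (Matrix.of fun i j => a (Pi.single i 1) j) * (Matrix.of fun i j => b (Pi.single i 1) j) = 1 := by
    intro a b hab
    ext i j
    have h1 := congrFun (hab (Pi.single i 1)) j
    rw [pi_eq_sum_univ' (a (Pi.single i 1)), map_sum, Finset.sum_apply] at h1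
    rw [Matrix.mul_apply]
    refine Eq.trans (Finset.sum_congr rfl fun l _ => ?_) (h1.trans ?_)
    · rw [map_smul]
      simp
    · simp [Matrix.one_apply, Pi.single_apply, eq_comm]
  refine ⟨⟨_, _, hmul e e' hee, hmul e' e hee'⟩, ?_⟩
  funext j
  change e (Pi.single i₀ 1) j = y j
  have : P₁ (Pi.single i₀ 1) = 0 := by
    apply Subtype.ext
    rw [hP₁, hp, one_smul, sub_self]
    rfl
  rw [he, this, map_zero, hp, one_smul]
  simp

end Unimodular

/-! ### Matrices supported on a relation -/

section Supports

variable {k : ℕ} {D : Type*} [Ring D]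

/-- The matrix `g` agrees with the identity matrix outside of the relation `r`. -/
def SuppOn (r : Fin k → Fin k → Prop) (g : Matrix (Fin k) (Fin k) D) : Prop :=
  ∀ i j, ¬ r i j → g i j = (1 : Matrix (Fin k) (Fin k) D) i j

theorem suppOn_iff {r : Fin k → Fin k → Prop} {g : Matrix (Fin k) (Fin k) D} :
    SuppOn r g ↔ ∀ i j, ¬ r i j → (g - 1) i j = 0 := by
  simp only [SuppOn, Matrix.sub_apply, sub_eq_zero]

theorem suppOn_one (r : Fin k → Fin k → Prop) : SuppOn r (1 : Matrix (Fin k) (Fin k) D) :=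
  fun _ _ _ => rfl

theorem SuppOn.mono {r r' : Fin k → Fin k → Prop} {g : Matrix (Fin k) (Fin k) D}
    (h : SuppOn r g) (hr : ∀ i j, r i j → r' i j) : SuppOn r' g :=
  fun i j hij => h i j fun h' => hij (hr i j h')

theorem SuppOn.mul {r : Fin k → Fin k → Prop} (hr : ∀ i j l, r i j → r j l → r i l)
    {g h : Matrix (Fin k) (Fin k) D} (hg : SuppOn r g) (hh : SuppOn r h) : SuppOn r (g * h) := by
  rw [suppOn_iff] at *
  intro i j hij
  have : g * h - 1 = (g - 1) * (h - 1) + (g - 1) + (h - 1) := by noncomm_ring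
  rw [this, Matrix.add_apply, Matrix.add_apply, hg i j hij, hh i j hij, add_zero, add_zero,
    Matrix.mul_apply]
  refine Finset.sum_eq_zero fun l _ => ?_
  by_cases h1 : r i l
  · rw [hh l j fun h2 => hij (hr _ _ _ h1 h2), mul_zero]
  · rw [hg i l h1, zero_mul]

/-- Since `g n g⁻¹ - 1 = g (n - 1) g⁻¹`, it suffices that composing `r` with `R` on either side
stays in `r`. -/
theorem SuppOn.conj {R r : Fin k → Fin k → Prop} {g : GLk k D} {n : Matrix (Fin k) (Fin k) D}
    (hg : SuppOn R g.1) (hg' : SuppOn R (g⁻¹).1) (hn : SuppOn r n)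
    (hl : ∀ i j l, R i j → r j l → r i l) (hr : ∀ i j l, r i j → R j l → r i l) :
    SuppOn r (g.1 * n * (g⁻¹).1) := by
  rw [suppOn_iff] at hn ⊢
  intro i j hij
  have : g.1 * n * (g⁻¹).1 - 1 = g.1 * (n - 1) * (g⁻¹).1 := by
    rw [mul_sub, sub_mul, mul_one, Units.mul_inv]
  rw [this, Matrix.mul_apply]
  refine Finset.sum_eq_zero fun l' _ => ?_
  rw [Matrix.mul_apply, Finset.sum_mul]
  refine Finset.sum_eq_zero fun l _ => ?_
  by_cases h1 : r l l'
  · by_cases h2 : r i l'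
    · have h3 : ¬ R l' j := fun h3 => hij (hr _ _ _ h2 h3)
      have h4 : l' ≠ j := by rintro rfl; exact hij h2
      rw [hg' _ _ h3, Matrix.one_apply_ne h4, mul_zero]
    · have h3 : ¬ R i l := fun h3 => h2 (hl _ _ _ h3 h1)
      have h4 : i ≠ l := by rintro rfl; exact h2 h1
      rw [hg _ _ h3, Matrix.one_apply_ne h4, zero_mul, zero_mul]
  · rw [hn _ _ h1, mul_zero, zero_mul]

theorem mul_mul_apply_of_col {g n h : Matrix (Fin k) (Fin k) D} {j : Fin k}
    (hh : ∀ l, h l j = (1 : Matrix (Fin k) (Fin k) D) l j) (i : Fin k) :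
    (g * n * h) i j = (g * n) i j := by
  rw [Matrix.mul_apply, Finset.sum_congr rfl fun l _ => by rw [hh l]]
  rw [← Matrix.mul_apply, mul_one]

theorem mul_apply_of_row {g n : Matrix (Fin k) (Fin k) D} {i : Fin k}
    (hg : ∀ l, g i l = (1 : Matrix (Fin k) (Fin k) D) i l) (j : Fin k) :
    (g * n) i j = n i j := by
  rw [Matrix.mul_apply, Finset.sum_congr rfl fun l _ => by rw [hg l]]
  rw [← Matrix.mul_apply, one_mul]

/-- Upper triangular unipotent matrices whose entries above the diagonal vanish in the columns
before `m`, except for those above and to the right of the position `(a, a)`. -/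
def unipRel (k a m : ℕ) (i j : Fin k) : Prop :=
  i < j ∧ (m ≤ j.val ∨ (i.val < a ∧ a ≤ j.val))

variable (k D) in
/-- The set of invertible matrices supported on `unipRel k a m`. -/
def unipSet (a m : ℕ) : Set (GLk k D) := {g | SuppOn (unipRel k a m) g.1}

theorem unipSet_subset {a a' m m' : ℕ} (h : ∀ i j, unipRel k a m i j → unipRel k a' m' i j) :
    unipSet k D a m ⊆ unipSet k D a' m' := fun _ hg => SuppOn.mono hg h

theorem unipSet_zero_anti {m m' : ℕ} (h : m ≤ m') : unipSet k D 0 m' ⊆ unipSet k D 0 m :=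
  unipSet_subset fun i j hij => ⟨hij.1, Or.inl (h.trans (hij.2.resolve_right fun h => by omega))⟩

theorem coe_N_eq_unipSet : (N k D : Set (GLk k D)) = unipSet k D 0 1 := by
  have h : ∀ i j : Fin k, i < j ↔ unipRel k 0 1 i j := fun i j => by
    unfold unipRel
    rw [Fin.lt_def]
    omega
  ext g
  exact ⟨fun hg => SuppOn.mono hg fun i j => (h i j).1, fun hg => SuppOn.mono hg fun i j =>
    (h i j).2⟩

theorem coe_U_eq_unipSet (a : ℕ) : (U k D a : Set (GLk k D)) = unipSet k D a k := by
  have h : ∀ i j : Fin k, (i.val < a ∧ a ≤ j.val) ↔ unipRel k a k i j := fun i j => by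
    unfold unipRel
    rw [Fin.lt_def]
    omega
  ext g
  exact ⟨fun hg => SuppOn.mono hg fun i j => (h i j).1, fun hg => SuppOn.mono hg fun i j =>
    (h i j).2⟩

variable (k D) in
/-- The group of invertible matrices that agree with the identity outside of the diagonal block
with indices in `[a, m)`. -/
def block (a m : ℕ) : Subgroup (GLk k D) where
  carrier := {g | SuppOn (fun i j => (a ≤ i.val ∧ i.val < m) ∧ (a ≤ j.val ∧ j.val < m)) g.1 ∧
    SuppOn (fun i j => (a ≤ i.val ∧ i.val < m) ∧ (a ≤ j.val ∧ j.val < m)) (g⁻¹).1}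
  one_mem' := ⟨suppOn_one _, by rw [inv_one]; exact suppOn_one _⟩
  mul_mem' hg hh := ⟨hg.1.mul (fun _ _ _ h h' => ⟨h.1, h'.2⟩) hh.1, by
    rw [mul_inv_rev]
    exact hh.2.mul (fun _ _ _ h h' => ⟨h.1, h'.2⟩) hg.2⟩
  inv_mem' hg := ⟨hg.2, by rw [inv_inv]; exact hg.1⟩

theorem block_mono {a a' m m' : ℕ} (ha : a' ≤ a) (hm : m ≤ m') :
    block k D a m ≤ block k D a' m' := by
  intro g hg
  have : ∀ i j : Fin k, ((a ≤ i.val ∧ i.val < m) ∧ (a ≤ j.val ∧ j.val < m)) →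
      ((a' ≤ i.val ∧ i.val < m') ∧ (a' ≤ j.val ∧ j.val < m')) := fun i j h => by omega
  exact ⟨hg.1.mono this, hg.2.mono this⟩

theorem block_le_P {m : ℕ} (hm : m < k) : block k D 0 m ≤ P k D := by
  intro g hg
  change Matrix.vecMul (lastRow k D) g.1 = lastRow k D
  ext j
  rw [Matrix.vecMul, dotProduct, Finset.sum_eq_single (⟨k - 1, by omega⟩ : Fin k)]
  · rw [hg.1 _ _ (by dsimp only; omega)]
    simp only [lastRow, Matrix.one_apply, Fin.ext_iff]
    split_ifs <;> first | omega | simp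
  · intro i _ hi
    rw [lastRow, if_neg, zero_mul]
    intro h
    exact hi (Fin.ext (by dsimp only; omega))
  · simp

theorem block_zero_eq_bot : block k D 0 0 = ⊥ := by
  rw [eq_bot_iff]
  intro g hg
  rw [Subgroup.mem_bot]
  ext i j
  exact hg.1 i j (by omega)

theorem block_top (g : GLk k D) : g ∈ block k D 0 k :=
  ⟨fun i j h => absurd ⟨⟨i.val.zero_le, i.isLt⟩, ⟨j.val.zero_le, j.isLt⟩⟩ h,
    fun i j h => absurd ⟨⟨i.val.zero_le, i.isLt⟩, ⟨j.val.zero_le, j.isLt⟩⟩ h⟩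

theorem block_conj_mem {a m : ℕ} {g n : GLk k D} (hg : g ∈ block k D a m)
    (hn : n ∈ unipSet k D a m) : g * n * g⁻¹ ∈ unipSet k D a m := by
  refine SuppOn.conj (g := g) hg.1 hg.2 hn ?_ ?_
  · intro i j l h1 h2
    obtain ⟨h2, h3⟩ := h2
    rw [Fin.lt_def] at h2
    refine ⟨?_, ?_⟩
    · rw [Fin.lt_def]; omega
    · omega
  · intro i j l h1 h2
    obtain ⟨h1, h3⟩ := h1
    rw [Fin.lt_def] at h1
    refine ⟨?_, ?_⟩
    · rw [Fin.lt_def]; omega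
    · omega

/-- The sum of the superdiagonal entries in the columns from `m` on. -/
def superdiagFrom (m : ℕ) (g : Matrix (Fin k) (Fin k) D) : D :=
  ∑ i : Fin k, ∑ j : Fin k, if i.val + 1 = j.val ∧ m ≤ j.val then g i j else 0

theorem superdiagFrom_congr {m : ℕ} {g h : Matrix (Fin k) (Fin k) D}
    (e : ∀ i j : Fin k, i.val + 1 = j.val → m ≤ j.val → g i j = h i j) :
    superdiagFrom m g = superdiagFrom m h := by
  refine Finset.sum_congr rfl fun i _ => Finset.sum_congr rfl fun j _ => ?_
  split_ifs with hij
  · exact e i j hij.1 hij.2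
  · rfl

theorem superdiagFrom_one (g : Matrix (Fin k) (Fin k) D) : superdiagFrom 1 g = superdiagSum g := by
  refine Finset.sum_congr rfl fun i _ => Finset.sum_congr rfl fun j _ => ?_
  congr 1
  rw [eq_iff_iff]
  omega

theorem superdiagFrom_eq_of_suppOn {m m' : ℕ} (h : m' ≤ m) {g : Matrix (Fin k) (Fin k) D}
    (hg : SuppOn (unipRel k 0 m) g) : superdiagFrom m' g = superdiagFrom m g := by
  refine Finset.sum_congr rfl fun i _ => Finset.sum_congr rfl fun j _ => ?_
  split_ifs with h1 h2 h2
  · rfl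
  · rw [hg i j (by unfold unipRel; omega), Matrix.one_apply_ne]
    rintro rfl
    omega
  · omega
  · rfl

/-- The row vector with entry `1` in position `m - 1`. -/
def unitRow (k m : ℕ) (D : Type*) [Ring D] : Fin k → D := fun i => if i.val + 1 = m then 1 else 0

theorem superdiagFrom_eq (m : Fin k) (g : Matrix (Fin k) (Fin k) D) :
    superdiagFrom m.val g = ∑ i, unitRow k m D i * g i m + superdiagFrom (m.val + 1) g := by
  unfold superdiagFrom
  rw [← Finset.sum_add_distrib]
  refine Finset.sum_congr rfl fun i _ => ?_
  have h1 : unitRow k m D i * g i m = ∑ j : Fin k, if j = m then unitRow k m D i * g i j else 0 := by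
    simp
  rw [h1, ← Finset.sum_add_distrib]
  refine Finset.sum_congr rfl fun j _ => ?_
  simp only [unitRow, Fin.ext_iff]
  split_ifs <;> first | omega | simp

/-- The row `y` is the row with index `m - 1` of an invertible matrix supported on the block
`[a, m)`. -/
def Nondegenerate (a m : ℕ) (y : Fin k → D) : Prop :=
  ∃ g ∈ block k D a m, y = Matrix.vecMul (unitRow k m D) g.1

theorem sum_mul_row {y : Fin k → D} (g n : Matrix (Fin k) (Fin k) D) (m : Fin k) :
    ∑ i, y i * (g * n) i m = ∑ i, Matrix.vecMul y g i * n i m := by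
  change Matrix.vecMul y (g * n) m = Matrix.vecMul (Matrix.vecMul y g) n m
  rw [Matrix.vecMul_vecMul]

theorem vecMul_unitRow_apply {m : ℕ} (hm : 0 < m) (hmk : m ≤ k) (g : Matrix (Fin k) (Fin k) D)
    (j : Fin k) : Matrix.vecMul (unitRow k m D) g j = g ⟨m - 1, by omega⟩ j := by
  rw [Matrix.vecMul, dotProduct, Finset.sum_eq_single (⟨m - 1, by omega⟩ : Fin k)]
  · rw [unitRow, if_pos (by dsimp only; omega), one_mul]
  · intro i _ hi
    rw [unitRow, if_neg, zero_mul]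
    intro h
    exact hi (Fin.ext (by dsimp only; omega))
  · simp

theorem not_nondegenerate_zero [Nontrivial D] {m : ℕ} (hm : 0 < m) (hmk : m ≤ k) :
    ¬ Nondegenerate 0 m (0 : Fin k → D) := by
  rintro ⟨g, -, hg⟩
  have h1 : (g.1 * (g⁻¹).1) ⟨m - 1, by omega⟩ ⟨m - 1, by omega⟩ = 1 := by
    rw [Units.mul_inv, Matrix.one_apply_eq]
  rw [Matrix.mul_apply, Finset.sum_eq_zero] at h1
  · exact zero_ne_one h1
  · intro l _
    rw [← vecMul_unitRow_apply hm hmk g.1, ← hg, Pi.zero_apply, zero_mul]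

/-- Extension of an invertible matrix by the identity. -/
def extendUnit (p : Fin k → Prop) [DecidablePred p] (h : (Matrix {i // p i} {i // p i} D)ˣ) :
    GLk k D where
  val := (Matrix.fromBlocks h.1 0 0 1).submatrix (Equiv.sumCompl p).symm (Equiv.sumCompl p).symm
  inv := (Matrix.fromBlocks (h⁻¹).1 0 0 1).submatrix (Equiv.sumCompl p).symm
    (Equiv.sumCompl p).symm
  val_inv := by
    rw [Matrix.submatrix_mul_equiv, Matrix.fromBlocks_multiply]
    simp
  inv_val := by
    rw [Matrix.submatrix_mul_equiv, Matrix.fromBlocks_multiply]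
    simp

theorem extendUnit_apply (p : Fin k → Prop) [DecidablePred p]
    (h : Matrix {i // p i} {i // p i} D) (i j : Fin k) :
    (Matrix.fromBlocks h 0 0 1).submatrix (Equiv.sumCompl p).symm (Equiv.sumCompl p).symm i j
      = if hij : p i ∧ p j then h ⟨i, hij.1⟩ ⟨j, hij.2⟩
        else (1 : Matrix (Fin k) (Fin k) D) i j := by
  rw [Matrix.submatrix_apply]
  by_cases hi : p i <;> by_cases hj : p j
  · rw [Equiv.sumCompl_symm_apply_of_pos hi, Equiv.sumCompl_symm_apply_of_pos hj]
    simp [hi, hj]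
  · rw [Equiv.sumCompl_symm_apply_of_pos hi, Equiv.sumCompl_symm_apply_of_neg hj]
    have : i ≠ j := by rintro rfl; exact hj hi
    simp [hj, Matrix.one_apply_ne this]
  · rw [Equiv.sumCompl_symm_apply_of_neg hi, Equiv.sumCompl_symm_apply_of_pos hj]
    have : i ≠ j := by rintro rfl; exact hi hj
    simp [hi, Matrix.one_apply_ne this]
  · rw [Equiv.sumCompl_symm_apply_of_neg hi, Equiv.sumCompl_symm_apply_of_neg hj]
    simp [hi, Matrix.one_apply]

theorem extendUnit_mem_block (a m : ℕ)
    (h : (Matrix {i : Fin k // a ≤ i.val ∧ i.val < m} {i : Fin k // a ≤ i.val ∧ i.val < m} D)ˣ) :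
    extendUnit _ h ∈ block k D a m := by
  refine ⟨fun i j hij => ?_, fun i j hij => ?_⟩
  · exact (extendUnit_apply _ _ i j).trans (dif_neg hij)
  · exact (extendUnit_apply _ _ i j).trans (dif_neg hij)

/-- Column `m - 1` of `g⁻¹` witnesses that `y` is unimodular, and this involves only its entries in
`[a, m)`. The row can thus be completed inside the smaller block, which normalizes `unipSet k D a
m`. -/
theorem Nondegenerate.of_support (F : Type*) [Field F] [Algebra F D] [IsSimpleRing D]
    [FiniteDimensional F D] {a m : ℕ} (ham : a < m) (hmk : m ≤ k) {y : Fin k → D}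
    (hy : ∀ i, ¬ (a ≤ i.val ∧ i.val < m) → y i = 0) (h : Nondegenerate 0 m y) :
    Nondegenerate a m y := by
  obtain ⟨g, -, hg⟩ := h
  let i₀ : {i : Fin k // a ≤ i.val ∧ i.val < m} := ⟨⟨m - 1, by omega⟩, by dsimp only; omega⟩
  have h1 : ∑ i, y i * (g⁻¹).1 i i₀.1 = 1 := by
    rw [hg]
    change Matrix.vecMul (Matrix.vecMul (unitRow k m D) g.1) (g⁻¹).1 i₀.1 = 1
    rw [Matrix.vecMul_vecMul, Units.mul_inv, Matrix.vecMul_one, unitRow,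
      if_pos (by dsimp only [i₀]; omega)]
  obtain ⟨u, hu⟩ := exists_unit_row F i₀ (fun i => y i.1) (fun i => (g⁻¹).1 i.1 i₀.1) (by
    rw [← h1, ← Finset.sum_subtype
      (Finset.univ.filter fun i : Fin k => a ≤ i.val ∧ i.val < m) (by simp)
      (fun i => y i * (g⁻¹).1 i i₀.1)]
    refine Finset.sum_filter_of_ne fun i _ hi => ?_
    by_contra hc
    exact hi (by rw [hy i hc, zero_mul]))
  refine ⟨extendUnit _ u, extendUnit_mem_block a m u, ?_⟩
  ext j
  rw [vecMul_unitRow_apply (by omega) hmk]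
  refine Eq.trans ?_ (extendUnit_apply _ _ _ j).symm
  split_ifs with hj
  · exact (congrFun hu ⟨j, hj.2⟩).symm
  · have hj' : ¬ (a ≤ j.val ∧ j.val < m) := fun h => hj ⟨i₀.2, h⟩
    rw [hy j hj', Matrix.one_apply_ne]
    rintro rfl
    exact hj' i₀.2

end Supports

/-! ### Abelian unipotent subgroups -/

section BlockUnip

variable {k : ℕ} {D : Type*} [Ring D]

open Classical in
/-- The part of a matrix lying on the relation `r`. -/
def relPart (r : Fin k → Fin k → Prop) (x : Fin k → Fin k → D) : Matrix (Fin k) (Fin k) D :=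
  Matrix.of fun i j => if r i j then x i j else 0

theorem relPart_of_not {r : Fin k → Fin k → Prop} {x : Fin k → Fin k → D} {i j : Fin k}
    (h : ¬ r i j) : relPart r x i j = 0 := if_neg h

theorem relPart_of {r : Fin k → Fin k → Prop} {x : Fin k → Fin k → D} {i j : Fin k}
    (h : r i j) : relPart r x i j = x i j := if_pos h

theorem relPart_add (r : Fin k → Fin k → Prop) (x y : Fin k → Fin k → D) :
    relPart r (x + y) = relPart r x + relPart r y := by
  ext i j
  by_cases h : r i j
  · simp [relPart_of h]
  · simp [relPart_of_not h]

theorem relPart_mul {r : Fin k → Fin k → Prop} (hr : ∀ i j l, r i j → ¬ r j l)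
    (x y : Fin k → Fin k → D) : relPart r x * relPart r y = 0 := by
  ext i j
  rw [Matrix.mul_apply]
  refine Finset.sum_eq_zero fun l _ => ?_
  by_cases h : r i l
  · rw [relPart_of_not (hr _ _ _ h), mul_zero]
  · rw [relPart_of_not h, zero_mul]

/-- The unipotent matrix `1 + x`, for a matrix `x` supported on a relation `r` without
compositions. -/
def blockUnip (r : Fin k → Fin k → Prop) (hr : ∀ i j l, r i j → ¬ r j l)
    (x : Fin k → Fin k → D) : GLk k D where
  val := 1 + relPart r x
  inv := 1 - relPart r x
  val_inv := by rw [add_mul, one_mul, mul_sub, mul_one, relPart_mul hr]; abel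
  inv_val := by rw [sub_mul, one_mul, mul_add, mul_one, relPart_mul hr]; abel

variable {r : Fin k → Fin k → Prop} {hr : ∀ i j l, r i j → ¬ r j l}

theorem blockUnip_add (x y : Fin k → Fin k → D) :
    blockUnip r hr (x + y) = blockUnip r hr x * blockUnip r hr y := by
  apply Units.ext
  change 1 + relPart r (x + y) = (1 + relPart r x) * (1 + relPart r y)
  rw [relPart_add, add_mul, one_mul, mul_add, mul_one, relPart_mul hr]
  abel

theorem blockUnip_zero : blockUnip r hr (0 : Fin k → Fin k → D) = 1 := by
  have := blockUnip_add (hr := hr) (0 : Fin k → Fin k → D) 0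
  rw [add_zero] at this
  exact left_eq_mul.1 this

theorem suppOn_blockUnip (x : Fin k → Fin k → D) : SuppOn r (blockUnip r hr x).1 := by
  intro i j h
  change (1 + relPart r x) i j = _
  rw [Matrix.add_apply, relPart_of_not h, add_zero]

theorem suppOn_blockUnip_inv (x : Fin k → Fin k → D) : SuppOn r ((blockUnip r hr x)⁻¹).1 := by
  intro i j h
  change (1 - relPart r x) i j = _
  rw [Matrix.sub_apply, relPart_of_not h, sub_zero]

theorem blockUnip_apply (x : Fin k → Fin k → D) {i j : Fin k} (h : r i j) :
    (blockUnip r hr x).1 i j = x i j := by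
  change (1 + relPart r x) i j = _
  have : i ≠ j := by rintro rfl; exact hr _ _ _ h h
  rw [Matrix.add_apply, relPart_of h, Matrix.one_apply_ne this, zero_add]

theorem blockUnip_eq {g : GLk k D} (hg : SuppOn r g.1) (x : Fin k → Fin k → D)
    (h : ∀ i j, r i j → g.1 i j = x i j) : g = blockUnip r hr x := by
  ext i j
  by_cases hij : r i j
  · rw [h i j hij, blockUnip_apply x hij]
  · rw [hg i j hij, suppOn_blockUnip x i j hij]

theorem continuous_blockUnip [TopologicalSpace D] [IsTopologicalRing D] :
    Continuous (blockUnip r hr : (Fin k → Fin k → D) → GLk k D) := by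
  have h : Continuous (relPart r : (Fin k → Fin k → D) → Matrix (Fin k) (Fin k) D) := by
    refine continuous_matrix fun i j => ?_
    by_cases h : r i j
    · simp only [relPart_of h]; fun_prop
    · simp only [relPart_of_not h]; fun_prop
  exact Units.continuous_iff.2 ⟨continuous_const.add h, continuous_const.sub h⟩

/-- The positions in column `m` and in the rows `[a, m)`. -/
def colRel (k a m : ℕ) (i j : Fin k) : Prop := (a ≤ i.val ∧ i.val < m) ∧ j.val = m

theorem colRel_not_comp (a m : ℕ) (i j l : Fin k) : colRel k a m i j → ¬ colRel k a m j l := by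
  unfold colRel
  omega

/-- The elementary unipotent matrix with column `m` given by `x`. -/
def colUnip (a m : ℕ) (x : Fin k → D) : GLk k D :=
  blockUnip (colRel k a m) (colRel_not_comp a m) fun i _ => x i

theorem colUnip_inv_row (a m : ℕ) (x : Fin k → D) {i : Fin k} (h : ¬ (a ≤ i.val ∧ i.val < m))
    (l : Fin k) : ((colUnip a m x)⁻¹).1 i l = (1 : Matrix (Fin k) (Fin k) D) i l :=
  suppOn_blockUnip_inv _ i l fun h' => h h'.1

theorem colUnip_row (a m : ℕ) (x : Fin k → D) {i : Fin k} (h : ¬ (a ≤ i.val ∧ i.val < m))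
    (l : Fin k) : (colUnip a m x).1 i l = (1 : Matrix (Fin k) (Fin k) D) i l :=
  suppOn_blockUnip _ i l fun h' => h h'.1

theorem colUnip_inv_col (a m : ℕ) (x : Fin k → D) {j : Fin k} (h : j.val ≠ m)
    (l : Fin k) : ((colUnip a m x)⁻¹).1 l j = (1 : Matrix (Fin k) (Fin k) D) l j :=
  suppOn_blockUnip_inv _ l j fun h' => h h'.2

theorem colUnip_mem_unipSet (a : ℕ) {m : ℕ} (x : Fin k → D) :
    colUnip a m x ∈ unipSet k D 0 m :=
  (suppOn_blockUnip _).mono fun i j h => by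
    unfold colRel at h
    exact ⟨Fin.lt_def.2 (by omega), by omega⟩

theorem colUnip_conj_mem {a m : ℕ} (x : Fin k → D) {n : GLk k D}
    (hn : n ∈ unipSet k D a (m + 1)) :
    colUnip a m x * n * (colUnip a m x)⁻¹ ∈ unipSet k D a (m + 1) := by
  refine SuppOn.conj (g := colUnip a m x) (suppOn_blockUnip _) (suppOn_blockUnip_inv _) hn ?_ ?_
  · intro i j l h1 h2
    obtain ⟨h2, h3⟩ := h2
    unfold colRel at h1
    rw [Fin.lt_def] at h2
    refine ⟨?_, ?_⟩
    · rw [Fin.lt_def]; omega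
    · omega
  · intro i j l h1 h2
    obtain ⟨h1, h3⟩ := h1
    unfold colRel at h2
    rw [Fin.lt_def] at h1
    refine ⟨?_, ?_⟩
    · rw [Fin.lt_def]; omega
    · omega

/-- The conjugation changes only rows before `m` and column `m`, whereas superdiagonal entries in
columns past `m` lie in rows from `m` on. With `colUnip_conj_mem`, column `m` acts on the
Whittaker-twisted coinvariants of `unipSet k D a (m + 1)`. -/
theorem superdiagFrom_colUnip_conj {a m : ℕ} (x : Fin k → D) (n : GLk k D) :
    superdiagFrom (m + 1) (colUnip a m x * n * (colUnip a m x)⁻¹).1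
      = superdiagFrom (m + 1) n.1 := by
  refine superdiagFrom_congr fun i j hij hj => ?_
  rw [Units.val_mul, Units.val_mul, mul_mul_apply_of_col (colUnip_inv_col a m x (by omega)),
    mul_apply_of_row (colUnip_row a m x (by omega))]

/-- Clearing column `m` in rows `[a, m)` does not disturb the earlier columns, because row `m` of
`n` vanishes left of the diagonal. This is the factorization used in the climb from column `m` to `m
+ 1`. -/
theorem colUnip_inv_mul_mem {a m : ℕ} (ham : a ≤ m) (hm : m < k) {n : GLk k D}
    (hn : n ∈ unipSet k D a m) :
    (colUnip a m fun i => n.1 i ⟨m, hm⟩)⁻¹ * n ∈ unipSet k D a (m + 1) := by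
  intro i j hij
  by_cases hi : a ≤ i.val ∧ i.val < m
  · have hrow : ((colUnip a m fun i => n.1 i ⟨m, hm⟩)⁻¹ * n).1 i j
        = n.1 i j - n.1 i ⟨m, hm⟩ * n.1 ⟨m, hm⟩ j := by
      change ((1 - relPart (colRel k a m) fun i _ => n.1 i ⟨m, hm⟩) * n.1) i j = _
      rw [sub_mul, one_mul, Matrix.sub_apply, Matrix.mul_apply, Finset.sum_eq_single ⟨m, hm⟩]
      · rw [relPart_of ⟨hi, rfl⟩]
      · intro l _ hl
        rw [relPart_of_not, zero_mul]
        intro h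
        exact hl (Fin.ext h.2)
      · simp
    rw [hrow]
    unfold unipRel at hij
    rcases lt_trichotomy j.val m with h | h | h
    · have h0 : n.1 ⟨m, hm⟩ j = 0 := (hn ⟨m, hm⟩ j (by unfold unipRel; dsimp only; omega)).trans
        (Matrix.one_apply_ne (by rintro rfl; exact lt_irrefl _ h))
      rw [h0, mul_zero, sub_zero, hn i j (by unfold unipRel; omega)]
    · have hj : j = ⟨m, hm⟩ := Fin.ext h
      subst hj
      rw [hn ⟨m, hm⟩ ⟨m, hm⟩ (by unfold unipRel; simp), Matrix.one_apply_eq, mul_one, sub_self,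
        Matrix.one_apply_ne]
      rintro rfl
      exact lt_irrefl _ hi.2
    · exact absurd ⟨Fin.lt_def.2 (by omega), Or.inl h⟩ hij
  · rw [Units.val_mul, mul_apply_of_row (colUnip_inv_row a m _ hi)]
    refine hn i j fun h => hij ?_
    unfold unipRel at h ⊢
    rw [Fin.lt_def] at h ⊢
    omega

theorem superdiagFrom_colUnip_inv_mul {a m : ℕ} (x : Fin k → D) (n : GLk k D) :
    superdiagFrom (m + 1) ((colUnip a m x)⁻¹ * n).1 = superdiagFrom (m + 1) n.1 := by
  refine superdiagFrom_congr fun i j hij hj => ?_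
  rw [Units.val_mul, mul_apply_of_row (colUnip_inv_row a m x (by omega))]

end BlockUnip

/-! ### The characters -/

section Characters

variable {F : Type*} [Field F] {k : ℕ} {D : Type*} [Ring D] [Algebra F D]

/-- The function `ψ(tr(∑ g_{j-1,j}))`, where the sum is over the columns `j ≥ m`. -/
def eta (ψ : AddChar F Circle) (m : ℕ) (g : GLk k D) : Circle :=
  ψ (reducedTrace F (superdiagFrom m g.1))

/-- The function `ψ(tr(∑ y_i g_{i,m} + ∑ g_{j-1,j}))`, where the second sum is over the columns
`j > m`. -/
def theta (ψ : AddChar F Circle) (m : Fin k) (y : Fin k → D) (g : GLk k D) : Circle :=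
  ψ (reducedTrace F (∑ i, y i * g.1 i m + superdiagFrom (m.val + 1) g.1))

variable (ψ : AddChar F Circle)

theorem theta_unitRow (m : Fin k) (g : GLk k D) : theta ψ m (unitRow k m D) g = eta ψ m.val g := by
  rw [theta, eta, superdiagFrom_eq]

theorem eta_eq_of_mem {m m' : ℕ} (h : m' ≤ m) {g : GLk k D} (hg : g ∈ unipSet k D 0 m) :
    eta ψ m' g = eta ψ m g := by
  rw [eta, eta, superdiagFrom_eq_of_suppOn h hg]

/-- On `unipSet k D 0 m` the earlier column `m'` is trivial, so `y` is invisible; `y m' = 0`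
disposes of the diagonal entry `1`. Relations for a late column thereby imply relations for all
earlier ones. -/
theorem eta_eq_theta_of_mem {m : ℕ} {m' : Fin k} (h : m'.val < m) {g : GLk k D}
    (hg : g ∈ unipSet k D 0 m) {y : Fin k → D} (hy : y m' = 0) : eta ψ m g = theta ψ m' y g := by
  rw [eta, theta, superdiagFrom_eq_of_suppOn h hg, Finset.sum_eq_zero, zero_add]
  intro i _
  rw [hg i m' (by unfold unipRel; omega)]
  by_cases hi : i = m'
  · rw [hi, hy, zero_mul]
  · rw [Matrix.one_apply_ne hi, mul_zero]

/-- Right multiplication by `g⁻¹` leaves the columns from `m` on alone, and left multiplication by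
`g` only touches rows before `m`. Hence only the linear form on column `m` changes. -/
theorem theta_block_conj {a : ℕ} {m : Fin k} {g : GLk k D} (hg : g ∈ block k D a m)
    (y : Fin k → D) (n : GLk k D) :
    theta ψ m y (g * n * g⁻¹) = theta ψ m (Matrix.vecMul y g.1) n := by
  rw [theta, theta]
  have h1 : ∀ j : Fin k, m.val ≤ j.val → ∀ i, (g * n * g⁻¹).1 i j = (g.1 * n.1) i j := by
    intro j hj i
    rw [Units.val_mul, Units.val_mul, mul_mul_apply_of_col]
    exact fun l => hg.2 l j (by omega)
  congr 3
  · rw [← sum_mul_row]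
    exact Finset.sum_congr rfl fun i _ => by rw [h1 m le_rfl]
  · refine superdiagFrom_congr fun i j hij hj => ?_
    rw [h1 j (by omega), mul_apply_of_row]
    exact fun l => hg.1 i l (by omega)

theorem psiN_eq_eta (g : N k D) : psiN ψ k D g = eta ψ 1 g.1 := by
  rw [eta, superdiagFrom_one]
  rfl

end Characters

/-! ### Detecting vectors by their twisted coinvariants in one more column -/

section ColumnStep

open Topology

variable {F : Type*} [Field F] [ValuativeRel F] [TopologicalSpace F] [IsNonarchimedeanLocalField F]
    [CharZero F] {k : ℕ}
    {D : Type*} [Ring D] [Algebra F D] [IsSimpleRing D]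
    [FiniteDimensional F D] [TopologicalSpace D] [IsTopologicalRing D] [IsModuleTopology F D]
    {V : Type*} [AddCommGroup V] [Module ℂ V]

/-- The index type of the entries in column `m` and rows `[a, m)`. -/
abbrev ColIdx (k a m : ℕ) := {i : Fin k // a ≤ i.val ∧ i.val < m}

/-- Extension by zero. -/
def colExt {a m : ℕ} (x : ColIdx k a m → D) (i : Fin k) : D :=
  if h : a ≤ i.val ∧ i.val < m then x ⟨i, h⟩ else 0

theorem colExt_of_not {a m : ℕ} (x : ColIdx k a m → D) {i : Fin k}
    (h : ¬ (a ≤ i.val ∧ i.val < m)) : colExt x i = 0 := dif_neg h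

theorem colExt_coe {a m : ℕ} (x : ColIdx k a m → D) (i : ColIdx k a m) : colExt x i.1 = x i :=
  dif_pos i.2

theorem colExt_add {a m : ℕ} (x y : ColIdx k a m → D) : colExt (x + y) = colExt x + colExt y := by
  ext i
  by_cases h : a ≤ i.val ∧ i.val < m
  · simp [colExt, h]
  · simp [colExt, h]

theorem continuous_colExt {a m : ℕ} : Continuous (colExt : (ColIdx k a m → D) → Fin k → D) := by
  refine continuous_pi fun i => ?_
  by_cases h : a ≤ i.val ∧ i.val < m
  · simp only [colExt, h, and_self, dite_true]; fun_prop
  · simp only [colExt, h, dite_false]; fun_prop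

theorem sum_colExt_mul {a m : ℕ} (y : ColIdx k a m → D) (z : Fin k → D) :
    ∑ i, colExt y i * z i = ∑ i, y i * z i.1 := by
  have h1 : ∑ i, y i * z i.1 = ∑ i : ColIdx k a m, colExt y i.1 * z i.1 :=
    Finset.sum_congr rfl fun i _ => by rw [colExt_coe]
  rw [h1, ← Finset.sum_subtype (Finset.univ.filter fun i : Fin k => a ≤ i.val ∧ i.val < m)
    (by simp) (fun i => colExt y i * z i)]
  refine (Finset.sum_filter_of_ne fun i _ hi => ?_).symm
  by_contra hc
  exact hi (by rw [colExt_of_not y hc, zero_mul])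

theorem continuous_colUnip {a m : ℕ} :
    Continuous fun x : ColIdx k a m → D => colUnip a m (colExt x) := by
  refine (continuous_blockUnip (D := D)).comp ?_
  exact continuous_pi fun i => continuous_pi fun _ => (continuous_apply i).comp continuous_colExt

theorem colUnip_colExt_add {a m : ℕ} (x y : ColIdx k a m → D) :
    colUnip a m (colExt (x + y)) = colUnip a m (colExt x) * colUnip a m (colExt y) := by
  rw [colExt_add]
  exact blockUnip_add _ _

theorem colUnip_colExt_zero {a m : ℕ} : colUnip a m (colExt (0 : ColIdx k a m → D)) = 1 := by
  have : colExt (0 : ColIdx k a m → D) = 0 := by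
    ext i
    simp [colExt]
  rw [this]
  exact blockUnip_zero

/-- A smooth representation restricts to a smooth action of a column. -/
theorem isSmoothAction_colUnip {π : Representation ℂ (GLk k D) V} (hsm : IsSmooth π) (a m : ℕ) :
    IsSmoothAction fun x : ColIdx k a m → D => π (colUnip a m (colExt x)) where
  zero := by rw [colUnip_colExt_zero, map_one]; rfl
  add x y := by rw [colUnip_colExt_add, map_mul]; rfl
  smooth w := by
    refine ⟨_, (continuous_colUnip (k := k) (D := D) (a := a) (m := m)).continuousAt
      ((hsm w).mem_nhds ?_), fun x hx => hx⟩
    simp [colUnip_colExt_zero]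

/-- Fourier inversion for column `m`, acting on the quotient `V ⧸ p`: the relations for `theta ψ m
y` map into the relations for the character `y` of the column, so the image of `v` dies for every
character and is zero. -/
theorem mem_twistKer_eta_succ {ψ : AddChar F Circle} (hψ : Continuous ψ) (hψ1 : ψ ≠ 1)
    {π : Representation ℂ (GLk k D) V} (hsm : IsSmooth π) {a : ℕ} (m : Fin k) (ham : a ≤ m.val)
    {v : V} (h : ∀ y : Fin k → D, (∀ i, ¬ (a ≤ i.val ∧ i.val < m.val) → y i = 0) →
      v ∈ twistKer π (unipSet k D a m) (theta ψ m y)) :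
    v ∈ twistKer π (unipSet k D a (m.val + 1)) (eta ψ (m.val + 1)) := by
  set p := twistKer π (unipSet k D a (m.val + 1)) (eta ψ (m.val + 1)) with hp
  let s : (ColIdx k a m → D) → GLk k D := fun x => colUnip a m (colExt x)
  have hs : ∀ x, p ≤ p.comap (π (s x)) := fun x w hw =>
    conj_mem_twistKer π (s x) (fun n hn => ⟨colUnip_conj_mem _ hn, by
      rw [eta, superdiagFrom_colUnip_conj, eta]⟩) hw
  have hπ := isSmoothAction_colUnip hsm a m.val
  let T : (ColIdx k a m → D) → (V ⧸ p) →ₗ[ℂ] (V ⧸ p) := fun x => p.mapQ p (π (s x)) (hs x)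
  have hT : IsSmoothAction T :=
    { zero := by
        ext w
        have := LinearMap.congr_fun hπ.zero w
        exact congrArg p.mkQ this
      add := fun x y => by
        ext w
        have := LinearMap.congr_fun (hπ.add x y) w
        exact congrArg p.mkQ this
      smooth := fun w => by
        obtain ⟨w, rfl⟩ := p.mkQ_surjective w
        obtain ⟨U, hU, h⟩ := hπ.smooth w
        exact ⟨U, hU, fun x hx => congrArg p.mkQ (h x hx)⟩ }
  rw [← Submodule.ker_mkQ p, LinearMap.mem_ker]
  refine eq_zero_of_forall_mem_twistKer hψ hψ1 (tracePairing_injective (F := F) (ColIdx k a m))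
    (tracePairing_flip_injective (F := F) (ColIdx k a m)) hT fun y => ?_
  have h1 := h (colExt y) fun i hi => colExt_of_not y hi
  suffices twistKer π (unipSet k D a m) (theta ψ m (colExt y)) ≤
    (twistKer T Set.univ (pairChar ψ (tracePairing F D (ColIdx k a m)) y)).comap p.mkQ from this h1
  refine twistKer_le fun n hn w => ?_
  -- Write `n = s x * ((s x)⁻¹ * n)`: the second factor acts on the quotient through `eta`, and the
  -- first is an element of the column.
  let x : ColIdx k a m → D := fun i => n.1 i.1 m
  have hx : colUnip a m.val (fun i => n.1 i m) = s x := by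
    refine (blockUnip_eq (g := s x) (suppOn_blockUnip _) _ fun i j hij => ?_).symm
    refine (blockUnip_apply _ hij).trans ?_
    exact colExt_coe x ⟨i, hij.1⟩
  have hm := colUnip_inv_mul_mem ham m.isLt hn
  have hη := superdiagFrom_colUnip_inv_mul (a := a) (m := m.val) (fun i => n.1 i m) n
  change (colUnip a m.val fun i => n.1 i m)⁻¹ * n ∈ _ at hm
  rw [hx] at hm hη
  have hθ : theta ψ m (colExt y) n = pairChar ψ (tracePairing F D (ColIdx k a m)) y x *
      eta ψ (m.val + 1) ((s x)⁻¹ * n) := by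
    rw [theta, eta, hη, sum_colExt_mul, map_add, AddChar.map_add_eq_mul]
    rfl
  have h2 : p.mkQ (π ((s x)⁻¹ * n) w) = (eta ψ (m.val + 1) ((s x)⁻¹ * n) : ℂ) • p.mkQ w := by
    rw [← map_smul, ← sub_eq_zero, ← map_sub, ← LinearMap.mem_ker, Submodule.ker_mkQ]
    exact sub_mem_twistKer π (eta ψ (m.val + 1)) hm w
  have h3 : p.mkQ (π n w) = T x (p.mkQ (π ((s x)⁻¹ * n) w)) := by
    change _ = p.mkQ (π (s x) (π ((s x)⁻¹ * n) w))
    rw [← Module.End.mul_apply, ← map_mul, mul_inv_cancel_left]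
  rw [Submodule.mem_comap, map_sub, map_smul, h3, h2, map_smul, hθ, Circle.coe_mul, mul_comm,
    mul_smul, ← smul_sub]
  exact Submodule.smul_mem _ _ (sub_mem_twistKer T _ (Set.mem_univ x) _)

end ColumnStep

/-! ### The subspace of vectors without degenerate twisted coinvariants -/

section Core

variable {F : Type*} [Field F] {k : ℕ} {D : Type*} [Ring D] [Algebra F D]
  {V : Type*} [AddCommGroup V] [Module ℂ V]

/-- The vectors whose translates by `P_{k,D}` have no degenerate twisted coinvariants. -/
def kirillovCore (ψ : AddChar F Circle) (π : Representation ℂ (GLk k D) V) : Submodule ℂ V where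
  carrier := {v | ∀ p ∈ P k D, ∀ m : Fin k, 0 < m.val → ∀ y : Fin k → D,
    (∀ i : Fin k, ¬ i.val < m.val → y i = 0) → ¬ Nondegenerate 0 m y →
      π p v ∈ twistKer π (unipSet k D 0 m) (theta ψ m y)}
  add_mem' hv hw p hp m hm y hy hd := by
    rw [map_add]
    exact Submodule.add_mem _ (hv p hp m hm y hy hd) (hw p hp m hm y hy hd)
  zero_mem' p _ m _ y _ _ := by
    rw [map_zero]
    exact Submodule.zero_mem _
  smul_mem' c v hv p hp m hm y hy hd := by
    rw [map_smul]
    exact Submodule.smul_mem _ _ (hv p hp m hm y hy hd)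

variable {ψ : AddChar F Circle} {π : Representation ℂ (GLk k D) V}

theorem map_mem_kirillovCore {v : V} (hv : v ∈ kirillovCore ψ π) {p : GLk k D} (hp : p ∈ P k D) :
    π p v ∈ kirillovCore ψ π := by
  intro q hq m hm y hy hd
  rw [← Module.End.mul_apply, ← map_mul]
  exact hv _ (mul_mem hq hp) m hm y hy hd

theorem suppOn_diag_conj {r : Fin k → Fin k → Prop} (d : Dˣ) {g : GLk k D}
    (hg : SuppOn r g.1) : SuppOn r (diag k D d * g * (diag k D d)⁻¹).1 := by
  intro i j hij
  rw [diag_conj_apply, hg i j hij]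
  by_cases h : i = j
  · subst h; simp
  · simp [Matrix.one_apply_ne h]

theorem diag_conj_mem_block (d : Dˣ) {a m : ℕ} {g : GLk k D} (hg : g ∈ block k D a m) :
    diag k D d * g * (diag k D d)⁻¹ ∈ block k D a m := by
  refine ⟨suppOn_diag_conj d hg.1, ?_⟩
  have : (diag k D d * g * (diag k D d)⁻¹)⁻¹ = diag k D d * g⁻¹ * (diag k D d)⁻¹ := by group
  rw [this]
  exact suppOn_diag_conj d hg.2

theorem superdiagFrom_diag_conj (m : ℕ) (d : Dˣ) (g : GLk k D) :
    superdiagFrom m (diag k D d * g * (diag k D d)⁻¹).1 = d.1 * superdiagFrom m g.1 * (d⁻¹).1 := by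
  unfold superdiagFrom
  simp only [diag_conj_apply, Finset.mul_sum, Finset.sum_mul]
  refine Finset.sum_congr rfl fun i _ => Finset.sum_congr rfl fun j _ => ?_
  split_ifs <;> simp

theorem theta_diag_conj (m : Fin k) (y : Fin k → D) (d : Dˣ) (g : GLk k D) :
    theta ψ m y (diag k D d * g * (diag k D d)⁻¹)
      = theta ψ m (fun i => (d⁻¹).1 * y i * d.1) g := by
  rw [theta, theta, superdiagFrom_diag_conj]
  have h1 : ∑ i, y i * (diag k D d * g * (diag k D d)⁻¹).1 i m =
      d.1 * (∑ i, ((d⁻¹).1 * y i * d.1) * g.1 i m) * (d⁻¹).1 := by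
    rw [Finset.mul_sum, Finset.sum_mul]
    refine Finset.sum_congr rfl fun i _ => ?_
    rw [diag_conj_apply]
    simp only [← mul_assoc, Units.mul_inv, one_mul]
  rw [h1, ← add_mul, ← mul_add, reducedTrace_mul_comm, ← mul_assoc, Units.inv_mul, one_mul]

/-- The diagonal normalizes `P` and every column group, and it replaces `y` by `d⁻¹ y d`.
Conjugating a completing matrix by `d` shows that this preserves degeneracy. -/
theorem diag_mem_kirillovCore {v : V} (hv : v ∈ kirillovCore ψ π) (d : Dˣ) :
    π (diag k D d) v ∈ kirillovCore ψ π := by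
  intro p hp m hm y hy hd
  have hp' : (diag k D d)⁻¹ * p * diag k D d ∈ P k D := by
    have := diag_conj_mem_P d⁻¹ hp
    rwa [map_inv, inv_inv] at this
  have e : π p (π (diag k D d) v) = π (diag k D d) (π ((diag k D d)⁻¹ * p * diag k D d) v) := by
    rw [← Module.End.mul_apply, ← Module.End.mul_apply, ← map_mul, ← map_mul]
    congr 2
    group
  rw [e]
  refine conj_mem_twistKer π _ (fun n hn => ⟨suppOn_diag_conj d hn, theta_diag_conj m y d n⟩)
    (hv _ hp' m hm (fun i => (d⁻¹).1 * y i * d.1) (fun i hi => by rw [hy i hi]; simp) ?_)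
  rintro ⟨g, hg, e⟩
  refine hd ⟨_, diag_conj_mem_block d hg, ?_⟩
  ext j
  rw [vecMul_unitRow_apply hm m.isLt.le, diag_conj_apply,
    ← vecMul_unitRow_apply hm m.isLt.le g.1, ← e]
  simp [← mul_assoc]

/-- On column `m` the Whittaker character is the unit row, and conjugation by `g⁻¹` carries it to
the unit row times `g`. All nondegenerate rows thus reduce to one character. -/
theorem mem_twistKer_theta_of_eta {a : ℕ} {m : Fin k} {g : GLk k D} (hg : g ∈ block k D a m)
    {v : V} (hv : π g v ∈ twistKer π (unipSet k D a m) (eta ψ m)) :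
    v ∈ twistKer π (unipSet k D a m)
      (theta ψ m (Matrix.vecMul (unitRow k m D) g.1)) := by
  have h := conj_mem_twistKer π (S' := unipSet k D a m)
    (χ' := theta ψ m (Matrix.vecMul (unitRow k m D) g.1)) g⁻¹ (fun n hn =>
    ⟨block_conj_mem (inv_mem hg) hn, by
      rw [theta_block_conj ψ (inv_mem hg), Matrix.vecMul_vecMul, Units.mul_inv, Matrix.vecMul_one,
        theta_unitRow]⟩) hv
  rwa [← Module.End.mul_apply, ← map_mul, inv_mul_cancel, map_one] at h

end Core

/-! ### Climbing through the columns: injectivity and cuspidality on the core -/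

section CoreLocal

variable {F : Type*} [Field F] [ValuativeRel F] [TopologicalSpace F] [IsNonarchimedeanLocalField F]
    [CharZero F] {k : ℕ}
    {D : Type*} [Ring D] [Algebra F D] [IsSimpleRing D]
    [FiniteDimensional F D] [TopologicalSpace D] [IsTopologicalRing D] [IsModuleTopology F D]
    {V : Type*} [AddCommGroup V] [Module ℂ V]
    {ψ : AddChar F Circle} {π : Representation ℂ (GLk k D) V}

/-- A vector without degenerate twisted coinvariants is determined by its image in the Kirillov
model. -/
theorem eq_zero_of_mem_kirillovCore (hψ : Continuous ψ) (hψ1 : ψ ≠ 1) (hsm : IsSmooth π)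
    (hk : 0 < k) {v : V} (hv : v ∈ kirillovCore ψ π)
    (h : ∀ p ∈ P k D, π p v ∈ twistKer π (unipSet k D 0 1) (eta ψ 1)) : v = 0 := by
  have key : ∀ m, 1 ≤ m → m ≤ k →
      ∀ p ∈ P k D, π p v ∈ twistKer π (unipSet k D 0 m) (eta ψ m) := by
    intro m hm
    induction m, hm using Nat.le_induction with
    | base => exact fun _ => h
    | succ m hm ih =>
      intro hmk p hp
      refine mem_twistKer_eta_succ hψ hψ1 hsm ⟨m, hmk⟩ (Nat.zero_le _) fun y hy => ?_
      by_cases hd : Nondegenerate 0 m y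
      · obtain ⟨g, hg, rfl⟩ := hd
        refine mem_twistKer_theta_of_eta (m := ⟨m, hmk⟩) hg ?_
        rw [← Module.End.mul_apply, ← map_mul]
        -- As `m < k`, the conjugating block matrix lies in `P` and is absorbed into `p`; this is
        -- why the induction quantifies over all of `P`.
        exact ih (Nat.le_of_succ_le hmk) _ (mul_mem (block_le_P hmk hg) hp)
      · exact hv p hp ⟨m, hmk⟩ hm y (fun i hi => hy i fun h => hi h.2) hd
  have h1 := key k hk le_rfl 1 (one_mem _)
  rw [map_one, Module.End.one_apply] at h1
  have h2 : twistKer π (unipSet k D 0 k) (eta ψ k) ≤ ⊥ := by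
    refine twistKer_le fun g hg w => ?_
    have hg1 : g = 1 := by
      ext i j
      exact hg i j (by unfold unipRel; omega)
    have h0 : superdiagFrom k (1 : Matrix (Fin k) (Fin k) D) = 0 := by
      refine Finset.sum_eq_zero fun i _ => Finset.sum_eq_zero fun j _ => if_neg ?_
      omega
    rw [hg1, eta, Units.val_one, h0]
    simp
  exact (Submodule.mem_bot ℂ).1 (h2 h1)

/-- Vectors without degenerate twisted coinvariants vanish in the Jacquet modules of `U'_{a,b}`. -/
theorem mem_twistKer_one_of_mem_kirillovCore (hψ : Continuous ψ) (hψ1 : ψ ≠ 1) (hsm : IsSmooth π)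
    {a : ℕ} (ha : 0 < a) (hak : a < k) {v : V} (hv : v ∈ kirillovCore ψ π) :
    v ∈ twistKer π (unipSet k D a k) 1 := by
  have key : ∀ m, a + 1 ≤ m → m ≤ k →
      ∀ p ∈ P k D, π p v ∈ twistKer π (unipSet k D a m) (eta ψ m) := by
    intro m hm
    induction m, hm using Nat.le_induction with
    | base =>
      intro _ p hp
      -- The relations `unipRel k 0 a` and `unipRel k a (a + 1)` coincide, and `theta` with the zero
      -- row is `eta ψ (a + 1)`. So the base case is the degenerate row `0` at column `a`.
      refine twistKer_mono π (unipSet_subset fun i j hij => ?_) (fun g _ => ?_)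
        (hv p hp ⟨a, hak⟩ ha 0 (fun _ _ => rfl) (not_nondegenerate_zero ha hak.le))
      · unfold unipRel at hij ⊢
        rw [Fin.lt_def] at hij ⊢
        dsimp only at hij
        omega
      · rw [theta, eta]
        simp
    | succ m hm ih =>
      intro hmk p hp
      refine mem_twistKer_eta_succ hψ hψ1 hsm ⟨m, hmk⟩ (by dsimp only; omega) fun y hy => ?_
      by_cases hd : Nondegenerate 0 m y
      · obtain ⟨g, hg, rfl⟩ := hd.of_support F (by omega) (Nat.le_of_succ_le hmk) hy
        refine mem_twistKer_theta_of_eta (m := ⟨m, hmk⟩) hg ?_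
        rw [← Module.End.mul_apply, ← map_mul]
        exact ih (Nat.le_of_succ_le hmk) _
          (mul_mem (block_le_P hmk (block_mono (Nat.zero_le a) le_rfl hg)) hp)
      · refine twistKer_mono π (unipSet_subset fun i j hij => ?_) (fun _ _ => rfl)
          (hv p hp ⟨m, hmk⟩ (by dsimp only; omega) y (fun i hi => hy i fun h => hi h.2) hd)
        exact ⟨hij.1, Or.inl (hij.2.resolve_right fun h => by omega)⟩
  have h1 := key k hak le_rfl 1 (one_mem _)
  rw [map_one, Module.End.one_apply] at h1
  refine twistKer_mono π subset_rfl (fun g _ => ?_) h1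
  have h0 : superdiagFrom k g.1 = 0 := by
    refine Finset.sum_eq_zero fun i _ => Finset.sum_eq_zero fun j _ => if_neg ?_
    omega
  rw [eta, h0]
  simp

end CoreLocal

/-! ### Units near the identity -/

section NearOne

open Topology ValuativeRel

variable {F : Type*} [Field F] [ValuativeRel F] [TopologicalSpace F] [IsNonarchimedeanLocalField F]

variable (F) in
theorem t2Space_localField : T2Space F := by
  refine IsTopologicalAddGroup.t2Space_of_zero_sep fun x hx => ?_
  exact ⟨_, (IsValuativeTopology.hasBasis_nhds_zero' F).mem_of_mem
    (i := valuation F x) (by simpa using hx), by simp⟩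

/-- In a finite-dimensional algebra the elements near `1` are units near `1`. -/
theorem eventually_exists_unit {F : Type*} [Field F] [ValuativeRel F] [TopologicalSpace F]
    [IsNonarchimedeanLocalField F] {R : Type*} [Ring R] [Algebra F R] [FiniteDimensional F R]
    [TopologicalSpace R] [IsTopologicalRing R] [IsModuleTopology F R] {Ω : Set Rˣ}
    (hΩ : Ω ∈ 𝓝 (1 : Rˣ)) : ∀ᶠ a in 𝓝 (1 : R), ∃ u ∈ Ω, u.1 = a := by
  classical
  have := t2Space_localField F
  let b := Module.finBasis F R
  let M := Algebra.leftMulMatrix b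
  have hM : Continuous M := continuous_matrix fun i j =>
    IsModuleTopology.continuous_of_linearMap
      ((Matrix.entryLinearMap F F i j) ∘ₗ M.toLinearMap)
  -- The inverse of `a`, obtained by solving `a * x = 1` in the left regular representation. Its
  -- continuity at `1` matters because the topology of the unit group also sees inverses.
  let f : R → R := fun a => b.equivFun.symm ((M a)⁻¹.mulVec (b.equivFun 1))
  have hM1 : (M 1).det ≠ 0 := by rw [map_one, Matrix.det_one]; exact one_ne_zero
  have hdet : Continuous fun a => (M a).det := hM.matrix_det
  have hf1 : f 1 = 1 := by
    simp only [f, map_one, inv_one, Matrix.one_mulVec, LinearEquiv.symm_apply_apply]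
  have hf : ContinuousAt f 1 := by
    have h1 : ContinuousAt (fun a => (M a)⁻¹) 1 := by
      simp only [Matrix.inv_def, Ring.inverse_eq_inv']
      exact (hdet.continuousAt.inv₀ hM1).smul hM.matrix_adjugate.continuousAt
    have h2 : Continuous fun A : Matrix _ _ F => b.equivFun.symm (A.mulVec (b.equivFun 1)) := by
      refine (coordHomeo b).symm.continuous.comp ?_
      fun_prop
    exact h2.continuousAt.comp h1
  have hmul : ∀ a, (M a).det ≠ 0 → a * f a = 1 := by
    intro a ha
    apply b.equivFun.injective
    have h1 : ∀ c, b.equivFun (a * c) = (M a).mulVec (b.equivFun c) := fun c => by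
      ext i
      simp [M, Algebra.leftMulMatrix_mulVec_repr]
    rw [h1, LinearEquiv.apply_symm_apply, Matrix.mulVec_mulVec,
      Matrix.mul_nonsing_inv _ (isUnit_iff_ne_zero.2 ha), Matrix.one_mulVec]
  have hmul' : ∀ a, (M a).det ≠ 0 → f a * a = 1 := by
    intro a ha
    apply Algebra.leftMulMatrix_injective b
    have h1 := congrArg M (hmul a ha)
    rw [map_mul, map_one] at h1 ⊢
    exact mul_eq_one_comm.1 h1
  rw [Units.isInducing_embedProduct.nhds_eq_comap, Filter.mem_comap] at hΩ
  obtain ⟨t, ht, hΩt⟩ := hΩ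
  have hc : ContinuousAt (fun a : R => (a, MulOpposite.op (f a))) 1 :=
    continuousAt_id.prodMk (MulOpposite.continuous_op.continuousAt.comp hf)
  have ht' : t ∈ 𝓝 ((1 : R), MulOpposite.op (f 1)) := by
    rw [hf1]
    exact ht
  filter_upwards [hc ht', hdet.continuousAt.eventually_ne hM1] with a ha ha'
  exact ⟨⟨a, f a, hmul a ha', hmul' a ha'⟩, hΩt ha, rfl⟩

end NearOne

/-! ### Factoring block matrices with a trivial row -/

section BlockInverse

variable {k : ℕ} {D : Type*} [Ring D]

theorem mem_block_of_suppOn {a m : ℕ} {g : GLk k D}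
    (hg : SuppOn (fun i j => (a ≤ i.val ∧ i.val < m) ∧ (a ≤ j.val ∧ j.val < m)) g.1) :
    g ∈ block k D a m := by
  refine ⟨hg, fun i j hij => ?_⟩
  by_cases hi : a ≤ i.val ∧ i.val < m
  · have hj : ¬ (a ≤ j.val ∧ j.val < m) := fun h => hij ⟨hi, h⟩
    have := mul_mul_apply_of_col (g := (g⁻¹).1) (n := 1) (h := g.1) (j := j)
      (fun l => hg l j fun h => hj h.2) i
    rw [mul_one, Units.inv_mul] at this
    exact this.symm
  · have := mul_apply_of_row (g := g.1) (n := (g⁻¹).1) (i := i)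
      (fun l => hg i l fun h => hi h.1) j
    rw [Units.mul_inv] at this
    exact this.symm

/-- A matrix in the block `[0, m + 1)` with trivial row `m` is the product of a column and a matrix
in the block `[0, m)`. -/
theorem colUnip_inv_mul_mem_block {m : ℕ} (hm : m < k) {h : GLk k D} (hh : h ∈ block k D 0 (m + 1))
    (hrow : ∀ j, h.1 ⟨m, hm⟩ j = (1 : Matrix (Fin k) (Fin k) D) ⟨m, hm⟩ j) :
    (colUnip 0 m fun i => h.1 i ⟨m, hm⟩)⁻¹ * h ∈ block k D 0 m := by
  refine mem_block_of_suppOn fun i j hij => ?_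
  by_cases hi : i.val < m
  · have e : ((colUnip 0 m fun i => h.1 i ⟨m, hm⟩)⁻¹ * h).1 i j
        = h.1 i j - h.1 i ⟨m, hm⟩ * h.1 ⟨m, hm⟩ j := by
      change ((1 - relPart (colRel k 0 m) fun i _ => h.1 i ⟨m, hm⟩) * h.1) i j = _
      rw [sub_mul, one_mul, Matrix.sub_apply, Matrix.mul_apply, Finset.sum_eq_single ⟨m, hm⟩]
      · rw [relPart_of ⟨⟨Nat.zero_le _, hi⟩, rfl⟩]
      · intro l _ hl
        rw [relPart_of_not, zero_mul]
        intro h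
        exact hl (Fin.ext h.2)
      · simp
    rw [e, hrow]
    by_cases hj : j = ⟨m, hm⟩
    · subst hj
      rw [Matrix.one_apply_eq, mul_one, sub_self, Matrix.one_apply_ne]
      rintro rfl
      exact lt_irrefl _ hi
    · rw [Matrix.one_apply_ne (Ne.symm hj), mul_zero, sub_zero]
      refine hh.1 i j fun h => hij ?_
      have : j.val ≠ m := fun e => hj (Fin.ext e)
      omega
  · rw [Units.val_mul, mul_apply_of_row (colUnip_inv_row 0 m _ fun h => hi h.2)]
    by_cases him : i = ⟨m, hm⟩
    · subst him
      exact hrow j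
    · have : i.val ≠ m := fun e => him (Fin.ext e)
      exact hh.1 i j fun h => by omega

end BlockInverse

/-! ### Completing rows close to the unit row -/

section NearRow

open Topology

variable {F : Type*} [Field F] [ValuativeRel F] [TopologicalSpace F] [IsNonarchimedeanLocalField F]

/-- Rows near the unit row are rows of invertible matrices near the identity. -/
theorem exists_nhds_row {F : Type*} [Field F] [ValuativeRel F] [TopologicalSpace F]
    [IsNonarchimedeanLocalField F] {k : ℕ} {D : Type*} [Ring D] [Algebra F D] [IsSimpleRing D]
    [FiniteDimensional F D] [TopologicalSpace D] [IsTopologicalRing D] [IsModuleTopology F D]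
    {m : ℕ} (hm : 0 < m) (hmk : m ≤ k) {Ω : Set (GLk k D)} (hΩ : Ω ∈ 𝓝 (1 : GLk k D)) :
    ∃ U ∈ 𝓝 (0 : ColIdx k 0 m → D), ∀ z ∈ U, ∃ κ ∈ Ω, κ ∈ block k D 0 m ∧
      Matrix.vecMul (unitRow k m D) κ.1 = unitRow k m D + colExt z := by
  have : IsModuleTopology F (Matrix (Fin k) (Fin k) D) :=
    inferInstanceAs (IsModuleTopology F (Fin k → Fin k → D))
  let A : (ColIdx k 0 m → D) → Matrix (Fin k) (Fin k) D := fun z =>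
    1 + Matrix.of fun i j => unitRow k m D i * colExt z j
  have hA : Continuous A := by
    refine continuous_const.add (continuous_matrix fun i j => ?_)
    exact continuous_const.mul ((continuous_apply j).comp continuous_colExt)
  have hA0 : A 0 = 1 := by
    ext i j
    simp [A, colExt]
  have h := hA.continuousAt (x := 0)
  rw [ContinuousAt, hA0] at h
  refine ⟨_, h (eventually_exists_unit (F := F) hΩ), fun z hz => ?_⟩
  obtain ⟨κ, hκ, e⟩ := hz
  refine ⟨κ, hκ, mem_block_of_suppOn fun i j hij => ?_, ?_⟩
  · rw [e]
    change (1 : Matrix (Fin k) (Fin k) D) i j + unitRow k m D i * colExt z j = _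
    by_cases hj : j.val < m
    · have hi : ¬ i.val < m := fun hi => hij ⟨⟨Nat.zero_le _, hi⟩, ⟨Nat.zero_le _, hj⟩⟩
      rw [unitRow, if_neg (by omega), zero_mul, add_zero]
    · rw [colExt_of_not z fun h => hj h.2, mul_zero, add_zero]
  · ext j
    rw [vecMul_unitRow_apply hm hmk, e]
    change (1 : Matrix (Fin k) (Fin k) D) _ j + unitRow k m D _ * colExt z j = _
    rw [Pi.add_apply, unitRow, if_pos (by dsimp only; omega), one_mul, Matrix.one_apply]
    congr 1
    simp only [unitRow, Fin.ext_iff]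
    split_ifs <;> first | omega | rfl

end NearRow

/-! ### Vectors with small support in the Kirillov model -/

section Existence

open Topology

variable {F : Type*} [Field F] [ValuativeRel F] [TopologicalSpace F] [IsNonarchimedeanLocalField F]
    [CharZero F] {k : ℕ}
    {D : Type*} [Ring D] [Algebra F D] [IsSimpleRing D]
    [FiniteDimensional F D] [TopologicalSpace D] [IsTopologicalRing D] [IsModuleTopology F D]
    {V : Type*} [AddCommGroup V] [Module ℂ V]
    {ψ : AddChar F Circle} {π : Representation ℂ (GLk k D) V}

theorem theta_colUnip (m : Fin k) {y : Fin k → D} (hy : ∀ i : Fin k, ¬ i.val < m.val → y i = 0)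
    (x : ColIdx k 0 m → D) :
    theta ψ m y (colUnip 0 m (colExt x))
      = pairChar ψ (tracePairing F D (ColIdx k 0 m)) (fun i => y i.1) x := by
  have hy' : colExt (fun i : ColIdx k 0 m => y i.1) = y := by
    ext i
    by_cases hi : i.val < m.val
    · exact colExt_coe (fun i : ColIdx k 0 m => y i.1) ⟨i, Nat.zero_le _, hi⟩
    · rw [colExt_of_not _ fun h => hi h.2, hy i hi]
  have h0 : superdiagFrom (m.val + 1) (colUnip 0 m (colExt x)).1 = 0 := by
    refine Finset.sum_eq_zero fun i _ => Finset.sum_eq_zero fun j _ => ?_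
    split_ifs with hij
    · refine (suppOn_blockUnip _ i j fun h => ?_).trans (Matrix.one_apply_ne ?_)
      · have := h.2
        omega
      · rintro rfl
        omega
    · rfl
  rw [theta, h0, add_zero]
  conv_lhs => rw [← hy']
  rw [sum_colExt_mul]
  change ψ (reducedTrace F _) = ψ (reducedTrace F _)
  congr 2
  refine Finset.sum_congr rfl fun i _ => ?_
  congr 1
  exact (blockUnip_apply _ ⟨i.2, rfl⟩).trans (colExt_coe x i)

theorem vecMul_block_support {m : ℕ} {g : GLk k D} (hg : g ∈ block k D 0 m) {y : Fin k → D}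
    (hy : ∀ i : Fin k, ¬ i.val < m → y i = 0) {j : Fin k} (hj : ¬ j.val < m) :
    Matrix.vecMul y g.1 j = 0 := by
  rw [Matrix.vecMul, dotProduct]
  refine Finset.sum_eq_zero fun i _ => ?_
  by_cases hi : i.val < m
  · rw [hg.1 i j fun h => hj h.2.2, Matrix.one_apply_ne, mul_zero]
    rintro rfl
    exact hj hi
  · rw [hy i hi, zero_mul]

theorem block_conj_colUnip_mem {m : Fin k} {g : GLk k D} (hg : g ∈ block k D 0 m)
    (x : Fin k → D) : g * colUnip 0 m x * g⁻¹ ∈ unipSet k D 0 m :=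
  block_conj_mem hg (colUnip_mem_unipSet 0 x)

/-- Averaging a vector over a lattice in a column against a character `χ` of the column has the
effect of a cutoff on its twisted coinvariants. -/
theorem block_latticeAverage (hψ : Continuous ψ) (hsm : IsSmooth π) {m : Fin k}
    {L : AddSubgroup (ColIdx k 0 m → D)} (hL : IsCompact (L : Set (ColIdx k 0 m → D)))
    (e y : Fin k → D) (hy : ∀ i : Fin k, ¬ i.val < m.val → y i = 0)
    {g : GLk k D} (hg : g ∈ block k D 0 m) (v : V) :
    let v' := latticeAverage (fun x : ColIdx k 0 m → D => π (colUnip 0 m (colExt x)))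
      (pairChar ψ (tracePairing F D (ColIdx k 0 m)) fun i => e i.1) L v
    ((fun i : ColIdx k 0 m => Matrix.vecMul y g.1 i.1 - e i.1) ∈
        perp ψ (tracePairing F D (ColIdx k 0 m)) L ∧
      π g v' - π g v ∈ twistKer π (unipSet k D 0 m) (theta ψ m y)) ∨
    π g v' ∈ twistKer π (unipSet k D 0 m) (theta ψ m y) := by
  intro v'
  set p := twistKer π (unipSet k D 0 m) (theta ψ m y) with hp
  set β := tracePairing F D (ColIdx k 0 m) with hβ
  let yg : ColIdx k 0 m → D := fun i => Matrix.vecMul y g.1 i.1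
  let e' : ColIdx k 0 m → D := fun i => e i.1
  have hu := isUniform_latticeAverage (isSmoothAction_colUnip hsm 0 m.val)
    (pairChar_locally_trivial hψ β e') hL v
  -- Moved across `g`, the column acts on the image of `π g v` in the coinvariants through the row
  -- `y g`.
  have h1 : ∀ x : ColIdx k 0 m → D, p.mkQ (π g (π (colUnip 0 m (colExt x)) v))
      = (pairChar ψ β yg x : ℂ) • p.mkQ (π g v) := by
    intro x
    have h2 : π g (π (colUnip 0 m (colExt x)) v)
        = π (g * colUnip 0 m (colExt x) * g⁻¹) (π g v) := by
      rw [← Module.End.mul_apply, ← Module.End.mul_apply, ← map_mul, ← map_mul,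
        inv_mul_cancel_right]
    have h3 : theta ψ m y (g * colUnip 0 m (colExt x) * g⁻¹) = pairChar ψ β yg x := by
      rw [theta_block_conj ψ hg, theta_colUnip m fun i hi => vecMul_block_support hg hy hi]
    rw [h2, ← h3, ← map_smul, ← sub_eq_zero, ← map_sub, ← LinearMap.mem_ker, Submodule.ker_mkQ]
    exact sub_mem_twistKer π (theta ψ m y) (block_conj_colUnip_mem hg _) _
  have h4 : p.mkQ (π g v') = average fun x : Multiplicative L =>
      (pairChar ψ β (yg - e') (x.toAdd : ColIdx k 0 m → D) : ℂ) • p.mkQ (π g v) := by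
    change (p.mkQ ∘ₗ π g) (average _) = _
    rw [map_average hu]
    congr 1
    funext x
    rw [LinearMap.comp_apply, map_smul, map_smul, h1, smul_smul]
    congr 1
    change ((ψ (β e' x.toAdd) : Circle) : ℂ)⁻¹ * (ψ (β yg x.toAdd) : Circle) = (ψ (β (yg - e') x.toAdd) : Circle)
    rw [map_sub, LinearMap.sub_apply, AddChar.map_sub_eq_div, Circle.coe_div, div_eq_inv_mul]
  -- Orthogonality over `L`: the average of the character `yg - e'` is `1` if it annihilates `L`,
  -- and `0` otherwise.
  by_cases hperp : yg - e' ∈ perp ψ β L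
  · refine Or.inl ⟨hperp, ?_⟩
    have h5 : ∀ x : Multiplicative L,
        pairChar ψ β (yg - e') (x.toAdd : ColIdx k 0 m → D) = 1 :=
      fun x => hperp _ x.toAdd.2
    simp only [h5, Circle.coe_one, one_smul, average_const] at h4
    rw [← Submodule.ker_mkQ p, LinearMap.mem_ker, map_sub, h4, sub_self]
  · refine Or.inr ?_
    obtain ⟨x, hx, hne⟩ : ∃ x ∈ L, ψ (β (yg - e') x) ≠ 1 := by
      by_contra! hc
      exact hperp hc
    rw [← Submodule.ker_mkQ p, LinearMap.mem_ker, h4]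
    refine average_eq_zero_of_mul_left ?_ (Multiplicative.ofAdd ⟨x, hx⟩)
      (ψ (β (yg - e') x) : ℂ) ?_ fun a => ?_
    · have := hu.comp (p.mkQ ∘ₗ π g)
      refine (congrArg IsUniform (funext fun x => ?_)).mp this
      rw [LinearMap.comp_apply, map_smul, map_smul, h1, smul_smul]
      congr 1
      change ((ψ (β e' x.toAdd) : Circle) : ℂ)⁻¹ * (ψ (β yg x.toAdd) : Circle) = (ψ (β (yg - e') x.toAdd) : Circle)
      rw [map_sub, LinearMap.sub_apply, AddChar.map_sub_eq_div, Circle.coe_div, div_eq_inv_mul]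
    · exact fun e => hne (Circle.ext e)
    · change (ψ (β (yg - e') (x + a.toAdd)) : ℂ) • _ = _
      rw [map_add, AddChar.map_add_eq_mul, Circle.coe_mul, mul_smul]
      rfl

theorem eta_one_mul {n n' : GLk k D} (hn : n ∈ N k D) (hn' : n' ∈ N k D) :
    eta ψ 1 (n * n') = eta ψ 1 n * eta ψ 1 n' := by
  have := map_mul (psiN ψ k D) ⟨n, hn⟩ ⟨n', hn'⟩
  rwa [psiN_eq_eta, psiN_eq_eta, psiN_eq_eta] at this

theorem map_mem_twistKer_self {S : Set (GLk k D)} {χ : GLk k D → Circle} {n : GLk k D} (hn : n ∈ S)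
    {w : V} (hw : w ∈ twistKer π S χ) : π n w ∈ twistKer π S χ := by
  have := Submodule.add_mem _ (sub_mem_twistKer π χ hn w) (Submodule.smul_mem _ (χ n : ℂ) hw)
  rwa [sub_add_cancel] at this

variable (ψ π) in
/-- The vector `v` has no degenerate twisted coinvariants for the columns up to `m`, and its image
in the Kirillov model is supported in `N K` and only takes the value of `v₀` up to scalars. -/
structure IsLocalizedAt (m : ℕ) (K : Subgroup (GLk k D)) (v₀ v : V) (g : GLk k D) : Prop where
  degenerate : ∀ j : Fin k, 0 < j.val → j.val ≤ m → ∀ y : Fin k → D,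
    (∀ i : Fin k, ¬ i.val < j.val → y i = 0) → ¬ Nondegenerate 0 j y →
      π g v ∈ twistKer π (unipSet k D 0 j) (theta ψ j y)
  value : π g v ∈ twistKer π (N k D) (eta ψ 1) ∨ ∃ n ∈ N k D, ∃ κ ∈ K, g = n * κ ∧
    π g v - (eta ψ 1 n : ℂ) • v₀ ∈ twistKer π (N k D) (eta ψ 1)

theorem unipSet_subset_N {m : ℕ} (hm : 0 < m) : unipSet k D 0 m ⊆ N k D := by
  rw [coe_N_eq_unipSet]
  exact unipSet_zero_anti hm

/-- `IsLocalizedAt` passes from the block `[0, m)` to its product with column `m`. -/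
theorem IsLocalizedAt.colUnip_mul {m : ℕ} {K : Subgroup (GLk k D)} {v₀ v : V}
    {g : GLk k D} (h : IsLocalizedAt ψ π m K v₀ v g) (x : Fin k → D) :
    IsLocalizedAt ψ π m K v₀ v (colUnip 0 m x * g) := by
  have hN : colUnip 0 m x ∈ N k D := by
    refine (suppOn_blockUnip _).mono fun i j h => ?_
    unfold colRel at h
    exact Fin.lt_def.2 (by omega)
  refine ⟨fun j hj hjm y hy hd => ?_, ?_⟩
  · rw [map_mul]
    exact map_mem_twistKer_self (unipSet_zero_anti hjm (colUnip_mem_unipSet 0 x))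
      (h.degenerate j hj hjm y hy hd)
  · rcases h.value with h | ⟨n, hn, κ, hκ, rfl, h⟩
    · refine Or.inl ?_
      rw [map_mul]
      exact map_mem_twistKer_self hN h
    · refine Or.inr ⟨_, mul_mem hN hn, κ, hκ, (mul_assoc _ _ _).symm, ?_⟩
      have h1 := map_mem_twistKer_self (π := π) hN h
      rw [map_sub, map_smul, ← Module.End.mul_apply, ← map_mul] at h1
      have h2 := Submodule.smul_mem _ (eta ψ 1 n : ℂ) (sub_mem_twistKer π (eta ψ 1) hN v₀)
      have h3 := Submodule.add_mem _ h1 h2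
      rw [smul_sub, sub_add_sub_cancel, smul_smul] at h3
      rw [eta_one_mul hN hn, Circle.coe_mul, mul_comm (eta ψ 1 _ : ℂ)]
      exact h3

/-- Induction on the size of the block: passing to `[0, m + 1)` costs one average over a lattice in
column `m + 1`, against the unit row. It keeps only those `g` whose row `m` is close to the unit
row; such a `g` is, up to a small matrix `κ` fixing the previous vector, a column times an element
of the block `[0, m)`. -/
theorem exists_isLocalizedAt (hψ : Continuous ψ) (hψ1 : ψ ≠ 1) (hsm : IsSmooth π)
    {K : Subgroup (GLk k D)} {Ω : Set (GLk k D)} (hΩ : Ω ∈ 𝓝 1)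
    (hK : ∀ g ∈ Ω, g ∈ P k D → g ∈ K) (v₀ : V) (m : ℕ) (hm : m < k) :
    ∃ v, v - v₀ ∈ twistKer π (N k D) (eta ψ 1) ∧
      ∀ g ∈ block k D 0 m, IsLocalizedAt ψ π m K v₀ v g := by
  induction m with
  | zero =>
    refine ⟨v₀, by rw [sub_self]; exact Submodule.zero_mem _, fun g hg => ?_⟩
    rw [block_zero_eq_bot, Subgroup.mem_bot] at hg
    subst hg
    refine ⟨fun j hj hj' => by omega, Or.inr ⟨1, one_mem _, 1, one_mem _, (mul_one 1).symm, ?_⟩⟩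
    have : eta ψ 1 (1 : GLk k D) = 1 := by
      have := map_one (psiN ψ k D)
      rwa [psiN_eq_eta] at this
    rw [this, map_one, Circle.coe_one, one_smul, Module.End.one_apply, sub_self]
    exact Submodule.zero_mem _
  | succ m ih =>
    obtain ⟨v', hv', h'⟩ := ih (by omega)
    let M : Fin k := ⟨m + 1, hm⟩
    -- The completing matrices must lie in `Ω`, so that they end up in `K`, and must fix `v'`, so
    -- that they can be removed. `L` is then taken large enough for its annihilator to fit in `U`.
    obtain ⟨U, hU, hUκ⟩ := exists_nhds_row (F := F) (k := k) (D := D) (m := m + 1) (Nat.succ_pos m)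
      hm.le (Filter.inter_mem hΩ ((hsm v').mem_nhds (by simp)))
    let β := tracePairing F D (ColIdx k 0 (m + 1))
    have hβ : Function.Injective β := tracePairing_injective _
    obtain ⟨L, -, hLc, hLU⟩ := exists_perp_subset hψ1 hβ hU
    let e : ColIdx k 0 (m + 1) → D := fun i => unitRow k (m + 1) D i.1
    let v := latticeAverage (fun x : ColIdx k 0 (m + 1) → D => π (colUnip 0 (m + 1) (colExt x)))
      (pairChar ψ β e) L v'
    have hrow : ∀ i : Fin k, ¬ i.val < m + 1 → unitRow k (m + 1) D i = 0 :=
      fun i hi => if_neg (by omega)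
    have hMN : unipSet k D 0 (m + 1) ⊆ N k D := unipSet_subset_N (Nat.succ_pos m)
    -- coinvariants for `θ` with the unit row are finer than all the others
    have hle : twistKer π (unipSet k D 0 (m + 1)) (theta ψ M (unitRow k (m + 1) D)) ≤
        twistKer π (N k D) (eta ψ 1) := by
      refine twistKer_mono π hMN fun g hg => ?_
      rw [eta_eq_of_mem ψ (Nat.succ_pos m) hg]
      exact theta_unitRow ψ M g
    have hle' : ∀ j : Fin k, j.val ≤ m → ∀ y : Fin k → D,
        (∀ i : Fin k, ¬ i.val < j.val → y i = 0) →
        twistKer π (unipSet k D 0 (m + 1)) (theta ψ M (unitRow k (m + 1) D)) ≤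
        twistKer π (unipSet k D 0 j) (theta ψ j y) := by
      intro j hj y hy
      refine twistKer_mono π (unipSet_zero_anti (by omega)) fun g hg => ?_
      rw [← eta_eq_theta_of_mem ψ (by omega : j.val < m + 1) hg (hy j (lt_irrefl _))]
      exact theta_unitRow ψ M g
    refine ⟨v, ?_, fun g hg => ?_⟩
    · rw [← sub_add_sub_cancel v v' v₀]
      refine Submodule.add_mem _ ?_ hv'
      have h1 := sub_latticeAverage_mem (isSmoothAction_colUnip hsm 0 (m + 1))
        (pairChar_locally_trivial hψ β e) hLc v'
      refine hle ?_
      suffices twistKer (fun x : ColIdx k 0 (m + 1) → D => π (colUnip 0 (m + 1) (colExt x))) L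
          (pairChar ψ β e) ≤
          twistKer π (unipSet k D 0 (m + 1)) (theta ψ M (unitRow k (m + 1) D)) from this h1
      refine twistKer_le fun x _ w => ?_
      have h2 := theta_colUnip (ψ := ψ) M hrow x
      have h3 := sub_mem_twistKer π (theta ψ M (unitRow k (m + 1) D))
        (colUnip_mem_unipSet (m := m + 1) 0 (colExt x)) w
      rw [h2] at h3
      exact h3
    · have key : ∀ y : Fin k → D, (∀ i : Fin k, ¬ i.val < m + 1 → y i = 0) →
          ((∃ κ ∈ Ω ∩ {g | π g v' = v'}, κ ∈ block k D 0 (m + 1) ∧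
            Matrix.vecMul (unitRow k (m + 1) D) κ.1 = Matrix.vecMul y g.1) ∧
            π g v - π g v' ∈ twistKer π (unipSet k D 0 (m + 1)) (theta ψ M y)) ∨
          π g v ∈ twistKer π (unipSet k D 0 (m + 1)) (theta ψ M y) := by
        intro y hy
        refine (block_latticeAverage (m := M) hψ hsm hLc (unitRow k (m + 1) D) y hy hg v').imp_left
          fun h => ⟨?_, h.2⟩
        obtain ⟨κ, hκ, hκb, hκe⟩ := hUκ _ (hLU h.1)
        refine ⟨κ, hκ, hκb, ?_⟩
        rw [hκe]
        ext i
        by_cases hi : i.val < m + 1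
        · rw [Pi.add_apply, colExt, dif_pos ⟨Nat.zero_le _, hi⟩]
          abel
        · rw [Pi.add_apply, colExt_of_not _ fun h => hi h.2, vecMul_block_support hg hy hi,
            hrow i hi, add_zero]
      have hdeg : ∀ y : Fin k → D, (∀ i : Fin k, ¬ i.val < m + 1 → y i = 0) →
          ¬ Nondegenerate 0 (m + 1) y →
          π g v ∈ twistKer π (unipSet k D 0 (m + 1)) (theta ψ M y) := by
        intro y hy hd
        -- A row that survives the cutoff equals the unit row times `κ g⁻¹`, hence is nondegenerate.
        rcases key y hy with ⟨⟨κ, -, hκ, e⟩, -⟩ | h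
        · refine absurd ⟨κ * g⁻¹, mul_mem hκ (inv_mem hg), ?_⟩ hd
          rw [Units.val_mul, ← Matrix.vecMul_vecMul, e, Matrix.vecMul_vecMul, Units.mul_inv,
            Matrix.vecMul_one]
        · exact h
      have hcase : ∀ j : Fin k, j.val = m + 1 → j = M := fun j hj => Fin.ext hj
      -- For the unit row, survival says that `g` and `κ` have the same row `m`, so `g κ⁻¹` has
      -- trivial row `m` and the induction hypothesis applies to `π g v' = π (g κ⁻¹) v'`. Without
      -- survival, `π g v` dies already for `U_{m+1}`, hence in all the coarser coinvariants.
      rcases key _ hrow with ⟨⟨κ, ⟨hκΩ, hκv⟩, hκ, hκe⟩, hv⟩ | hv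
      · have hh : g * κ⁻¹ ∈ block k D 0 (m + 1) := mul_mem hg (inv_mem hκ)
        have hrow' : ∀ j, (g * κ⁻¹).1 ⟨m, by omega⟩ j
            = (1 : Matrix (Fin k) (Fin k) D) ⟨m, by omega⟩ j := by
          intro j
          have h1 := vecMul_unitRow_apply (Nat.succ_pos m) hm.le (g * κ⁻¹).1 j
          have h2 := vecMul_unitRow_apply (Nat.succ_pos m) hm.le (1 : Matrix (Fin k) (Fin k) D) j
          rw [Units.val_mul, ← Matrix.vecMul_vecMul, ← hκe, Matrix.vecMul_vecMul, Units.mul_inv,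
            h2] at h1
          exact h1.symm
        have hg' := colUnip_inv_mul_mem_block (by omega) hh hrow'
        set u := colUnip 0 m fun i => (g * κ⁻¹).1 i ⟨m, by omega⟩ with hu
        have hloc := (h' _ hg').colUnip_mul (fun i => (g * κ⁻¹).1 i ⟨m, by omega⟩)
        rw [← hu, mul_inv_cancel_left] at hloc
        have hκv' : π κ v' = v' := hκv
        have hgv : π g v' = π (g * κ⁻¹) v' := by
          conv_rhs => rw [← hκv']
          rw [← Module.End.mul_apply, ← map_mul, inv_mul_cancel_right]
        rw [hgv] at hv
        refine ⟨fun j hj hjm y hy hd => ?_, ?_⟩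
        · rcases Nat.lt_or_ge j.val (m + 1) with hlt | hge
          · have := Submodule.add_mem _ (hle' j (by omega) y hy hv)
              (hloc.degenerate j hj (by omega) y hy hd)
            rwa [sub_add_cancel] at this
          · obtain rfl := hcase j (by omega)
            exact hdeg y hy hd
        · rcases hloc.value with h1 | ⟨n, hn, κ', hκ', e, h1⟩
          · refine Or.inl ?_
            have := Submodule.add_mem _ (hle hv) h1
            rwa [sub_add_cancel] at this
          · refine Or.inr ⟨n, hn, κ' * κ, mul_mem hκ' (hK κ hκΩ (block_le_P hm hκ)), ?_, ?_⟩
            · rw [← mul_assoc, ← e, inv_mul_cancel_right]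
            · have := Submodule.add_mem _ (hle hv) h1
              rwa [sub_add_sub_cancel] at this
      · refine ⟨fun j hj hjm y hy hd => ?_, Or.inl (hle hv)⟩
        rcases Nat.lt_or_ge j.val (m + 1) with hlt | hge
        · exact hle' j (by omega) y hy hv
        · obtain rfl := hcase j (by omega)
          exact hdeg y hy hd

/-- Existence of vectors without degenerate twisted coinvariants, with prescribed image in the
coinvariants and small support in the Kirillov model. -/
theorem exists_mem_kirillovCore (hψ : Continuous ψ) (hψ1 : ψ ≠ 1) (hsm : IsSmooth π) (hk : 0 < k)
    {K : Subgroup (GLk k D)} {Ω : Set (GLk k D)} (hΩ : Ω ∈ 𝓝 1)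
    (hK : ∀ g ∈ Ω, g ∈ P k D → g ∈ K) (v₀ : V) :
    ∃ v ∈ kirillovCore ψ π, v - v₀ ∈ twistKer π (N k D) (eta ψ 1) ∧
      ∀ p ∈ P k D, π p v ∈ twistKer π (N k D) (eta ψ 1) ∨
        ∃ n ∈ N k D, ∃ κ ∈ K, p = n * κ ∧
          π p v - (eta ψ 1 n : ℂ) • v₀ ∈ twistKer π (N k D) (eta ψ 1) := by
  obtain ⟨m, rfl⟩ : ∃ m, k = m + 1 := ⟨k - 1, by omega⟩
  obtain ⟨v, hv, h⟩ := exists_isLocalizedAt hψ hψ1 hsm hΩ hK v₀ m (Nat.lt_succ_self m)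
  -- An element of `P` has trivial last row, so it is a last column times an element of the block
  -- `[0, m)`, where `v` is already controlled.
  have key : ∀ p ∈ P (m + 1) D, IsLocalizedAt ψ π m K v₀ v p := by
    intro p hp
    have hrow : ∀ j, p.1 ⟨m, Nat.lt_succ_self m⟩ j
        = (1 : Matrix (Fin (m + 1)) (Fin (m + 1)) D) ⟨m, Nat.lt_succ_self m⟩ j := by
      intro j
      have hp' : Matrix.vecMul (unitRow (m + 1) (m + 1) D) p.1 = unitRow (m + 1) (m + 1) D := hp
      have h1 := vecMul_unitRow_apply (Nat.succ_pos m) le_rfl p.1 j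
      have h2 := vecMul_unitRow_apply (Nat.succ_pos m) le_rfl
        (1 : Matrix (Fin (m + 1)) (Fin (m + 1)) D) j
      rw [hp'] at h1
      rw [Matrix.vecMul_one] at h2
      exact h1.symm.trans h2
    have := (h _ (colUnip_inv_mul_mem_block (Nat.lt_succ_self m) (block_top p) hrow)).colUnip_mul
      (fun i => p.1 i ⟨m, Nat.lt_succ_self m⟩)
    rwa [mul_inv_cancel_left] at this
  exact ⟨v, fun p hp j hj y hy hd => (key p hp).degenerate j hj (Nat.lt_succ_iff.1 j.isLt) y hy hd,
    hv, fun p hp => (key p hp).value⟩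

end Existence

/-! ### Compact open subgroups -/

section CompactOpen

open Topology Pointwise

/-- A locally compact totally disconnected group has small compact open subgroups. -/
theorem exists_isCompact_isOpen_subgroup {G : Type*} [Group G] [TopologicalSpace G]
    [IsTopologicalGroup G] [LocallyCompactSpace G] [T2Space G] [TotallyDisconnectedSpace G]
    {Ω : Set G} (hΩ : Ω ∈ 𝓝 1) :
    ∃ K : Subgroup G, IsOpen (K : Set G) ∧ IsCompact (K : Set G) ∧ (K : Set G) ⊆ Ω := by
  obtain ⟨C, hC, hCΩ, hCc⟩ := local_compact_nhds hΩ
  obtain ⟨W, hW, h1, hWC⟩ := loc_compact_Haus_tot_disc_of_zero_dim.mem_nhds_iff.1 hC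
  have hWc : IsCompact W := hCc.of_isClosed_subset hW.1 hWC
  obtain ⟨T, hT, hWT⟩ := compact_open_separated_mul_right hWc hW.2 subset_rfl
  -- The stabilizer of the compact open set `W` under right translation; it lies in `W` because `1 ∈
  -- W`, and it is open because `W T ⊆ W` for a neighbourhood `T` of `1`.
  let K : Subgroup G :=
    { carrier := {g | (∀ w ∈ W, w * g ∈ W) ∧ ∀ w ∈ W, w * g⁻¹ ∈ W}
      one_mem' := by simp
      mul_mem' := fun {a b} ha hb => ⟨fun w hw => by
          rw [← mul_assoc]
          exact hb.1 _ (ha.1 w hw), fun w hw => by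
          rw [mul_inv_rev, ← mul_assoc]
          exact ha.2 _ (hb.2 w hw)⟩
      inv_mem' := fun {a} ha => ⟨ha.2, by
        rw [inv_inv]
        exact ha.1⟩ }
  have hKW : (K : Set G) ⊆ W := fun g hg => by
    have := hg.1 1 h1
    rwa [one_mul] at this
  have hK : IsOpen (K : Set G) := by
    refine K.isOpen_of_mem_nhds (g := 1) ?_
    filter_upwards [hT, inv_mem_nhds_one G hT] with g hg hg'
    exact ⟨fun w hw => hWT (Set.mul_mem_mul hw hg), fun w hw => hWT (Set.mul_mem_mul hw hg')⟩
  exact ⟨K, hK, hWc.of_isClosed_subset (K.isClosed_of_isOpen hK) hKW,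
    hKW.trans (hWC.trans hCΩ)⟩

theorem totallyDisconnectedSpace_of_injective {X Y : Type*} [TopologicalSpace X]
    [TopologicalSpace Y] [TotallyDisconnectedSpace Y] {f : X → Y} (hf : Continuous f)
    (hf' : Function.Injective f) : TotallyDisconnectedSpace X :=
  ⟨fun t _ ht => Set.subsingleton_of_image hf' t (ht.image f hf.continuousOn).subsingleton⟩

variable {F : Type*} [Field F] [ValuativeRel F] [TopologicalSpace F] [IsNonarchimedeanLocalField F]

theorem t2Space_of_finiteDimensional (F : Type*) [Field F] [ValuativeRel F] [TopologicalSpace F]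
    [IsNonarchimedeanLocalField F] (R : Type*) [AddCommGroup R] [Module F R]
    [FiniteDimensional F R] [TopologicalSpace R] [IsModuleTopology F R] : T2Space R := by
  have := t2Space_localField F
  exact (coordHomeo (Module.finBasis F R)).symm.t2Space

theorem locallyCompactSpace_of_finiteDimensional (F : Type*) [Field F] [ValuativeRel F]
    [TopologicalSpace F] [IsNonarchimedeanLocalField F] (R : Type*) [AddCommGroup R] [Module F R]
    [FiniteDimensional F R] [TopologicalSpace R] [IsModuleTopology F R] : LocallyCompactSpace R :=
  (coordHomeo (Module.finBasis F R)).isClosedEmbedding.locallyCompactSpace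

theorem totallyDisconnectedSpace_of_finiteDimensional (F : Type*) [Field F] [ValuativeRel F]
    [TopologicalSpace F] [IsNonarchimedeanLocalField F] (R : Type*) [AddCommGroup R] [Module F R]
    [FiniteDimensional F R] [TopologicalSpace R] [IsModuleTopology F R] :
    TotallyDisconnectedSpace R := by
  have := t2Space_of_finiteDimensional F R
  have := IsModuleTopology.topologicalAddGroup F R
  have : NonarchimedeanAddGroup R := ⟨fun s hs => by
    obtain ⟨γ, hγ, h⟩ := exists_coordBall_subset (Module.finBasis F R) hs
    exact ⟨⟨coordBall _ γ, isOpen_coordBall _ hγ⟩, h⟩⟩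
  infer_instance

theorem exists_isCompact_isOpen_subgroup_mirabolic (F : Type*) [Field F] [ValuativeRel F]
    [TopologicalSpace F] [IsNonarchimedeanLocalField F] {k : ℕ} {D : Type*} [Ring D] [Algebra F D]
    [FiniteDimensional F D] [TopologicalSpace D] [IsTopologicalRing D] [IsModuleTopology F D]
    {Ω : Set (P k D)} (hΩ : Ω ∈ 𝓝 1) :
    ∃ K : Subgroup (P k D), IsOpen (K : Set (P k D)) ∧ IsCompact (K : Set (P k D)) ∧
      (K : Set (P k D)) ⊆ Ω := by
  have : IsModuleTopology F (Matrix (Fin k) (Fin k) D) :=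
    inferInstanceAs (IsModuleTopology F (Fin k → Fin k → D))
  have := t2Space_of_finiteDimensional F D
  have := t2Space_of_finiteDimensional F (Matrix (Fin k) (Fin k) D)
  have := locallyCompactSpace_of_finiteDimensional F (Matrix (Fin k) (Fin k) D)
  have := totallyDisconnectedSpace_of_finiteDimensional F (Matrix (Fin k) (Fin k) D)
  have : T2Space (GLk k D) := Units.isEmbedding_embedProduct.t2Space
  have hP : IsClosed (P k D : Set (GLk k D)) :=
    isClosed_eq (f := fun g : GLk k D => Matrix.vecMul (lastRow k D) g.1)
      (continuous_const.matrix_vecMul Units.continuous_val) continuous_const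
  have : LocallyCompactSpace (P k D) := hP.isClosedEmbedding_subtypeVal.locallyCompactSpace
  have : TotallyDisconnectedSpace (P k D) := totallyDisconnectedSpace_of_injective
    (Units.continuous_val.comp continuous_subtype_val)
    (Units.val_injective.comp Subtype.val_injective)
  exact exists_isCompact_isOpen_subgroup hΩ

end CompactOpen

/-! ### The induced space inside the Kirillov model -/

section Gluing

open Topology

section Basic

variable {F : Type*} [Field F] {k : ℕ} {D : Type*} [Ring D] [Algebra F D]
  {V : Type*} [AddCommGroup V] [Module ℂ V]

/-- The projection of `π` to its twisted Jacquet module. -/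
def toWhJacquet (ψ : AddChar F Circle) (π : Representation ℂ (GLk k D) V) : V →ₗ[ℂ] WhJacquet ψ π :=
  (jacquetKer π (N k D) (psiN ψ k D)).mkQ

variable {ψ : AddChar F Circle} {π : Representation ℂ (GLk k D) V}

theorem toWhJacquet_eq_zero_iff {v : V} :
    toWhJacquet ψ π v = 0 ↔ v ∈ twistKer π (N k D) (eta ψ 1) := by
  rw [toWhJacquet, ← LinearMap.mem_ker, Submodule.ker_mkQ,
    jacquetKer_eq_twistKer π _ _ (eta ψ 1) (psiN_eq_eta ψ)]

theorem toWhJacquet_surjective : Function.Surjective (toWhJacquet ψ π) :=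
  Submodule.mkQ_surjective _

theorem toWhJacquet_map {n : GLk k D} (hn : n ∈ N k D) (v : V) :
    toWhJacquet ψ π (π n v) = (eta ψ 1 n : ℂ) • toWhJacquet ψ π v := by
  rw [← map_smul, ← sub_eq_zero, ← map_sub, toWhJacquet_eq_zero_iff]
  exact sub_mem_twistKer π (eta ψ 1) hn v

variable (ψ π) in
/-- The image of a vector in the Kirillov model, as a function on the mirabolic subgroup. -/
def kirillovFunction (v : V) (p : P k D) : WhJacquet ψ π :=
  toWhJacquet ψ π (π p v)

theorem kirillovFunction_mul_left {n : P k D} (hn : n.1 ∈ N k D) (p : P k D) (v : V) :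
    kirillovFunction ψ π v (n * p) = (eta ψ 1 n.1 : ℂ) • kirillovFunction ψ π v p := by
  rw [kirillovFunction, Subgroup.coe_mul, map_mul]
  exact toWhJacquet_map hn _

theorem kirillovFunction_map (v : V) (p q : P k D) :
    kirillovFunction ψ π (π q v) p = kirillovFunction ψ π v (p * q) := by
  rw [kirillovFunction, kirillovFunction, Subgroup.coe_mul, map_mul]
  rfl

theorem N_le_P (hk : 0 < k) : N k D ≤ P k D := by
  intro n hn
  change Matrix.vecMul (lastRow k D) n.1 = lastRow k D
  ext j
  have h1 : ∀ A : Matrix (Fin k) (Fin k) D, Matrix.vecMul (lastRow k D) A j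
      = A ⟨k - 1, by omega⟩ j := by
    intro A
    rw [Matrix.vecMul, dotProduct, Finset.sum_eq_single ⟨k - 1, by omega⟩]
    · rw [lastRow, if_pos (by dsimp only; omega), one_mul]
    · intro i _ hi
      rw [lastRow, if_neg, zero_mul]
      exact fun h => hi (Fin.ext (by dsimp only; omega))
    · simp
  have h2 : ¬ (⟨k - 1, by omega⟩ : Fin k) < j := by
    rw [Fin.lt_def]
    dsimp only
    omega
  rw [h1, hn _ _ h2, ← h1 1, Matrix.vecMul_one]

end Basic

variable {F : Type*} [Field F] [ValuativeRel F] [TopologicalSpace F] [IsNonarchimedeanLocalField F]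
    [CharZero F] {k : ℕ}
    {D : Type*} [Ring D] [Algebra F D] [IsSimpleRing D]
    [FiniteDimensional F D] [TopologicalSpace D] [IsTopologicalRing D] [IsModuleTopology F D]
    {V : Type*} [AddCommGroup V] [Module ℂ V]
    {ψ : AddChar F Circle} {π : Representation ℂ (GLk k D) V}

/-- Functions supported in `N K`, for a small compact open subgroup `K`, are in the image of the
Kirillov model. -/
theorem exists_kirillovFunction_eq_of_support_one (hψ : Continuous ψ) (hψ1 : ψ ≠ 1)
    (hsm : IsSmooth π) (hk : 0 < k)
    {K : Subgroup (P k D)} (hK : IsOpen (K : Set (P k D))) (hKc : IsCompact (K : Set (P k D)))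
    {f : P k D → WhJacquet ψ π}
    (hN : ∀ n : P k D, n.1 ∈ N k D → ∀ p, f (n * p) = (eta ψ 1 n.1 : ℂ) • f p)
    (hf : ∀ p, ∀ κ ∈ K, f (p * κ) = f p)
    (hs : ∀ p, f p ≠ 0 → ∃ n : P k D, n.1 ∈ N k D ∧ ∃ κ ∈ K, p = n * κ) :
    ∃ v ∈ kirillovCore ψ π, kirillovFunction ψ π v = f := by
  classical
  by_cases hf1 : f 1 = 0
  · refine ⟨0, Submodule.zero_mem _, funext fun p => ?_⟩
    rw [kirillovFunction, map_zero, map_zero]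
    by_contra hp
    obtain ⟨n, hn, κ, hκ, rfl⟩ := hs p (Ne.symm hp)
    have h1 := hf 1 κ hκ
    rw [one_mul, hf1] at h1
    rw [hN n hn, h1, smul_zero] at hp
    exact hp rfl
  obtain ⟨v₀, hv₀⟩ := toWhJacquet_surjective (f 1)
  obtain ⟨Ω, hΩ, hΩK⟩ : ∃ Ω ∈ 𝓝 (1 : GLk k D), ∀ g (hg : g ∈ P k D), g ∈ Ω → (⟨g, hg⟩ : P k D) ∈ K := by
    have h1 : (K : Set (P k D)) ∈ 𝓝 (1 : P k D) := hK.mem_nhds K.one_mem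
    rw [nhds_subtype, Filter.mem_comap] at h1
    obtain ⟨Ω, hΩ, h⟩ := h1
    exact ⟨Ω, hΩ, fun g hg hgΩ => h hgΩ⟩
  obtain ⟨v, hv, hv1, hvK⟩ := exists_mem_kirillovCore (K := K.map (P k D).subtype) hψ hψ1 hsm hk hΩ
    (fun g hg hgP => ⟨⟨g, hgP⟩, hΩK g hgP hg, rfl⟩) v₀
  set h := kirillovFunction ψ π v with hh
  have h1 : h 1 = f 1 := by
    rw [← hv₀, ← sub_eq_zero, hh, kirillovFunction, Subgroup.coe_one, map_one,
      Module.End.one_apply, ← map_sub]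
    exact toWhJacquet_eq_zero_iff.2 hv1
  -- On `N K` the function `f` is determined by `f 1`, the class of `v₀`; so wherever `h` is
  -- non-zero it equals `f`. Only the support of `h` may be too small, and averaging over `K`
  -- repairs this.
  have h2 : ∀ p, h p = (if h p ≠ 0 then (1 : ℂ) else 0) • f p := by
    intro p
    split_ifs with h0
    · rw [one_smul]
      rcases hvK p p.2 with h3 | ⟨n, hn, _, ⟨κ, hκ, rfl⟩, e, h3⟩
      · exact absurd (toWhJacquet_eq_zero_iff.2 h3) h0
      · have e' : p = ⟨n, N_le_P hk hn⟩ * κ := Subtype.ext e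
        rw [← toWhJacquet_eq_zero_iff, map_sub, sub_eq_zero, map_smul, hv₀] at h3
        rw [hh, kirillovFunction, h3, e', hN _ hn, ← one_mul κ, hf 1 κ hκ]
    · rw [zero_smul]
      exact not_not.1 h0
  have : CompactSpace K := isCompact_iff_compactSpace.1 hKc
  have hu : IsUniform fun κ : K => π κ v := by
    have hc : Continuous fun κ : K => ((κ : P k D) : GLk k D) :=
      continuous_subtype_val.comp continuous_subtype_val
    let S : Subgroup K :=
      { carrier := {κ | π κ v = v}
        one_mem' := by simp
        mul_mem' := fun {a b} ha hb => by
          have ha' : π a v = v := ha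
          have hb' : π b v = v := hb
          change π (a * b) v = v
          rw [map_mul, Module.End.mul_apply, hb', ha']
        inv_mem' := fun {a} ha => by
          have ha' : π a v = v := ha
          change π (a⁻¹ : GLk k D) v = v
          conv_lhs => rw [← ha']
          rw [← Module.End.mul_apply, ← map_mul, inv_mul_cancel, map_one, Module.End.one_apply] }
    refine isUniform_of_isOpen S ((hsm v).preimage hc) fun a s hs => ?_
    have hs' : π s v = v := hs
    change π (a * s) v = _
    rw [map_mul, Module.End.mul_apply, hs']
  -- The proportion of `K` on which `h` does not vanish; it is non-zero since `h 1 = f 1 ≠ 0`.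
  let c : ℂ := average fun κ : K => if h κ ≠ 0 then (1 : ℂ) else 0
  have hh' : ∀ p, IsUniform fun κ : K => h (p * κ) := by
    intro p
    have := hu.comp fun w => kirillovFunction ψ π w p
    simp only [kirillovFunction_map] at this
    exact this
  have hc : c ≠ 0 := by
    have h3 := (hh' 1).comp (· ≠ 0)
    simp only [one_mul] at h3
    have h4 := average_indicator_ne_zero h3 (a := 1) (by
      change h 1 ≠ 0
      rwa [h1])
    convert h4
  have hav : ∀ p, kirillovFunction ψ π (average fun κ : K => π κ v) p = c • f p := by
    intro p
    have h3 : kirillovFunction ψ π (average fun κ : K => π κ v) p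
        = average fun κ : K => h (p * κ) := by
      change (toWhJacquet ψ π ∘ₗ π p) _ = _
      rw [map_average hu]
      congr 1
      funext κ
      exact kirillovFunction_map v p κ
    rw [h3]
    by_cases hp : f p = 0
    · rw [hp, smul_zero]
      have h4 : ∀ κ : K, h (p * κ) = 0 := fun κ => by rw [h2, hf p κ κ.2, hp, smul_zero]
      simp only [h4, average_const]
    · have h4 : ∀ κ : K, h (p * κ) = (if h (p * κ) ≠ 0 then (1 : ℂ) else 0) • f p := fun κ => by
        conv_lhs => rw [h2, hf p κ κ.2]
      obtain ⟨n, hn, κ₀, hκ₀, rfl⟩ := hs p hp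
      -- The factor `n` acts by a non-zero scalar and `κ₀` by a left translation of `K`, so the
      -- proportion is the same `c` at every point of `N K`.
      have h5 : ∀ κ : K, h (n * κ₀ * κ) ≠ 0 ↔ h ((⟨κ₀, hκ₀⟩ * κ : K) : P k D) ≠ 0 := fun κ => by
        rw [mul_assoc, hh, kirillovFunction_mul_left hn, smul_ne_zero_iff_right (Circle.coe_ne_zero _)]
        rfl
      rw [funext h4]
      simp only [h5]
      have hu1 : IsUniform fun κ : K => if h κ ≠ 0 then (1 : ℂ) else 0 := by
        have := (hh' 1).comp fun w => if w ≠ 0 then (1 : ℂ) else 0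
        simpa only [one_mul] using this
      have h6 := map_average (hu1.mul_left ⟨κ₀, hκ₀⟩) (LinearMap.toSpanSingleton ℂ _ (f (n * κ₀)))
      rw [average_mul_left hu1] at h6
      exact h6.symm
  refine ⟨c⁻¹ • average fun κ : K => π κ v, Submodule.smul_mem _ _ (average_mem fun κ =>
    map_mem_kirillovCore hv κ.1.2), funext fun p => ?_⟩
  have := hav p
  rw [kirillovFunction] at this ⊢
  rw [map_smul, map_smul, this, smul_smul, inv_mul_cancel₀ hc, one_smul]

/-- Right translation by `t` moves the support from `N t K` to `N (t K t⁻¹)`, where the previous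
case applies; `π t⁻¹` undoes it without leaving the core. -/
theorem exists_kirillovFunction_eq_of_support_singleton (hψ : Continuous ψ) (hψ1 : ψ ≠ 1)
    (hsm : IsSmooth π) (hk : 0 < k)
    {K : Subgroup (P k D)} (hK : IsOpen (K : Set (P k D))) (hKc : IsCompact (K : Set (P k D)))
    {f : P k D → WhJacquet ψ π}
    (hN : ∀ n : P k D, n.1 ∈ N k D → ∀ p, f (n * p) = (eta ψ 1 n.1 : ℂ) • f p)
    (hf : ∀ p, ∀ κ ∈ K, f (p * κ) = f p) (t : P k D)
    (hs : ∀ p, f p ≠ 0 → ∃ n : P k D, n.1 ∈ N k D ∧ ∃ κ ∈ K, p = n * t * κ) :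
    ∃ v ∈ kirillovCore ψ π, kirillovFunction ψ π v = f := by
  have hcont : Continuous (MulAut.conj t : P k D → P k D) := by
    change Continuous fun x => t * x * t⁻¹
    fun_prop
  have hcont' : Continuous fun x : P k D => t⁻¹ * x * t := by fun_prop
  have e : ((K.map (MulAut.conj t).toMonoidHom : Subgroup (P k D)) : Set (P k D))
      = (fun x => t⁻¹ * x * t) ⁻¹' K := by
    ext x
    constructor
    · rintro ⟨κ, hκ, rfl⟩
      change t⁻¹ * (t * κ * t⁻¹) * t ∈ K
      have : t⁻¹ * (t * κ * t⁻¹) * t = κ := by group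
      rwa [this]
    · intro hx
      refine ⟨_, hx, ?_⟩
      change t * (t⁻¹ * x * t) * t⁻¹ = x
      group
  obtain ⟨v, hv, h⟩ := exists_kirillovFunction_eq_of_support_one hψ hψ1 hsm hk
    (K := K.map (MulAut.conj t).toMonoidHom) (f := fun p => f (p * t))
    (by
      rw [e]
      exact hK.preimage hcont')
    (by
      rw [Subgroup.coe_map]
      exact hKc.image hcont)
    (fun n hn p => by rw [mul_assoc, hN n hn])
    (by
      rintro p _ ⟨κ, hκ, rfl⟩
      change f (p * (t * κ * t⁻¹) * t) = _
      rw [← hf (p * t) κ hκ]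
      congr 1
      group)
    (by
      intro p hp
      obtain ⟨n, hn, κ, hκ, e⟩ := hs _ hp
      refine ⟨n, hn, _, ⟨κ, hκ, rfl⟩, ?_⟩
      change p = n * (t * κ * t⁻¹)
      rw [← mul_left_inj t, e]
      group)
  refine ⟨π (t⁻¹ : P k D) v, map_mem_kirillovCore hv (t⁻¹ : P k D).2, funext fun p => ?_⟩
  rw [kirillovFunction_map, h]
  exact congrArg f (inv_mul_cancel_right p t)

/-- Restricting `f` to a double coset `N t K`, or to its complement, preserves both equivariance
conditions, so double cosets can be split off one at a time. -/
theorem exists_kirillovFunction_eq_of_support_finite (hψ : Continuous ψ) (hψ1 : ψ ≠ 1)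
    (hsm : IsSmooth π) (hk : 0 < k)
    {K : Subgroup (P k D)} (hK : IsOpen (K : Set (P k D))) (hKc : IsCompact (K : Set (P k D)))
    (T : Finset (P k D)) :
    ∀ f : P k D → WhJacquet ψ π,
    (∀ n : P k D, n.1 ∈ N k D → ∀ p, f (n * p) = (eta ψ 1 n.1 : ℂ) • f p) →
    (∀ p, ∀ κ ∈ K, f (p * κ) = f p) →
    (∀ p, f p ≠ 0 → ∃ t ∈ T, ∃ n : P k D, n.1 ∈ N k D ∧ ∃ κ ∈ K, p = n * t * κ) →
    ∃ v ∈ kirillovCore ψ π, kirillovFunction ψ π v = f := by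
  classical
  induction T using Finset.induction_on with
  | empty =>
    intro f _ _ hs
    refine ⟨0, Submodule.zero_mem _, funext fun p => ?_⟩
    rw [kirillovFunction, map_zero, map_zero]
    by_contra hp
    obtain ⟨t, ht, -⟩ := hs p (Ne.symm hp)
    simp at ht
  | insert t T _ ih =>
    intro f hN hf hs
    let Q : P k D → Prop := fun p => ∃ n : P k D, n.1 ∈ N k D ∧ ∃ κ ∈ K, p = n * t * κ
    have hQN : ∀ n : P k D, n.1 ∈ N k D → ∀ p, Q (n * p) ↔ Q p := by
      refine fun n hn p => ⟨?_, ?_⟩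
      · rintro ⟨n', hn', κ, hκ, e⟩
        refine ⟨n⁻¹ * n', mul_mem (inv_mem hn) hn', κ, hκ, ?_⟩
        rw [mul_assoc, mul_assoc, ← mul_assoc n', ← e, inv_mul_cancel_left]
      · rintro ⟨n', hn', κ, hκ, rfl⟩
        exact ⟨n * n', mul_mem hn hn', κ, hκ, by simp only [mul_assoc]⟩
    have hQK : ∀ p, ∀ κ ∈ K, Q (p * κ) ↔ Q p := by
      refine fun p κ hκ => ⟨?_, ?_⟩
      · rintro ⟨n', hn', κ', hκ', e⟩
        refine ⟨n', hn', κ' * κ⁻¹, mul_mem hκ' (inv_mem hκ), ?_⟩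
        rw [← mul_assoc, ← e, mul_inv_cancel_right]
      · rintro ⟨n', hn', κ', hκ', rfl⟩
        exact ⟨n', hn', κ' * κ, mul_mem hκ' hκ, by simp only [mul_assoc]⟩
    obtain ⟨v, hv, h⟩ := exists_kirillovFunction_eq_of_support_singleton hψ hψ1 hsm hk hK hKc
      (f := fun p => if Q p then f p else 0)
      (fun n hn p => by
        simp only [hQN n hn, hN n hn]
        split_ifs <;> simp)
      (fun p κ hκ => by simp only [hQK p κ hκ, hf p κ hκ]) t
      (fun p hp => by
        by_contra hc
        exact hp (if_neg hc))
    obtain ⟨v', hv', h'⟩ := ih (fun p => if Q p then 0 else f p)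
      (fun n hn p => by
        simp only [hQN n hn, hN n hn]
        split_ifs <;> simp)
      (fun p κ hκ => by simp only [hQK p κ hκ, hf p κ hκ])
      (fun p hp => by
        have hQ : ¬ Q p := fun hQ => hp (if_pos hQ)
        rw [if_neg hQ] at hp
        obtain ⟨t', ht', hp'⟩ := hs p hp
        rcases Finset.mem_insert.1 ht' with rfl | ht'
        · exact absurd hp' hQ
        · exact ⟨t', ht', hp'⟩)
    refine ⟨v + v', Submodule.add_mem _ hv hv', funext fun p => ?_⟩
    have e1 := congrFun h p
    have e2 := congrFun h' p
    rw [kirillovFunction] at e1 e2 ⊢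
    rw [map_add, map_add, e1, e2]
    split_ifs <;> simp

theorem Ind_mul_left (f : Ind ψ π) (n : P k D) (hn : n.1 ∈ N k D) (p : P k D) :
    f.1 (n * p) = (eta ψ 1 n.1 : ℂ) • f.1 p := by
  have h1 := f.2.1 ⟨n, hn⟩ p
  have h2 := psiN_eq_eta ψ (⟨n, hn⟩ : N k D)
  rw [← h2]
  exact h1

/-- Every function in the compactly induced space comes from a vector of `π`. -/
theorem exists_kirillovFunction_eq (hψ : Continuous ψ) (hψ1 : ψ ≠ 1) (hsm : IsSmooth π)
    (hk : 0 < k) (f : Ind ψ π) : ∃ v ∈ kirillovCore ψ π, kirillovFunction ψ π v = f.1 := by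
  classical
  obtain ⟨-, ⟨K', hK'⟩, ⟨C, hC, hCs⟩⟩ := f.2
  obtain ⟨K, hK, hKc, hKK'⟩ := exists_isCompact_isOpen_subgroup_mirabolic F (k := k) (D := D)
    (Ω := K') (K'.isOpen.mem_nhds K'.one_mem)
  obtain ⟨T, hT⟩ := hC.elim_finite_subcover (fun t : P k D => (fun x => t⁻¹ * x) ⁻¹' (K : Set (P k D)))
    (fun t => hK.preimage (continuous_const_mul t⁻¹))
    (fun c _ => Set.mem_iUnion.2 ⟨c, by simp⟩)
  refine exists_kirillovFunction_eq_of_support_finite hψ hψ1 hsm hk hK hKc T f.1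
    (Ind_mul_left f) (fun p κ hκ => hK' κ (hKK' hκ) p) fun p hp => ?_
  obtain ⟨n, c, hc, rfl⟩ := hCs p hp
  obtain ⟨t, ht, hct⟩ := Set.mem_iUnion₂.1 (hT hc)
  refine ⟨t, ht, n, n.2, t⁻¹ * c, hct, ?_⟩
  rw [mul_assoc, mul_inv_cancel_left]

/-- Reduces linearity and equivariance of the embedding to identities between Kirillov functions. -/
theorem kirillovFunction_injOn (hψ : Continuous ψ) (hψ1 : ψ ≠ 1) (hsm : IsSmooth π)
    (hk : 0 < k) {v v' : V} (hv : v ∈ kirillovCore ψ π) (hv' : v' ∈ kirillovCore ψ π)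
    (h : kirillovFunction ψ π v = kirillovFunction ψ π v') : v = v' := by
  rw [← sub_eq_zero]
  refine eq_zero_of_mem_kirillovCore hψ hψ1 hsm hk (Submodule.sub_mem _ hv hv') fun p hp => ?_
  rw [← coe_N_eq_unipSet, ← toWhJacquet_eq_zero_iff, map_sub, map_sub, sub_eq_zero]
  exact congrFun h ⟨p, hp⟩

end Gluing

/-! ### The embedding of the induced space, and its cuspidality -/

section Embedding

open Topology

variable {F : Type*} [Field F] [ValuativeRel F] [TopologicalSpace F] [IsNonarchimedeanLocalField F]
    [CharZero F] {k : ℕ}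
    {D : Type*} [Ring D] [Algebra F D] [IsSimpleRing D]
    [FiniteDimensional F D] [TopologicalSpace D] [IsTopologicalRing D] [IsModuleTopology F D]
    {V : Type*} [AddCommGroup V] [Module ℂ V]
    {ψ : AddChar F Circle} {π : Representation ℂ (GLk k D) V}

/-- The induced space embeds into `π`, inverting the map to the Kirillov model. -/
theorem exists_linearMap_kirillovFunction_eq (hψ : Continuous ψ) (hψ1 : ψ ≠ 1) (hsm : IsSmooth π)
    (hk : 0 < k) : ∃ J : Ind ψ π →ₗ[ℂ] V,
      ∀ f, J f ∈ kirillovCore ψ π ∧ kirillovFunction ψ π (J f) = f.1 := by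
  choose φ hφ hφ' using exists_kirillovFunction_eq (ψ := ψ) (π := π) hψ hψ1 hsm hk
  refine ⟨{ toFun := φ, map_add' := fun f g => ?_, map_smul' := fun c f => ?_ },
    fun f => ⟨hφ f, hφ' f⟩⟩
  · refine kirillovFunction_injOn hψ hψ1 hsm hk (hφ _) (Submodule.add_mem _ (hφ f) (hφ g)) ?_
    ext p
    have e1 := congrFun (hφ' f) p
    have e2 := congrFun (hφ' g) p
    rw [hφ']
    rw [kirillovFunction] at e1 e2 ⊢
    rw [map_add, map_add, e1, e2]
    rfl
  · refine kirillovFunction_injOn hψ hψ1 hsm hk (hφ _) (Submodule.smul_mem _ c (hφ f)) ?_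
    ext p
    have e1 := congrFun (hφ' f) p
    rw [hφ']
    rw [kirillovFunction] at e1 ⊢
    rw [RingHom.id_apply, map_smul, map_smul, e1]
    rfl

theorem kirillovFunction_diag (d : Dˣ) (v : V) (p : P k D) :
    kirillovFunction ψ π (π (diag k D d) v) p
      = diagJacquet ψ π d (kirillovFunction ψ π v ((conjP d).symm p)) := by
  have e : (p : GLk k D) * diag k D d = diag k D d * ((conjP d).symm p : P k D) := by
    change (p : GLk k D) * diag k D d = diag k D d * ((diag k D d)⁻¹ * (p : GLk k D) * diag k D d)
    group
  rw [kirillovFunction, ← Module.End.mul_apply, ← map_mul, e, map_mul]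
  rfl

theorem unipRel_top_comp {a : ℕ} (i j l : Fin k) (h : unipRel k a k i j) :
    ¬ unipRel k a k j l := by
  unfold unipRel at *
  omega

theorem blockUnip_mem_U (a : ℕ) (x : Fin k → Fin k → D) :
    blockUnip (unipRel k a k) unipRel_top_comp x ∈ U k D a := by
  rw [← SetLike.mem_coe, coe_U_eq_unipSet]
  exact suppOn_blockUnip x

theorem U_le_P {a : ℕ} (hak : a < k) : U k D a ≤ P k D := by
  refine le_trans ?_ (N_le_P (by omega))
  exact fun g hg => SuppOn.mono hg fun i j h => Fin.lt_def.2 (by omega)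

/-- The elements of `U'_{a,b}`, as elements of the mirabolic subgroup. -/
def mirabolicUnip {a : ℕ} (hak : a < k) (x : Fin k → Fin k → D) : P k D :=
  ⟨blockUnip (unipRel k a k) unipRel_top_comp x, U_le_P hak (blockUnip_mem_U a x)⟩

theorem mirabolicUnip_zero {a : ℕ} (hak : a < k) :
    mirabolicUnip hak (0 : Fin k → Fin k → D) = 1 :=
  Subtype.ext (blockUnip_zero (hr := unipRel_top_comp))

theorem mirabolicUnip_add {a : ℕ} (hak : a < k) (x y : Fin k → Fin k → D) :
    mirabolicUnip hak (x + y) = mirabolicUnip hak x * mirabolicUnip hak y :=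
  Subtype.ext (blockUnip_add (hr := unipRel_top_comp) x y)

theorem continuous_mirabolicUnip {a : ℕ} (hak : a < k) :
    Continuous (mirabolicUnip hak : (Fin k → Fin k → D) → P k D) :=
  continuous_blockUnip.subtype_mk _

theorem isSmoothAction_IndRep {a : ℕ} (hak : a < k) :
    IsSmoothAction fun x : Fin k → Fin k → D => IndRep ψ π (mirabolicUnip hak x) where
  zero := by
    rw [mirabolicUnip_zero]
    exact map_one (IndRep ψ π)
  add x y := by
    rw [mirabolicUnip_add]
    exact map_mul (IndRep ψ π) _ _
  smooth f := by
    obtain ⟨-, ⟨K, hK⟩, -⟩ := f.2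
    refine ⟨mirabolicUnip hak ⁻¹' K, (continuous_mirabolicUnip hak).continuousAt
      (K.isOpen.mem_nhds ?_), fun x hx => ?_⟩
    · rw [mirabolicUnip_zero]
      exact K.one_mem
    · exact Subtype.ext (funext fun p => hK _ hx p)

theorem isSmoothAction_mirabolicUnip (hsm : IsSmooth π) {a : ℕ} (hak : a < k) :
    IsSmoothAction fun x : Fin k → Fin k → D => π (mirabolicUnip hak x) where
  zero := by
    rw [mirabolicUnip_zero]
    exact map_one π
  add x y := by
    rw [mirabolicUnip_add]
    exact map_mul π _ _
  smooth w := by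
    refine ⟨_, (continuous_subtype_val.comp (continuous_mirabolicUnip hak)).continuousAt
      ((hsm w).mem_nhds ?_), fun x hx => hx⟩
    simp [mirabolicUnip_zero]

/-- `J f` dies in the coinvariants of `U'_{a,b}` on `V`, through finitely many elements, which lie
in one lattice `L`. Hence the average of `J f` over `L` is zero; by equivariance and injectivity so
is that of `f`, and `f` dies in the coinvariants of the induced space itself. -/
theorem isDCuspidal_IndRep (hψ : Continuous ψ) (hψ1 : ψ ≠ 1) (hsm : IsSmooth π)
    {J : Ind ψ π →ₗ[ℂ] V} (hJ : Function.Injective J) (hJc : ∀ f, J f ∈ kirillovCore ψ π)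
    (hJP : ∀ (p : P k D) f, J (IndRep ψ π p f) = π p (J f)) : IsDCuspidal (IndRep ψ π) := by
  intro a b ha hb hab
  have hak : a < k := by omega
  refine Submodule.Quotient.subsingleton_iff.2 (eq_top_iff.2 fun f _ => ?_)
  refine (jacquetKer_eq_twistKer (IndRep ψ π) ((U k D a).subgroupOf (P k D)) 1 1 fun _ => rfl).ge ?_
  obtain ⟨S, hS, hSf, hfS⟩ := exists_finite_twistKer
    (mem_twistKer_one_of_mem_kirillovCore hψ hψ1 hsm ha hak (hJc f))
  obtain ⟨L, -, hL, hSL⟩ := exists_lattice (Module.finBasis F (Fin k → Fin k → D))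
    (hSf.image fun (g : GLk k D) (i j : Fin k) => g.1 i j).isCompact
  have hT := isSmoothAction_IndRep (ψ := ψ) (π := π) hak
  have hT' := isSmoothAction_mirabolicUnip hsm hak
  set T : (Fin k → Fin k → D) → Ind ψ π →ₗ[ℂ] Ind ψ π := fun x => IndRep ψ π (mirabolicUnip hak x)
  set T' : (Fin k → Fin k → D) → V →ₗ[ℂ] V := fun x => π (mirabolicUnip hak x)
  have hχ : ∃ U ∈ 𝓝 (0 : Fin k → Fin k → D), ∀ x ∈ U, (1 : AddChar (Fin k → Fin k → D) Circle) x = 1 :=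
    ⟨Set.univ, Filter.univ_mem, fun _ _ => rfl⟩
  have h0 : latticeAverage T' 1 L (J f) = 0 := by
    refine latticeAverage_eq_zero hT' hχ hL ?_
    suffices twistKer π S 1 ≤ twistKer T' L (1 : AddChar (Fin k → Fin k → D) Circle) from
      this hfS
    refine twistKer_le fun g hg w => ?_
    have e : π g = T' fun i j => g.1 i j :=
      congrArg π (blockUnip_eq (hr := unipRel_top_comp) (hS hg) _ fun _ _ _ => rfl)
    have := sub_mem_twistKer T' (1 : AddChar (Fin k → Fin k → D) Circle)
      (hSL ⟨g, hg, rfl⟩) w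
    rwa [← e] at this
  have h1 : latticeAverage T 1 L f = 0 := by
    apply hJ
    rw [map_zero, ← h0, latticeAverage, latticeAverage,
      map_average (isUniform_latticeAverage hT hχ hL f)]
    congr 1
    funext x
    rw [map_smul, hJP]
  have h2 := sub_latticeAverage_mem hT hχ hL f
  rw [h1, zero_sub, Submodule.neg_mem_iff] at h2
  suffices twistKer T L (1 : AddChar (Fin k → Fin k → D) Circle) ≤ _ from this h2
  exact twistKer_le fun x _ w => sub_mem_twistKer (IndRep ψ π) 1
    (Subgroup.mem_subgroupOf.2 (blockUnip_mem_U a x)) w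

end Embedding

end Kirillov

end

/-! ### The embedding and its equivariance -/

theorem mainTheorem8
    {F : Type*} [Field F] [ValuativeRel F] [TopologicalSpace F] [IsNonarchimedeanLocalField F]
    [CharZero F]
    {D : Type*} [Ring D] [Algebra F D] [Algebra.IsCentral F D] [IsSimpleRing D]
    [FiniteDimensional F D] [TopologicalSpace D] [IsTopologicalRing D] [IsModuleTopology F D]
    (ψ : AddChar F Circle) (hψ : Continuous ψ) (hψ1 : ψ ≠ 1)
    (k : ℕ) (hk : 0 < k)
    {V : Type*} [AddCommGroup V] [Module ℂ V]
    (π : Representation ℂ (Kirillov.GLk k D) V)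
    (hsm : Kirillov.IsSmooth π) (hirr : π.IsIrreducible) :
    (∃ J : Kirillov.Ind ψ π →ₗ[ℂ] V,
      Function.Injective J ∧
      (∀ (p : Kirillov.P k D) (f : Kirillov.Ind ψ π), J (Kirillov.IndRep ψ π p f) = π p (J f)) ∧
      (∀ (d : Dˣ) (f : Kirillov.Ind ψ π),
        J (Kirillov.diagInd ψ π d f) = π (Kirillov.diag k D d) (J f)) ∧
      (∀ (p : Kirillov.P k D) (d : Dˣ) (f : Kirillov.Ind ψ π),
        J (Kirillov.IndRep ψ π p (Kirillov.diagInd ψ π d f))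
          = π (p * Kirillov.diag k D d) (J f)) ∧
      (∀ (l : Kirillov.Wh ψ π) (f : Kirillov.Ind ψ π),
        l.1 (J f) = Kirillov.descend l (f.1 1))) ∧
    Kirillov.IsDCuspidal (Kirillov.IndRep ψ π) := by
  obtain ⟨J, hJ⟩ := Kirillov.exists_linearMap_kirillovFunction_eq (ψ := ψ) (π := π) hψ hψ1 hsm hk
  have hinj : Function.Injective J := fun f g h => Subtype.ext (by
    rw [← (hJ f).2, h, (hJ g).2])
  have hP : ∀ (p : Kirillov.P k D) (f : Kirillov.Ind ψ π),
      J (Kirillov.IndRep ψ π p f) = π p (J f) := fun p f => by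
    refine Kirillov.kirillovFunction_injOn hψ hψ1 hsm hk (hJ _).1
      (Kirillov.map_mem_kirillovCore (hJ f).1 p.2) ?_
    ext q
    rw [(hJ _).2, Kirillov.kirillovFunction_map, (hJ f).2]
    rfl
  have hD : ∀ (d : Dˣ) (f : Kirillov.Ind ψ π),
      J (Kirillov.diagInd ψ π d f) = π (Kirillov.diag k D d) (J f) := fun d f => by
    refine Kirillov.kirillovFunction_injOn hψ hψ1 hsm hk (hJ _).1
      (Kirillov.diag_mem_kirillovCore (hJ f).1 d) ?_
    ext q
    rw [(hJ _).2, Kirillov.kirillovFunction_diag, (hJ f).2]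
    rfl
  refine ⟨⟨J, hinj, hP, hD, fun p d f => ?_, fun l f => ?_⟩,
    Kirillov.isDCuspidal_IndRep hψ hψ1 hsm hinj (fun f => (hJ f).1) hP⟩
  · rw [hP, hD, map_mul]
    rfl
  -- At `1` the Kirillov function of `J f` is the class of `J f` in the Jacquet module, on which the
  -- induced functional is `l (J f)` by definition.
  · rw [← (hJ f).2, Kirillov.kirillovFunction, Subgroup.coe_one, map_one, Module.End.one_apply]
    rfl
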